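/- Let $k$ be a field with $2\neq 0$ in $k$. Let $B$ and $B^\star$ be super-Hopf algebras over $k$, i.e. $\mathbb{Z}/2$-graded algebras and coalgebras with graded coproduct $\Delta b=b_{(1)}\otimes b_{(2)}$, counit $\epsilon$ and antipode, the coproduct being an algebra map to the super tensor product $(a\otimes b)(c\otimes d)=(-1)^{|b||c|}ac\otimes bd$; assume that the antipode of $B^\star$ is bijective. Let $\mathrm{ev}:B^\star\otimes B\to k$ be a (possibly degenerate) duality pairing, i.e. for all $c,d\in B^\star$, $a,b\in B$: $\mathrm{ev}(c,b)=0$ for homogeneous $c,b$ with $|c|+|b|\neq 0$, $\mathrm{ev}(cd,b)=\mathrm{ev}(d,b_{(1)})\,\mathrm{ev}(c,b_{(2)})$, $\mathrm{ev}(c,ab)=\mathrm{ev}(c_{(1)},b)\,\mathrm{ev}(c_{(2)},a)$, $\mathrm{ev}(1,b)=\epsilon(b)$, $\mathrm{ev}(c,1)=\epsilon(c)$. Let $\mathbb{Z}'_{/2}$ be the group algebra $k\langle g\mid g^2=1\rangle$. In the formulas below, elements and the components of their coproducts are homogeneous; the formulas are extended linearly. (1) Let $D(B)$ be the algebra generated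 by $B$ and $B^{\star\underline{\mathrm{op}}}$ (the space $B^\star$ with product $c\cdot_{\underline{\mathrm{op}}}d=(-1)^{|c||d|}dc$), with the cross relations $$b_{(1)}c_{(1)}\,\mathrm{ev}(c_{(2)},b_{(2)})\,(-1)^{|b_{(1)}||c|}=(-1)^{|c_{(1)}||c_{(2)}|}\,\mathrm{ev}(c_{(1)},b_{(1)})\,c_{(2)}b_{(2)}\qquad(b\in B,\ c\in B^\star).$$ Then $B^{\star\underline{\mathrm{op}}}$ and $B$ are subalgebras of $D(B)$, the map $B^\star\otimes B\to D(B)$, $c\otimes b\mapsto cb$, is bijective, and $D(B)$, with the grading and the coproducts and counits of $B^\star$ and $B$, is a super-Hopf algebra. (2) Let $\mathbb{Z}'_{/2}\ltimes D(B)$ be the bosonisation: the algebra generated by $\mathbb{Z}'_{/2}$ and $D(B)$ with $xg=(-1)^{|x|}gx$, and with $\Delta g=g\otimes g$, $\Delta x=x_{(1)}\otimes g^{|x_{(1)}|}x_{(2)}$ for $x\in D(B)$ (on the right, $x_{(1)}\otimes x_{(2)}$ is the coproduct of $D(B)$). This is a Hopf algebra, and $h\otimes x\mapsto hx$ is a bijection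 from $\mathbb{Z}'_{/2}\otimes D(B)$ to it. (3) Let $B^{\star\mathrm{op}}\rtimes\mathbb{Z}'_{/2}\ltimes B$ be the double-bosonisation for $n=2$, $q=-1$: the algebra generated by $B^{\star\mathrm{op}}$ (the space $B^\star$ with product $c\cdot_{\mathrm{op}}d=dc$), $\mathbb{Z}'_{/2}$ and $B$ with the cross relations $$bg=(-1)^{|b|}gb,\qquad cg=(-1)^{|c|}gc,\qquad b_{(1)}g^{|c_{(2)}|}c_{(1)}\,\mathrm{ev}(c_{(2)},b_{(2)})=\mathrm{ev}(c_{(1)},b_{(1)})\,c_{(2)}g^{|b_{(1)}|}b_{(2)},$$ and with $\Delta g=g\otimes g$, $\Delta b=b_{(1)}\otimes g^{|b_{(1)}|}b_{(2)}$, $\Delta c=g^{|c_{(2)}|}c_{(1)}\otimes c_{(2)}$ (the components on the right being those of the coproducts of $B$ and $B^\star$). This is a Hopf algebra, and $c\otimes h\otimes b\mapsto chb$ is a bijection from $B^\star\otimes\mathbb{Z}'_{/2}\otimes B$ to it. (4) There is an isomorphism of Hopf algebras $$\theta:\ \mathbb{Z}'_{/2}\ltimes D(B)\ \longrightarrow\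 B^{\star\mathrm{op}}\rtimes\mathbb{Z}'_{/2}\ltimes B,\qquad \theta(g)=g,\quad\theta(b)=b,\quad\theta(c)=g^{|c|}c$$ for all $b\in B$ and homogeneous $c\in B^\star$. In (2) and (3) the counits are $\epsilon(g)=1$ and, on the other generators, those of $D(B)$, $B$ and $B^\star$. -/

import Mathlib

open scoped TensorProduct

noncomputable section

namespace SuperDouble

/-! Super vector spaces are spaces graded by `ZMod 2`; the sign `(-1)^i`, for `i : ZMod 2`, is the
unit `(-1 : ℤˣ) ^ i`, which acts on every module.  This is the convention of the super tensor
product `𝒜 ᵍ⊗[k] ℬ` of Mathlib. -/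

section SuperHopf

variable {k : Type*} [Field k] {B : Type*} [Ring B] [Algebra k B] [Coalgebra k B]

/-- A Sweedler presentation `Δ b = ∑ₛ b₁ ⊗ b₂` in which all the `b₁`, `b₂` are homogeneous; the
degrees are `|b₁| = deg₁ s`, `|b₂| = deg₂ s`. -/
structure SuperRepr (𝓑 : ZMod 2 → Submodule k B) (b : B) where
  n : ℕ
  fst : Fin n → B
  snd : Fin n → B
  deg₁ : Fin n → ZMod 2
  deg₂ : Fin n → ZMod 2
  fst_mem : ∀ s, fst s ∈ 𝓑 (deg₁ s)
  snd_mem : ∀ s, snd s ∈ 𝓑 (deg₂ s)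
  eq : ∑ s, fst s ⊗ₜ[k] snd s = Coalgebra.comul (R := k) b

/-- Homogeneous Sweedler presentations always exist. -/
theorem SuperRepr.nonempty (𝓑 : ZMod 2 → Submodule k B) [GradedAlgebra 𝓑] (b : B) :
    Nonempty (SuperRepr 𝓑 b) := by
  classical
  obtain ⟨S, hS⟩ := TensorProduct.exists_finset (R := k) (Coalgebra.comul (R := k) b)
  let e := Fintype.equivFin (S × ZMod 2 × ZMod 2)
  let p : ZMod 2 → B → B := fun i x => (DirectSum.decompose 𝓑 x i : B)
  have hp : ∀ x : B, x = ∑ i, p i x := fun x => by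
    have h := DirectSum.sum_support_decompose 𝓑 x
    rw [← h]
    refine (Finset.sum_subset (Finset.subset_univ _) ?_).trans ?_
    · intro i _ hi
      simpa using hi
    · rw [h]
  refine ⟨⟨_, fun s => p (e.symm s).2.1 (e.symm s).1.1.1, fun s => p (e.symm s).2.2 (e.symm s).1.1.2,
    fun s => (e.symm s).2.1, fun s => (e.symm s).2.2, fun s => SetLike.coe_mem _,
    fun s => SetLike.coe_mem _, ?_⟩⟩
  rw [Equiv.sum_comp e.symm (fun z : S × ZMod 2 × ZMod 2 => p z.2.1 z.1.1.1 ⊗ₜ[k] p z.2.2 z.1.1.2),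
    hS, ← Finset.sum_coe_sort S, Fintype.sum_prod_type]
  refine Finset.sum_congr rfl fun x _ => ?_
  conv_rhs => rw [hp x.1.1, hp x.1.2]
  rw [TensorProduct.sum_tmul, Fintype.sum_prod_type]
  simp_rw [TensorProduct.tmul_sum]

/-- A super-quantum group (super-Hopf algebra): a `ZMod 2`-graded algebra and graded coalgebra whose
coproduct is an algebra homomorphism to the super tensor product
`(a ⊗ b)(c ⊗ d) = (-1)^{|b||c|} ac ⊗ bd` (the algebra `𝓑 ᵍ⊗[k] 𝓑`), whose counit is an algebra
homomorphism, and which has the antipode `S`. -/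
structure IsSuperHopf (𝓑 : ZMod 2 → Submodule k B) [GradedAlgebra 𝓑] (S : B →ₗ[k] B) : Prop where
  comul_graded : ∀ (i : ZMod 2) (b : B), b ∈ 𝓑 i →
    ∃ r : SuperRepr 𝓑 b, ∀ s, r.deg₁ s + r.deg₂ s = i
  counit_graded : ∀ b ∈ 𝓑 1, Coalgebra.counit (R := k) b = 0
  comul_one : Coalgebra.comul (R := k) (1 : B) = 1 ⊗ₜ[k] 1
  comul_mul : ∀ a b : B,
    GradedTensorProduct.of k 𝓑 𝓑 (Coalgebra.comul (R := k) (a * b)) =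
      GradedTensorProduct.of k 𝓑 𝓑 (Coalgebra.comul (R := k) a) *
        GradedTensorProduct.of k 𝓑 𝓑 (Coalgebra.comul (R := k) b)
  counit_one : Coalgebra.counit (R := k) (1 : B) = 1
  counit_mul : ∀ a b : B, Coalgebra.counit (R := k) (a * b) =
    Coalgebra.counit (R := k) a * Coalgebra.counit (R := k) b
  antipode_graded : ∀ (i : ZMod 2) (b : B), b ∈ 𝓑 i → S b ∈ 𝓑 i
  antipode_left : LinearMap.mul' k B ∘ₗ TensorProduct.map S LinearMap.id ∘ₗ Coalgebra.comul =
    Algebra.linearMap k B ∘ₗ Coalgebra.counit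
  antipode_right : LinearMap.mul' k B ∘ₗ TensorProduct.map LinearMap.id S ∘ₗ Coalgebra.comul =
    Algebra.linearMap k B ∘ₗ Coalgebra.counit

end SuperHopf

/-- An (ordinary) Hopf algebra structure, for a given algebra and a given coalgebra structure on
the same space. -/
structure IsHopf (k A : Type*) [Field k] [Ring A] [Algebra k A] [Coalgebra k A] : Prop where
  comul_one : Coalgebra.comul (R := k) (1 : A) = 1
  comul_mul : ∀ a b : A, Coalgebra.comul (R := k) (a * b) =
    Coalgebra.comul (R := k) a * Coalgebra.comul (R := k) b
  counit_one : Coalgebra.counit (R := k) (1 : A) = 1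
  counit_mul : ∀ a b : A, Coalgebra.counit (R := k) (a * b) =
    Coalgebra.counit (R := k) a * Coalgebra.counit (R := k) b
  exists_antipode : ∃ S : A →ₗ[k] A,
    LinearMap.mul' k A ∘ₗ TensorProduct.map S LinearMap.id ∘ₗ Coalgebra.comul =
      Algebra.linearMap k A ∘ₗ Coalgebra.counit ∧
    LinearMap.mul' k A ∘ₗ TensorProduct.map LinearMap.id S ∘ₗ Coalgebra.comul =
      Algebra.linearMap k A ∘ₗ Coalgebra.counit

/-- The algebra of the quantum group `ℤ'_{/2}`: one generator `g` with `g² = 1`, that is, the group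
algebra of `ℤ/2`. -/
abbrev Zh (k : Type*) [Field k] := AddMonoidAlgebra k (ZMod 2)

/-- The power `g ^ i` of the generator of `ℤ'_{/2}`. -/
def gp (k : Type*) [Field k] (i : ZMod 2) : Zh k := AddMonoidAlgebra.single i 1

section Pairing

variable {k : Type*} [Field k]
  {C : Type*} [Ring C] [Algebra k C] [Coalgebra k C]
  {B : Type*} [Ring B] [Algebra k B] [Coalgebra k B]

/-- `ev` makes `C = B⋆` dual to `B` in the braided sense: `ev` vanishes on homogeneous elements
unless `|c| + |b| = 0`, and relates the opposite product of one to the coproduct of the other. -/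
structure IsSuperDual (𝓒 : ZMod 2 → Submodule k C) (𝓑 : ZMod 2 → Submodule k B)
    (ev : C →ₗ[k] B →ₗ[k] k) : Prop where
  graded : ∀ (i j : ZMod 2) (c : C) (b : B), c ∈ 𝓒 i → b ∈ 𝓑 j → i + j ≠ 0 → ev c b = 0
  mul_left : ∀ (c d : C) (b : B) (r : SuperRepr 𝓑 b),
    ev (c * d) b = ∑ s, ev d (r.fst s) * ev c (r.snd s)
  mul_right : ∀ (c : C) (a b : B) (r : SuperRepr 𝓒 c),
    ev c (a * b) = ∑ s, ev (r.fst s) b * ev (r.snd s) a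
  one_left : ∀ b : B, ev 1 b = Coalgebra.counit (R := k) b
  one_right : ∀ c : C, ev c 1 = Coalgebra.counit (R := k) c

end Pairing

/-! ### The double-bosonisation -/

section DoubleBosonisation

variable {k : Type*} [Field k]
  {C : Type*} [Ring C] [Algebra k C] [Coalgebra k C] (𝓒 : ZMod 2 → Submodule k C)
  {B : Type*} [Ring B] [Algebra k B] [Coalgebra k B] (𝓑 : ZMod 2 → Submodule k B)
  (ev : C →ₗ[k] B →ₗ[k] k)

/-- Generators of the double-bosonisation coming from `C = B⋆`. -/
def genC (k C B : Type*) [Field k] [Ring C] [Algebra k C] [Ring B] [Algebra k B] :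
    C →ₗ[k] TensorAlgebra k (C × Zh k × B) :=
  TensorAlgebra.ι k ∘ₗ LinearMap.inl k C (Zh k × B)

/-- Generators of the double-bosonisation coming from `ℤ'_{/2}`. -/
def genH (k C B : Type*) [Field k] [Ring C] [Algebra k C] [Ring B] [Algebra k B] :
    Zh k →ₗ[k] TensorAlgebra k (C × Zh k × B) :=
  TensorAlgebra.ι k ∘ₗ LinearMap.inr k C (Zh k × B) ∘ₗ LinearMap.inl k (Zh k) B

/-- Generators of the double-bosonisation coming from `B`. -/
def genB (k C B : Type*) [Field k] [Ring C] [Algebra k C] [Ring B] [Algebra k B] :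
    B →ₗ[k] TensorAlgebra k (C × Zh k × B) :=
  TensorAlgebra.ι k ∘ₗ LinearMap.inr k C (Zh k × B) ∘ₗ LinearMap.inr k (Zh k) B

/-- The relations of the double-bosonisation `B⋆ᵒᵖ ⋊ ℤ'_{/2} ⋉ B`, for `n = 2` and `q = -1`: those
of the algebras `B⋆ᵒᵖ`, `ℤ'_{/2}`, `B`, and the cross relations
`b g = (-1)^{|b|} g b`, `c g = (-1)^{|c|} g c`,
`b₁ g^{|c₂|} c₁ ev(c₂, b₂) = ev(c₁, b₁) c₂ g^{|b₁|} b₂`. -/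
inductive DBosRel :
    TensorAlgebra k (C × Zh k × B) → TensorAlgebra k (C × Zh k × B) → Prop
  | oneC : DBosRel (genC k C B 1) 1
  | mulC (c d : C) : DBosRel (genC k C B c * genC k C B d) (genC k C B (d * c))
  | oneH : DBosRel (genH k C B 1) 1
  | mulH (x y : Zh k) : DBosRel (genH k C B x * genH k C B y) (genH k C B (x * y))
  | oneB : DBosRel (genB k C B 1) 1
  | mulB (a b : B) : DBosRel (genB k C B a * genB k C B b) (genB k C B (a * b))
  | actB (i : ZMod 2) (b : B) (hb : b ∈ 𝓑 i) :
      DBosRel (genB k C B b * genH k C B (gp k 1))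
        ((-1 : ℤˣ) ^ i • (genH k C B (gp k 1) * genB k C B b))
  | actC (i : ZMod 2) (c : C) (hc : c ∈ 𝓒 i) :
      DBosRel (genC k C B c * genH k C B (gp k 1))
        ((-1 : ℤˣ) ^ i • (genH k C B (gp k 1) * genC k C B c))
  | cross (b : B) (c : C) (r : SuperRepr 𝓑 b) (t : SuperRepr 𝓒 c) :
      DBosRel
        (∑ s, ∑ u, ev (t.snd u) (r.snd s) •
          (genB k C B (r.fst s) * genH k C B (gp k (t.deg₂ u)) * genC k C B (t.fst u)))
        (∑ s, ∑ u, ev (t.fst u) (r.fst s) •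
          (genC k C B (t.snd u) * genH k C B (gp k (r.deg₁ s)) * genB k C B (r.snd s)))

/-- The algebra of the double-bosonisation `B⋆ᵒᵖ ⋊ ℤ'_{/2} ⋉ B`. -/
def DBos : Type _ := RingQuot (DBosRel 𝓒 𝓑 ev)

instance : Ring (DBos 𝓒 𝓑 ev) := inferInstanceAs (Ring (RingQuot (DBosRel 𝓒 𝓑 ev)))

instance : Algebra k (DBos 𝓒 𝓑 ev) := inferInstanceAs (Algebra k (RingQuot (DBosRel 𝓒 𝓑 ev)))

namespace DBos

def inC : C →ₗ[k] DBos 𝓒 𝓑 ev :=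
  (RingQuot.mkAlgHom k (DBosRel 𝓒 𝓑 ev)).toLinearMap ∘ₗ genC k C B

def inH : Zh k →ₗ[k] DBos 𝓒 𝓑 ev :=
  (RingQuot.mkAlgHom k (DBosRel 𝓒 𝓑 ev)).toLinearMap ∘ₗ genH k C B

def inB : B →ₗ[k] DBos 𝓒 𝓑 ev :=
  (RingQuot.mkAlgHom k (DBosRel 𝓒 𝓑 ev)).toLinearMap ∘ₗ genB k C B

/-- The linear map `B⋆ ⊗ ℤ'_{/2} ⊗ B → B⋆ᵒᵖ ⋊ ℤ'_{/2} ⋉ B`, `c ⊗ h ⊗ b ↦ c h b`. -/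
def triple : C ⊗[k] (Zh k ⊗[k] B) →ₗ[k] DBos 𝓒 𝓑 ev :=
  LinearMap.mul' k (DBos 𝓒 𝓑 ev) ∘ₗ TensorProduct.map (inC 𝓒 𝓑 ev)
    (LinearMap.mul' k (DBos 𝓒 𝓑 ev) ∘ₗ TensorProduct.map (inH 𝓒 𝓑 ev) (inB 𝓒 𝓑 ev))

/-- The given coalgebra structure is that of the double-bosonisation: it gives a Hopf algebra, built
on `B⋆ ⊗ ℤ'_{/2} ⊗ B`, with `Δ g = g ⊗ g`, `Δ b = b₁ ⊗ g^{|b₁|} b₂`, `Δ c = g^{|c₂|} c₁ ⊗ c₂`.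
As the coproduct is multiplicative, these formulas leave no choice. -/
structure IsCoproduct [Coalgebra k (DBos 𝓒 𝓑 ev)] : Prop where
  isHopf : IsHopf k (DBos 𝓒 𝓑 ev)
  triple_bijective : Function.Bijective (triple 𝓒 𝓑 ev)
  comul_g : Coalgebra.comul (R := k) (inH 𝓒 𝓑 ev (gp k 1)) =
    inH 𝓒 𝓑 ev (gp k 1) ⊗ₜ[k] inH 𝓒 𝓑 ev (gp k 1)
  comul_B : ∀ (b : B) (r : SuperRepr 𝓑 b), Coalgebra.comul (R := k) (inB 𝓒 𝓑 ev b) =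
    ∑ s, inB 𝓒 𝓑 ev (r.fst s) ⊗ₜ[k] (inH 𝓒 𝓑 ev (gp k (r.deg₁ s)) * inB 𝓒 𝓑 ev (r.snd s))
  comul_C : ∀ (c : C) (t : SuperRepr 𝓒 c), Coalgebra.comul (R := k) (inC 𝓒 𝓑 ev c) =
    ∑ u, (inH 𝓒 𝓑 ev (gp k (t.deg₂ u)) * inC 𝓒 𝓑 ev (t.fst u)) ⊗ₜ[k] inC 𝓒 𝓑 ev (t.snd u)
  counit_g : Coalgebra.counit (R := k) (inH 𝓒 𝓑 ev (gp k 1)) = 1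
  counit_B : ∀ b : B, Coalgebra.counit (R := k) (inB 𝓒 𝓑 ev b) = Coalgebra.counit (R := k) b
  counit_C : ∀ c : C, Coalgebra.counit (R := k) (inC 𝓒 𝓑 ev c) = Coalgebra.counit (R := k) c

end DBos

end DoubleBosonisation

/-! ### The super-double -/

section Double

variable {k : Type*} [Field k]
  {C : Type*} [Ring C] [Algebra k C] [Coalgebra k C] (𝓒 : ZMod 2 → Submodule k C)
  {B : Type*} [Ring B] [Algebra k B] [Coalgebra k B] (𝓑 : ZMod 2 → Submodule k B)
  (ev : C →ₗ[k] B →ₗ[k] k)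

/-- Generators of the super-double coming from `C = B⋆`. -/
def dgenC (k C B : Type*) [Field k] [Ring C] [Algebra k C] [Ring B] [Algebra k B] :
    C →ₗ[k] TensorAlgebra k (C × B) :=
  TensorAlgebra.ι k ∘ₗ LinearMap.inl k C B

/-- Generators of the super-double coming from `B`. -/
def dgenB (k C B : Type*) [Field k] [Ring C] [Algebra k C] [Ring B] [Algebra k B] :
    B →ₗ[k] TensorAlgebra k (C × B) :=
  TensorAlgebra.ι k ∘ₗ LinearMap.inr k C B

/-- The relations of the super-double `D(B)`: those of `B⋆` with the anyonic-opposite product, which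
is `c · d = (-1)^{|c||d|} dc` on homogeneous elements, those of `B`, and the cross relations
`b₁ c₁ ev(c₂, b₂) (-1)^{|b₁||c|} = (-1)^{|c₁||c₂|} ev(c₁, b₁) c₂ b₂`, for homogeneous `c`. -/
inductive DoubleRel : TensorAlgebra k (C × B) → TensorAlgebra k (C × B) → Prop
  | oneC : DoubleRel (dgenC k C B 1) 1
  | mulC (i j : ZMod 2) (c d : C) (hc : c ∈ 𝓒 i) (hd : d ∈ 𝓒 j) :
      DoubleRel (dgenC k C B c * dgenC k C B d) ((-1 : ℤˣ) ^ (i * j) • dgenC k C B (d * c))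
  | oneB : DoubleRel (dgenB k C B 1) 1
  | mulB (a b : B) : DoubleRel (dgenB k C B a * dgenB k C B b) (dgenB k C B (a * b))
  | cross (b : B) (j : ZMod 2) (c : C) (hc : c ∈ 𝓒 j) (r : SuperRepr 𝓑 b) (t : SuperRepr 𝓒 c) :
      DoubleRel
        (∑ s, ∑ u, (-1 : ℤˣ) ^ (r.deg₁ s * j) • ev (t.snd u) (r.snd s) •
          (dgenB k C B (r.fst s) * dgenC k C B (t.fst u)))
        (∑ s, ∑ u, (-1 : ℤˣ) ^ (t.deg₁ u * t.deg₂ u) • ev (t.fst u) (r.fst s) •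
          (dgenC k C B (t.snd u) * dgenB k C B (r.snd s)))

/-- The algebra of the super-double `D(B)`. -/
def Double : Type _ := RingQuot (DoubleRel 𝓒 𝓑 ev)

instance : Ring (Double 𝓒 𝓑 ev) := inferInstanceAs (Ring (RingQuot (DoubleRel 𝓒 𝓑 ev)))

instance : Algebra k (Double 𝓒 𝓑 ev) :=
  inferInstanceAs (Algebra k (RingQuot (DoubleRel 𝓒 𝓑 ev)))

namespace Double

def inC : C →ₗ[k] Double 𝓒 𝓑 ev :=
  (RingQuot.mkAlgHom k (DoubleRel 𝓒 𝓑 ev)).toLinearMap ∘ₗ dgenC k C B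

def inB : B →ₗ[k] Double 𝓒 𝓑 ev :=
  (RingQuot.mkAlgHom k (DoubleRel 𝓒 𝓑 ev)).toLinearMap ∘ₗ dgenB k C B

/-- The linear map `B⋆ ⊗ B → D(B)`, `c ⊗ b ↦ c b`. -/
def pair : C ⊗[k] B →ₗ[k] Double 𝓒 𝓑 ev :=
  LinearMap.mul' k (Double 𝓒 𝓑 ev) ∘ₗ TensorProduct.map (inC 𝓒 𝓑 ev) (inB 𝓒 𝓑 ev)

/-- The grading of `D(B)`: the part of degree `i` is spanned by the products `c b` with `c`, `b`
homogeneous and `|c| + |b| = i`. -/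
def grading (i : ZMod 2) : Submodule k (Double 𝓒 𝓑 ev) :=
  Submodule.span k {x | ∃ (j l : ZMod 2) (c : C) (b : B), c ∈ 𝓒 j ∧ b ∈ 𝓑 l ∧ j + l = i ∧
    x = inC 𝓒 𝓑 ev c * inB 𝓒 𝓑 ev b}

/-- The given coalgebra structure is that of the super-double: it gives a super-Hopf algebra,
containing `B⋆` (with the anyonic-opposite product) and `B` as subalgebras whose product is all of
`D(B) ≅ B⋆ ⊗ B`, and the coproducts and counits are those of `B⋆` and `B`. -/
structure IsCoproduct [Coalgebra k (Double 𝓒 𝓑 ev)] [GradedAlgebra (grading 𝓒 𝓑 ev)] : Prop where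
  isSuperHopf : ∃ S : Double 𝓒 𝓑 ev →ₗ[k] Double 𝓒 𝓑 ev, IsSuperHopf (grading 𝓒 𝓑 ev) S
  pair_bijective : Function.Bijective (pair 𝓒 𝓑 ev)
  inC_injective : Function.Injective (inC 𝓒 𝓑 ev)
  inB_injective : Function.Injective (inB 𝓒 𝓑 ev)
  comul_B : ∀ b : B, Coalgebra.comul (R := k) (inB 𝓒 𝓑 ev b) =
    TensorProduct.map (inB 𝓒 𝓑 ev) (inB 𝓒 𝓑 ev) (Coalgebra.comul (R := k) b)
  comul_C : ∀ c : C, Coalgebra.comul (R := k) (inC 𝓒 𝓑 ev c) =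
    TensorProduct.map (inC 𝓒 𝓑 ev) (inC 𝓒 𝓑 ev) (Coalgebra.comul (R := k) c)
  counit_B : ∀ b : B, Coalgebra.counit (R := k) (inB 𝓒 𝓑 ev b) = Coalgebra.counit (R := k) b
  counit_C : ∀ c : C, Coalgebra.counit (R := k) (inC 𝓒 𝓑 ev c) = Coalgebra.counit (R := k) c

end Double

end Double

/-! ### Bosonisation of a super-Hopf algebra -/

section Bosonisation

variable {k : Type*} [Field k] {D : Type*} [Ring D] [Algebra k D] (𝓓 : ZMod 2 → Submodule k D)

/-- Generators of the bosonisation coming from `ℤ'_{/2}`. -/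
def bgenH (k D : Type*) [Field k] [Ring D] [Algebra k D] :
    Zh k →ₗ[k] TensorAlgebra k (Zh k × D) :=
  TensorAlgebra.ι k ∘ₗ LinearMap.inl k (Zh k) D

/-- Generators of the bosonisation coming from `D`. -/
def bgenD (k D : Type*) [Field k] [Ring D] [Algebra k D] :
    D →ₗ[k] TensorAlgebra k (Zh k × D) :=
  TensorAlgebra.ι k ∘ₗ LinearMap.inr k (Zh k) D

/-- The relations of the bosonisation `ℤ'_{/2} ⋉ D`: those of the algebras `ℤ'_{/2}` and `D`, and
`x g = (-1)^{|x|} g x`. -/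
inductive BosRel : TensorAlgebra k (Zh k × D) → TensorAlgebra k (Zh k × D) → Prop
  | oneH : BosRel (bgenH k D 1) 1
  | mulH (x y : Zh k) : BosRel (bgenH k D x * bgenH k D y) (bgenH k D (x * y))
  | oneD : BosRel (bgenD k D 1) 1
  | mulD (x y : D) : BosRel (bgenD k D x * bgenD k D y) (bgenD k D (x * y))
  | act (i : ZMod 2) (x : D) (hx : x ∈ 𝓓 i) :
      BosRel (bgenD k D x * bgenH k D (gp k 1))
        ((-1 : ℤˣ) ^ i • (bgenH k D (gp k 1) * bgenD k D x))

/-- The algebra of the bosonisation `ℤ'_{/2} ⋉ D`. -/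
def Bos : Type _ := RingQuot (BosRel 𝓓)

instance : Ring (Bos 𝓓) := inferInstanceAs (Ring (RingQuot (BosRel 𝓓)))

instance : Algebra k (Bos 𝓓) := inferInstanceAs (Algebra k (RingQuot (BosRel 𝓓)))

namespace Bos

def inH : Zh k →ₗ[k] Bos 𝓓 := (RingQuot.mkAlgHom k (BosRel 𝓓)).toLinearMap ∘ₗ bgenH k D

def inD : D →ₗ[k] Bos 𝓓 := (RingQuot.mkAlgHom k (BosRel 𝓓)).toLinearMap ∘ₗ bgenD k D

/-- The linear map `ℤ'_{/2} ⊗ D → ℤ'_{/2} ⋉ D`, `h ⊗ x ↦ h x`. -/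
def pair : Zh k ⊗[k] D →ₗ[k] Bos 𝓓 :=
  LinearMap.mul' k (Bos 𝓓) ∘ₗ TensorProduct.map (inH 𝓓) (inD 𝓓)

/-- The given coalgebra structure is that of the bosonisation: it gives a Hopf algebra, built on
`ℤ'_{/2} ⊗ D`, with `Δ g = g ⊗ g` and `Δ x = x₁ ⊗ g^{|x₁|} x₂`. -/
structure IsCoproduct [Coalgebra k D] [Coalgebra k (Bos 𝓓)] : Prop where
  isHopf : IsHopf k (Bos 𝓓)
  pair_bijective : Function.Bijective (pair 𝓓)
  comul_g : Coalgebra.comul (R := k) (inH 𝓓 (gp k 1)) = inH 𝓓 (gp k 1) ⊗ₜ[k] inH 𝓓 (gp k 1)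
  comul_D : ∀ (x : D) (r : SuperRepr 𝓓 x), Coalgebra.comul (R := k) (inD 𝓓 x) =
    ∑ s, inD 𝓓 (r.fst s) ⊗ₜ[k] (inH 𝓓 (gp k (r.deg₁ s)) * inD 𝓓 (r.snd s))
  counit_g : Coalgebra.counit (R := k) (inH 𝓓 (gp k 1)) = 1
  counit_D : ∀ x : D, Coalgebra.counit (R := k) (inD 𝓓 x) = Coalgebra.counit (R := k) x

end Bos

end Bosonisation

end SuperDouble

end

open scoped TensorProduct

noncomputable section

namespace SuperDouble

set_option linter.unusedSectionVars false
set_option linter.unnecessarySeqFocus false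

open WithConv

/-! ### Signs and parity projections -/

section Sign

variable (k : Type*) [Field k]

/-! Most of the argument takes place in convolution algebras. Write `C` for `B⋆`. The space `C ⊗ B`
carries the super tensor product coalgebra `STensor 𝓒 𝓑`. For linear maps `u` on `C` and `v` on `B`
with values in an algebra, put `U = inl u` and `V = inr v`. Then `U * V` is `c ⊗ b ↦ u(c) v(b)`,
while `V * U` is `c ⊗ b ↦ (-1)^{|c||b|} v(b) u(c)` (`inl_mul_inr`, `inr_mul_inl`). The cross
relation of `D(B)`, signs included, becomes the single identity `V * U * ev = ev * U * V`
(`cross_left`, `cross_right`). The pairing, even if degenerate, is always invertible for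
convolution, with inverse `ev ∘ S⁻¹` for the antipode `S` of `C`; this is why `S` has to be
bijective.

Size of `D(B)`. The identity `V * U = ev * U * V * ev⁻¹` rewrites every `b c` as a combination of
products `c' b'`, so these span (`pair_surjective`). For independence, `D(B)` acts on the Fock space
`C ⊗ B`. On `C` alone, `C` acts by super-opposite multiplication and `B` by contraction, with `V₁ *
U₁ = ev * U₁ * V₁`. On `B` alone, `B` acts by multiplication and `C` by contraction, with `V₂ * U₂ *
ev = U₂ * V₂`. Operators on different factors super-commute, so convolution products of the two
halves satisfy the full relation (`cross_mul`, `fock_cross`). Applied to the vacuum `1 ⊗ 1`, the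
element `c b` gives the contraction of `c ⊗ b` with `ev` (`fock_vacuum`), which is injective because
`ev` is invertible.

Structure of `D(B)`. The grading consists of the eigenspaces of a parity involution, which is where
`2 ≠ 0` enters. The coproduct is transported from `STensor 𝓒 𝓑`, so coassociativity is automatic. It
is multiplicative because it agrees with the algebra map to the super tensor square given by the
universal property, and that map exists by `cross_mul` once more (`of_comul`). The identity of
`D(B)` corresponds to `U * V`, so its convolution inverse is `V⁻¹ * U⁻¹`, built from the antipode of
`B` and from `S⁻¹`.

Bosonisation. For a super-Hopf algebra `D`, the map `x ⊗ y ↦ x ⊗ g^{|x|} y` is an algebra map from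
the super tensor square to an ordinary one (`boson`), which makes the coproduct multiplicative. The
identity is a convolution product of two maps that factor through the group algebra and through `D`
(`id_eq_mul`), and this gives the antipode.

Double-bosonisation. The substitution `c ↦ g^{|c|} c` converts the super-opposite product into the
opposite one and one cross relation into the other, so the universal properties give mutually
inverse algebra maps (`bosEquiv`). The Hopf structure is transported along this isomorphism, and
what remains is to recognise the stated coproducts and the basis `c h b`. -/

/-- The sign `(-1)^i` as a scalar. -/
def sgn (i : ZMod 2) : k := (((-1 : ℤˣ) ^ i : ℤˣ) : ℤ)

@[simp] theorem sgn_zero : sgn k 0 = 1 := by simp [sgn]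

@[simp] theorem sgn_one : sgn k 1 = -1 := by simp [sgn]

theorem sgn_add (i j : ZMod 2) : sgn k (i + j) = sgn k i * sgn k j := by
  simp [sgn, uzpow_add]

@[simp] theorem sgn_mul_self (i : ZMod 2) : sgn k i * sgn k i = 1 := by
  rw [← sgn_add, CharTwo.add_self_eq_zero, sgn_zero]

@[simp] theorem sgn_mul_sgn_mul (i : ZMod 2) (x : k) : sgn k i * (sgn k i * x) = x := by
  rw [← mul_assoc, sgn_mul_self, one_mul]

/-- Trades the action of `ℤˣ` for that of a scalar, so that signs pass through linear maps by
`map_smul` and merge by `sgn_add`. -/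
theorem unit_smul {M : Type*} [AddCommGroup M] [Module k M] (i : ZMod 2) (x : M) :
    (-1 : ℤˣ) ^ i • x = sgn k i • x := by
  rw [sgn, Units.smul_def, Int.cast_smul_eq_zsmul]

theorem zmod_two_cases (i : ZMod 2) : i = 0 ∨ i = 1 := by
  revert i; decide

theorem sum_zmod_two {M : Type*} [AddCommMonoid M] (f : ZMod 2 → M) : ∑ i, f i = f 0 + f 1 :=
  Fin.sum_univ_two f

end Sign

section Projection

variable {k : Type*} [Field k] {M : Type*} [AddCommGroup M] [Module k M]
  (𝓜 : ZMod 2 → Submodule k M) [DirectSum.Decomposition 𝓜]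

/-- The projection onto the part of degree `i`. -/
def pr (i : ZMod 2) : Module.End k M :=
  (𝓜 i).subtype ∘ₗ DirectSum.component k (ZMod 2) (fun i => 𝓜 i) i ∘ₗ
    (DirectSum.decomposeLinearEquiv 𝓜).toLinearMap

theorem pr_apply (i : ZMod 2) (x : M) : pr 𝓜 i x = (DirectSum.decompose 𝓜 x i : M) := rfl

theorem pr_mem (i : ZMod 2) (x : M) : pr 𝓜 i x ∈ 𝓜 i := SetLike.coe_mem _

variable {𝓜} in
theorem pr_of_mem {i : ZMod 2} {x : M} (h : x ∈ 𝓜 i) : pr 𝓜 i x = x :=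
  DirectSum.decompose_of_mem_same 𝓜 h

variable {𝓜} in
theorem pr_of_mem_ne {i j : ZMod 2} {x : M} (h : x ∈ 𝓜 i) (hij : i ≠ j) : pr 𝓜 j x = 0 :=
  DirectSum.decompose_of_mem_ne 𝓜 h hij

theorem pr_add_pr (x : M) : pr 𝓜 0 x + pr 𝓜 1 x = x := by
  classical
  have h := DirectSum.sum_support_decompose 𝓜 x
  conv_rhs => rw [← h]
  rw [← sum_zmod_two (fun i => pr 𝓜 i x)]
  refine (Finset.sum_subset (Finset.subset_univ _) ?_).symm
  intro i _ hi
  simpa [pr_apply] using hi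

theorem pr_pr (i j : ZMod 2) (x : M) : pr 𝓜 i (pr 𝓜 j x) = if i = j then pr 𝓜 j x else 0 := by
  split_ifs with h
  · subst h; exact pr_of_mem (pr_mem _ _ _)
  · exact pr_of_mem_ne (pr_mem _ _ _) (Ne.symm h)

/-- Linear maps agree when they agree on homogeneous elements. -/
theorem homogeneous_ext {N : Type*} [AddCommGroup N] [Module k N] {f g : M →ₗ[k] N}
    (h : ∀ i, ∀ x ∈ 𝓜 i, f x = g x) : f = g := by
  ext x
  rw [← pr_add_pr 𝓜 x, map_add, map_add, h _ _ (pr_mem _ _ _), h _ _ (pr_mem _ _ _)]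

/-- The parity involution `x ↦ (-1)^{|x|} x`. -/
def par : Module.End k M := pr 𝓜 0 - pr 𝓜 1

variable {𝓜} in
theorem par_of_mem {i : ZMod 2} {x : M} (h : x ∈ 𝓜 i) : par 𝓜 x = sgn k i • x := by
  rcases zmod_two_cases i with rfl | rfl
  · simp [par, pr_of_mem h, pr_of_mem_ne h (by decide : (0 : ZMod 2) ≠ 1)]
  · simp [par, pr_of_mem h, pr_of_mem_ne h (by decide : (1 : ZMod 2) ≠ 0)]

@[simp] theorem par_par (x : M) : par 𝓜 (par 𝓜 x) = x := by
  have : par 𝓜 ∘ₗ par 𝓜 = LinearMap.id := homogeneous_ext 𝓜 fun i x hx => by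
    simp [par_of_mem hx, smul_smul]
  exact LinearMap.congr_fun this x

theorem par_pr (i : ZMod 2) (x : M) : par 𝓜 (pr 𝓜 i x) = sgn k i • pr 𝓜 i x :=
  par_of_mem (pr_mem _ _ _)

end Projection

/-! ### The super tensor product of super-coalgebras -/

section SuperCoalgebra

variable {k : Type*} [Field k]

/-- A coalgebra with a compatible `ZMod 2`-grading. -/
class IsSuperCoalgebra {M : Type*} [AddCommGroup M] [Module k M] [Coalgebra k M]
    (𝓜 : ZMod 2 → Submodule k M) [DirectSum.Decomposition 𝓜] : Prop where
  -- An equation rather than the existence of a presentation. In `ZMod 2` the total degree `i`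
  -- consists of the bidegrees `(0, i)` and `(1, i + 1)`.
  comul_pr : ∀ i m, Coalgebra.comul (R := k) (pr 𝓜 i m) =
    TensorProduct.map (pr 𝓜 0) (pr 𝓜 i) (Coalgebra.comul (R := k) m) +
      TensorProduct.map (pr 𝓜 1) (pr 𝓜 (i + 1)) (Coalgebra.comul (R := k) m)
  counit_pr_one : ∀ m, Coalgebra.counit (R := k) (pr 𝓜 1 m) = 0

section

variable {M : Type*} [AddCommGroup M] [Module k M] [Coalgebra k M]
    (𝓜 : ZMod 2 → Submodule k M) [DirectSum.Decomposition 𝓜] [IsSuperCoalgebra 𝓜]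

/-- The four terms of `par ⊗ par` group by total degree, with `+` in even and `-` in odd degree, and
`Δ` respects total degree. -/
theorem comul_par (m : M) : Coalgebra.comul (R := k) (par 𝓜 m) =
    TensorProduct.map (par 𝓜) (par 𝓜) (Coalgebra.comul (R := k) m) := by
  have h11 : (1 + 1 : ZMod 2) = 0 := by decide
  have h : TensorProduct.map (par 𝓜) (par 𝓜) =
      (TensorProduct.map (pr 𝓜 0) (pr 𝓜 0) + TensorProduct.map (pr 𝓜 1) (pr 𝓜 1)) -
        (TensorProduct.map (pr 𝓜 0) (pr 𝓜 1) + TensorProduct.map (pr 𝓜 1) (pr 𝓜 0)) := by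
    ext x y
    simp [par, TensorProduct.sub_tmul, TensorProduct.tmul_sub]
    abel
  rw [h, par, LinearMap.sub_apply, map_sub, IsSuperCoalgebra.comul_pr, IsSuperCoalgebra.comul_pr]
  simp only [LinearMap.sub_apply, LinearMap.add_apply, zero_add, h11]

theorem counit_pr_zero (m : M) :
    Coalgebra.counit (R := k) (pr 𝓜 0 m) = Coalgebra.counit (R := k) m := by
  conv_rhs => rw [← pr_add_pr 𝓜 m, map_add, IsSuperCoalgebra.counit_pr_one, add_zero]

@[simp] theorem counit_par (m : M) :
    Coalgebra.counit (R := k) (par 𝓜 m) = Coalgebra.counit (R := k) m := by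
  simp [par, counit_pr_zero, IsSuperCoalgebra.counit_pr_one]

theorem counit_of_mem_one {m : M} (h : m ∈ 𝓜 1) : Coalgebra.counit (R := k) m = 0 := by
  rw [← pr_of_mem h, IsSuperCoalgebra.counit_pr_one]

end

variable {M M' N N' : Type*} [AddCommGroup M] [Module k M] [AddCommGroup M'] [Module k M']
  [AddCommGroup N] [Module k N] [AddCommGroup N'] [Module k N']

/-- The exchange of the two middle factors, with the sign given by the projections `P` and the
involution `τ`. -/
def shuffle (P : ZMod 2 → Module.End k M') (τ : Module.End k N) :
    (M ⊗[k] M') ⊗[k] (N ⊗[k] N') →ₗ[k] (M ⊗[k] N) ⊗[k] (M' ⊗[k] N') :=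
  (TensorProduct.tensorTensorTensorComm k M M' N N').toLinearMap ∘ₗ
    (TensorProduct.map (TensorProduct.map LinearMap.id (P 0)) LinearMap.id +
      TensorProduct.map (TensorProduct.map LinearMap.id (P 1)) (TensorProduct.map τ LinearMap.id))

@[simp] theorem shuffle_tmul (P : ZMod 2 → Module.End k M') (τ : Module.End k N)
    (x : M) (y : M') (u : N) (v : N') :
    shuffle P τ ((x ⊗ₜ y) ⊗ₜ (u ⊗ₜ v)) =
      (x ⊗ₜ[k] u) ⊗ₜ[k] (P 0 y ⊗ₜ[k] v) + (x ⊗ₜ τ u) ⊗ₜ (P 1 y ⊗ₜ v) := by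
  simp [shuffle]

theorem shuffle_of_mem {𝓜 : ZMod 2 → Submodule k M'} [DirectSum.Decomposition 𝓜]
    {𝓝 : ZMod 2 → Submodule k N} [DirectSum.Decomposition 𝓝] {i j : ZMod 2}
    (x : M) {y : M'} (hy : y ∈ 𝓜 i) {u : N} (hu : u ∈ 𝓝 j) (v : N') :
    shuffle (pr 𝓜) (par 𝓝) ((x ⊗ₜ y) ⊗ₜ (u ⊗ₜ v)) =
      sgn k (i * j) • ((x ⊗ₜ[k] u) ⊗ₜ[k] (y ⊗ₜ[k] v)) := by
  rw [shuffle_tmul]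
  rcases zmod_two_cases i with rfl | rfl
  · simp [pr_of_mem hy, pr_of_mem_ne hy (by decide : (0 : ZMod 2) ≠ 1)]
  · simp [pr_of_mem hy, pr_of_mem_ne hy (by decide : (1 : ZMod 2) ≠ 0), par_of_mem hu,
      TensorProduct.tmul_smul, TensorProduct.smul_tmul']

end SuperCoalgebra

section STensor

variable {k : Type*} [Field k]
  {M : Type*} [AddCommGroup M] [Module k M] [Coalgebra k M]
  (𝓜 : ZMod 2 → Submodule k M) [DirectSum.Decomposition 𝓜] [IsSuperCoalgebra 𝓜]
  {N : Type*} [AddCommGroup N] [Module k N] [Coalgebra k N]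
  (𝓝 : ZMod 2 → Submodule k N) [DirectSum.Decomposition 𝓝] [IsSuperCoalgebra 𝓝]

/-- The super tensor product of two super-coalgebras: the space `M ⊗ N` with the coproduct
`Δ (m ⊗ n) = (-1)^{|m₂||n₁|} (m₁ ⊗ n₁) ⊗ (m₂ ⊗ n₂)`. -/
@[nolint unusedArguments]
def STensor (_ : ZMod 2 → Submodule k M) (_ : ZMod 2 → Submodule k N) : Type _ := M ⊗[k] N

instance : AddCommGroup (STensor 𝓜 𝓝) := inferInstanceAs (AddCommGroup (M ⊗[k] N))

instance : Module k (STensor 𝓜 𝓝) := inferInstanceAs (Module k (M ⊗[k] N))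

namespace STensor

/-- The identification of the underlying spaces. -/
def of : M ⊗[k] N ≃ₗ[k] STensor 𝓜 𝓝 := LinearEquiv.refl _ _

/-- The coproduct on the underlying space. -/
def comulAux : M ⊗[k] N →ₗ[k] (M ⊗[k] N) ⊗[k] (M ⊗[k] N) :=
  shuffle (pr 𝓜) (par 𝓝) ∘ₗ TensorProduct.map Coalgebra.comul Coalgebra.comul

/-- The counit on the underlying space. -/
def counitAux (k M N : Type*) [Field k] [AddCommGroup M] [Module k M] [Coalgebra k M]
    [AddCommGroup N] [Module k N] [Coalgebra k N] : M ⊗[k] N →ₗ[k] k :=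
  LinearMap.mul' k k ∘ₗ TensorProduct.map Coalgebra.counit Coalgebra.counit

/-- Coassociativity of the signs alone, before any coproduct is inserted. One exchange passes a
tensor square as a whole: `par ⊗ par` is the parity of `N ⊗ N`, and the sum of two projections is
the degree projection of `M ⊗ M`. This is why `shuffle` takes arbitrary `P` and `τ`. -/
theorem shuffle_assoc :
    (TensorProduct.assoc k (M ⊗[k] N) (M ⊗[k] N) (M ⊗[k] N)).toLinearMap ∘ₗ
      LinearMap.rTensor _ (shuffle (pr 𝓜) (par 𝓝)) ∘ₗ
        shuffle (pr 𝓜) (TensorProduct.map (par 𝓝) (par 𝓝)) =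
    LinearMap.lTensor _ (shuffle (pr 𝓜) (par 𝓝)) ∘ₗ
      shuffle (fun i => TensorProduct.map (pr 𝓜 0) (pr 𝓜 i) +
        TensorProduct.map (pr 𝓜 1) (pr 𝓜 (i + 1))) (par 𝓝) ∘ₗ
      TensorProduct.map (TensorProduct.assoc k M M M).toLinearMap
        (TensorProduct.assoc k N N N).toLinearMap := by
  have h11 : (1 + 1 : ZMod 2) = 0 := by decide
  ext x y z u v w
  simp only [TensorProduct.AlgebraTensorModule.curry_apply, LinearMap.restrictScalars_self,
    TensorProduct.curry_apply, LinearMap.comp_apply, LinearEquiv.coe_coe, shuffle_tmul, map_add,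
    LinearMap.rTensor_tmul, LinearMap.lTensor_tmul, TensorProduct.map_tmul,
    TensorProduct.add_tmul, TensorProduct.tmul_add, LinearMap.add_apply, TensorProduct.assoc_tmul,
    pr_pr, par_par, zero_add, h11]
  simp
  abel

/-- The inner coproducts move past the exchange by `comul_par` (in `h1`) and `comul_pr` (in `h2`);
then `shuffle_assoc` and the coassociativity of the two factors suffice. -/
theorem comulAux_coassoc :
    (TensorProduct.assoc k (M ⊗[k] N) (M ⊗[k] N) (M ⊗[k] N)).toLinearMap ∘ₗ
      LinearMap.rTensor _ (comulAux 𝓜 𝓝) ∘ₗ comulAux 𝓜 𝓝 =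
    LinearMap.lTensor _ (comulAux 𝓜 𝓝) ∘ₗ comulAux 𝓜 𝓝 := by
  have h1 : LinearMap.rTensor (M ⊗[k] N) (TensorProduct.map (Coalgebra.comul (R := k) (A := M))
        (Coalgebra.comul (R := k) (A := N))) ∘ₗ shuffle (pr 𝓜) (par 𝓝) =
      shuffle (pr 𝓜) (TensorProduct.map (par 𝓝) (par 𝓝)) ∘ₗ
        TensorProduct.map (LinearMap.rTensor M Coalgebra.comul)
          (LinearMap.rTensor N Coalgebra.comul) := by
    ext x y u v
    simp [comul_par, shuffle]
  have h2 : LinearMap.lTensor (M ⊗[k] N) (TensorProduct.map (Coalgebra.comul (R := k) (A := M))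
        (Coalgebra.comul (R := k) (A := N))) ∘ₗ shuffle (pr 𝓜) (par 𝓝) =
      shuffle (fun i => TensorProduct.map (pr 𝓜 0) (pr 𝓜 i) +
        TensorProduct.map (pr 𝓜 1) (pr 𝓜 (i + 1))) (par 𝓝) ∘ₗ
        TensorProduct.map (LinearMap.lTensor M Coalgebra.comul)
          (LinearMap.lTensor N Coalgebra.comul) := by
    ext x y u v
    simp [IsSuperCoalgebra.comul_pr, shuffle]
  rw [comulAux, LinearMap.rTensor_comp, LinearMap.lTensor_comp]
  have e1 := congrArg (· ∘ₗ TensorProduct.map (Coalgebra.comul (R := k) (A := M))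
        (Coalgebra.comul (R := k) (A := N))) h1
  have e2 := congrArg (· ∘ₗ TensorProduct.map (Coalgebra.comul (R := k) (A := M))
        (Coalgebra.comul (R := k) (A := N))) h2
  simp only [LinearMap.comp_assoc] at e1 e2 ⊢
  rw [e1, e2]
  have := congrArg (· ∘ₗ (TensorProduct.map (LinearMap.rTensor M Coalgebra.comul)
          (LinearMap.rTensor N Coalgebra.comul) ∘ₗ
          TensorProduct.map (Coalgebra.comul (R := k) (A := M))
        (Coalgebra.comul (R := k) (A := N)))) (shuffle_assoc 𝓜 𝓝)
  simp only [LinearMap.comp_assoc] at this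
  rw [this, ← TensorProduct.map_comp, ← TensorProduct.map_comp, ← TensorProduct.map_comp,
    Coalgebra.coassoc, Coalgebra.coassoc]

/-- The counit does not see `par`, so the two terms of the exchange recombine by `pr_add_pr`. -/
theorem counitAux_comulAux_left :
    LinearMap.rTensor _ (counitAux k M N) ∘ₗ comulAux 𝓜 𝓝 = TensorProduct.mk k k _ 1 := by
  have h : LinearMap.rTensor (M ⊗[k] N) (counitAux k M N) ∘ₗ shuffle (pr 𝓜) (par 𝓝) =
      (TensorProduct.lid k (M ⊗[k] N)).symm.toLinearMap ∘ₗ TensorProduct.map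
        ((TensorProduct.lid k M).toLinearMap ∘ₗ LinearMap.rTensor M Coalgebra.counit)
        ((TensorProduct.lid k N).toLinearMap ∘ₗ LinearMap.rTensor N Coalgebra.counit) := by
    ext x y u v
    simp only [counitAux, TensorProduct.AlgebraTensorModule.curry_apply,
      LinearMap.restrictScalars_self, TensorProduct.curry_apply, LinearMap.comp_apply,
      shuffle_tmul, map_add, LinearMap.rTensor_tmul, TensorProduct.map_tmul,
      LinearMap.mul'_apply, counit_par, LinearEquiv.coe_coe, TensorProduct.lid_tmul,
      TensorProduct.lid_symm_apply, TensorProduct.smul_tmul_smul]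
    rw [← TensorProduct.tmul_add, ← TensorProduct.add_tmul, pr_add_pr, TensorProduct.tmul_smul,
      TensorProduct.smul_tmul', smul_eq_mul, mul_one]
  rw [comulAux, ← LinearMap.comp_assoc, h]
  ext m n
  simp

/-- Here the counit falls on the projected element and kills the odd term, the one that carries the
sign. -/
theorem counitAux_comulAux_right :
    LinearMap.lTensor _ (counitAux k M N) ∘ₗ comulAux 𝓜 𝓝 =
      (TensorProduct.mk k _ k).flip 1 := by
  have h : LinearMap.lTensor (M ⊗[k] N) (counitAux k M N) ∘ₗ shuffle (pr 𝓜) (par 𝓝) =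
      (TensorProduct.rid k (M ⊗[k] N)).symm.toLinearMap ∘ₗ TensorProduct.map
        ((TensorProduct.rid k M).toLinearMap ∘ₗ LinearMap.lTensor M Coalgebra.counit)
        ((TensorProduct.rid k N).toLinearMap ∘ₗ LinearMap.lTensor N Coalgebra.counit) := by
    ext x y u v
    simp [counitAux, counit_pr_zero, IsSuperCoalgebra.counit_pr_one]
    rw [TensorProduct.smul_tmul', TensorProduct.smul_tmul', smul_smul, ← TensorProduct.smul_tmul',
      ← TensorProduct.smul_tmul', ← TensorProduct.tmul_smul, smul_eq_mul, mul_one, mul_comm]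
  rw [comulAux, ← LinearMap.comp_assoc, h]
  ext m n
  simp

instance : Coalgebra k (STensor 𝓜 𝓝) where
  comul := comulAux 𝓜 𝓝
  counit := counitAux k M N
  coassoc := comulAux_coassoc 𝓜 𝓝
  rTensor_counit_comp_comul := counitAux_comulAux_left 𝓜 𝓝
  lTensor_counit_comp_comul := counitAux_comulAux_right 𝓜 𝓝

end STensor

end STensor

/-! ### Convolution -/

section Convolution

variable {k : Type*} [Field k]
  {E : Type*} [AddCommGroup E] [Module k E] [Coalgebra k E]
  {E' : Type*} [AddCommGroup E'] [Module k E'] [Coalgebra k E']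
  {A : Type*} [Ring A] [Algebra k A] {A' : Type*} [Ring A'] [Algebra k A']

/-- Composition with a coalgebra map is multiplicative for convolution. -/
def convPull (h : E →ₗc[k] E') : WithConv (E' →ₗ[k] A) →* WithConv (E →ₗ[k] A) where
  toFun f := toConv (f.ofConv ∘ₗ h.toLinearMap)
  map_one' := by
    ext x
    simp [LinearMap.convOne_def]
  map_mul' f g := congrArg toConv (LinearMap.convMul_comp_coalgHom_distrib f g h)

@[simp] theorem convPull_apply (h : E →ₗc[k] E') (f : WithConv (E' →ₗ[k] A)) (x : E) :
    convPull h f x = f (h x) := rfl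

/-- Composition with an algebra map is multiplicative for convolution. -/
def convPush (E : Type*) [AddCommGroup E] [Module k E] [Coalgebra k E] (h : A →ₐ[k] A') :
    WithConv (E →ₗ[k] A) →* WithConv (E →ₗ[k] A') where
  toFun f := toConv (h.toLinearMap ∘ₗ f.ofConv)
  map_one' := by
    ext x
    simp [LinearMap.convOne_def]
  map_mul' f g := congrArg toConv (LinearMap.algHom_comp_convMul_distrib h f g)

@[simp] theorem convPush_apply (h : A →ₐ[k] A') (f : WithConv (E →ₗ[k] A)) (x : E) :
    convPush E h f x = h (f x) := rfl

/-- A functional, seen as a linear map with values in an algebra. -/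
def scal (A : Type*) [Ring A] [Algebra k A] :
    WithConv (E →ₗ[k] k) →* WithConv (E →ₗ[k] A) := convPush E (Algebra.ofId k A)

@[simp] theorem scal_apply (f : WithConv (E →ₗ[k] k)) (x : E) :
    scal A f x = algebraMap k A (f x) := rfl

@[simp] theorem convPush_scal (h : A →ₐ[k] A') (f : WithConv (E →ₗ[k] k)) :
    convPush E h (scal A f) = scal A' f := by
  ext x; simp

/-- Convolving with a functional only forms linear combinations of values of `F`. This is how
straightening stays inside the span of ordered products. -/
theorem conv_mem (W : Submodule k A) {f : WithConv (E →ₗ[k] k)} {F : WithConv (E →ₗ[k] A)}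
    (h : ∀ x, F x ∈ W) (x : E) : (scal A f * F) x ∈ W := by
  rw [LinearMap.convMul_apply]
  generalize Coalgebra.comul (R := k) x = z
  induction z with
  | zero => simp
  | add a b ha hb => rw [map_add, map_add]; exact W.add_mem ha hb
  | tmul a b =>
    rw [TensorProduct.map_tmul, LinearMap.mul'_apply]
    change algebraMap k A (f a) * F b ∈ W
    rw [← Algebra.smul_def]
    exact W.smul_mem _ (h b)

theorem conv_mem' (W : Submodule k A) {f : WithConv (E →ₗ[k] k)} {F : WithConv (E →ₗ[k] A)}
    (h : ∀ x, F x ∈ W) (x : E) : (F * scal A f) x ∈ W := by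
  rw [LinearMap.convMul_apply]
  generalize Coalgebra.comul (R := k) x = z
  induction z with
  | zero => simp
  | add a b ha hb => rw [map_add, map_add]; exact W.add_mem ha hb
  | tmul a b =>
    rw [TensorProduct.map_tmul, LinearMap.mul'_apply]
    change F a * algebraMap k A (f b) ∈ W
    rw [← Algebra.commutes, ← Algebra.smul_def]
    exact W.smul_mem _ (h a)

end Convolution

/-! ### Convolution on the super tensor product -/

namespace STensor

section

variable {k : Type*} [Field k]
  {M : Type*} [AddCommGroup M] [Module k M] [Coalgebra k M]
  (𝓜 : ZMod 2 → Submodule k M) [DirectSum.Decomposition 𝓜] [IsSuperCoalgebra 𝓜]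
  {N : Type*} [AddCommGroup N] [Module k N] [Coalgebra k N]
  (𝓝 : ZMod 2 → Submodule k N) [DirectSum.Decomposition 𝓝] [IsSuperCoalgebra 𝓝]
  {A : Type*} [Ring A] [Algebra k A]

theorem comul_of (m : M) (n : N) : Coalgebra.comul (R := k) (of 𝓜 𝓝 (m ⊗ₜ n)) =
    TensorProduct.map (of 𝓜 𝓝).toLinearMap (of 𝓜 𝓝).toLinearMap (shuffle (pr 𝓜) (par 𝓝)
      (Coalgebra.comul (R := k) m ⊗ₜ Coalgebra.comul (R := k) n)) := by
  have : TensorProduct.map (of 𝓜 𝓝).toLinearMap (of 𝓜 𝓝).toLinearMap = LinearMap.id :=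
    TensorProduct.map_id
  rw [this]; rfl

@[simp] theorem counit_of (m : M) (n : N) : Coalgebra.counit (R := k) (of 𝓜 𝓝 (m ⊗ₜ n)) =
    Coalgebra.counit (R := k) m * Coalgebra.counit (R := k) n := rfl

variable {𝓜 𝓝} in
theorem hom_ext {X : Type*} [AddCommGroup X] [Module k X] {f g : STensor 𝓜 𝓝 →ₗ[k] X}
    (h : ∀ m n, f (of 𝓜 𝓝 (m ⊗ₜ n)) = g (of 𝓜 𝓝 (m ⊗ₜ n))) : f = g :=
  (TensorProduct.ext' h : f ∘ₗ (of 𝓜 𝓝).toLinearMap = g ∘ₗ (of 𝓜 𝓝).toLinearMap)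

variable {𝓜 𝓝} in
theorem hom_ext_homogeneous {X : Type*} [AddCommGroup X] [Module k X]
    {f g : STensor 𝓜 𝓝 →ₗ[k] X}
    (h : ∀ i j, ∀ m ∈ 𝓜 i, ∀ n ∈ 𝓝 j, f (of 𝓜 𝓝 (m ⊗ₜ n)) = g (of 𝓜 𝓝 (m ⊗ₜ n))) : f = g := by
  refine hom_ext fun m n => ?_
  rw [← pr_add_pr 𝓜 m, ← pr_add_pr 𝓝 n]
  simp only [TensorProduct.add_tmul, TensorProduct.tmul_add, map_add]
  simp only [h _ _ _ (pr_mem 𝓜 _ _) _ (pr_mem 𝓝 _ _)]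

variable {𝓜 𝓝} in
theorem conv_ext {X : Type*} [Ring X] [Algebra k X]
    {f g : WithConv (STensor 𝓜 𝓝 →ₗ[k] X)}
    (h : ∀ i j, ∀ m ∈ 𝓜 i, ∀ n ∈ 𝓝 j, f (of 𝓜 𝓝 (m ⊗ₜ n)) = g (of 𝓜 𝓝 (m ⊗ₜ n))) : f = g :=
  ofConv_injective (hom_ext_homogeneous h)

/-- The coalgebra map `m ⊗ n ↦ ε(n) m`. -/
def fst : STensor 𝓜 𝓝 →ₗc[k] M where
  toLinearMap := (TensorProduct.rid k M).toLinearMap ∘ₗ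
    LinearMap.lTensor M Coalgebra.counit ∘ₗ (of 𝓜 𝓝).symm.toLinearMap
  counit_comp := hom_ext fun m n => by
    simp [mul_comm]
  map_comp_comul := hom_ext fun m n => by
    -- The counit of `N` is blind to `par`, so the two halves of the exchange add up to the
    -- identity.
    have h : TensorProduct.map ((TensorProduct.rid k M).toLinearMap ∘ₗ
        LinearMap.lTensor M (Coalgebra.counit (R := k) (A := N))) ((TensorProduct.rid k M).toLinearMap ∘ₗ
        LinearMap.lTensor M (Coalgebra.counit (R := k) (A := N))) ∘ₗ shuffle (pr 𝓜) (par 𝓝) =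
        (TensorProduct.rid k _).toLinearMap ∘ₗ LinearMap.lTensor _ (Coalgebra.counit (R := k) (A := N) ∘ₗ
          (TensorProduct.rid k N).toLinearMap ∘ₗ LinearMap.lTensor N Coalgebra.counit) := by
      ext x y u v
      simp
      rw [← smul_add, ← TensorProduct.tmul_add, pr_add_pr, ← TensorProduct.smul_tmul', smul_smul]
    have h' := LinearMap.congr_fun h (Coalgebra.comul (R := k) m ⊗ₜ Coalgebra.comul (R := k) n)
    simp only [LinearMap.comp_apply, LinearMap.lTensor_tmul,
      Coalgebra.lTensor_counit_comul] at h'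
    rw [LinearMap.comp_apply, comul_of, ← LinearMap.comp_apply, ← TensorProduct.map_comp]
    refine h'.trans ?_
    simp

/-- The coalgebra map `m ⊗ n ↦ ε(m) n`. -/
def snd : STensor 𝓜 𝓝 →ₗc[k] N where
  toLinearMap := (TensorProduct.lid k N).toLinearMap ∘ₗ
    LinearMap.rTensor N Coalgebra.counit ∘ₗ (of 𝓜 𝓝).symm.toLinearMap
  counit_comp := hom_ext fun m n => by
    simp
  map_comp_comul := hom_ext fun m n => by
    have h : TensorProduct.map ((TensorProduct.lid k N).toLinearMap ∘ₗ
        LinearMap.rTensor N Coalgebra.counit) ((TensorProduct.lid k N).toLinearMap ∘ₗ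
        LinearMap.rTensor N Coalgebra.counit) ∘ₗ shuffle (pr 𝓜) (par 𝓝) =
        (TensorProduct.lid k _).toLinearMap ∘ₗ LinearMap.rTensor _ (Coalgebra.counit ∘ₗ
          (TensorProduct.rid k M).toLinearMap ∘ₗ LinearMap.lTensor M Coalgebra.counit) := by
      ext x y u v
      simp [counit_pr_zero, IsSuperCoalgebra.counit_pr_one]
      rw [← TensorProduct.smul_tmul', smul_smul]
    have h' := LinearMap.congr_fun h (Coalgebra.comul (R := k) m ⊗ₜ Coalgebra.comul (R := k) n)
    simp only [LinearMap.comp_apply, LinearMap.rTensor_tmul,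
      Coalgebra.lTensor_counit_comul] at h'
    rw [LinearMap.comp_apply, comul_of, ← LinearMap.comp_apply, ← TensorProduct.map_comp]
    refine h'.trans ?_
    simp

/-- The map `m ⊗ n ↦ ε(n) f(m)`. -/
def inl : WithConv (M →ₗ[k] A) →* WithConv (STensor 𝓜 𝓝 →ₗ[k] A) := convPull (fst 𝓜 𝓝)

/-- The map `m ⊗ n ↦ ε(m) f(n)`. -/
def inr : WithConv (N →ₗ[k] A) →* WithConv (STensor 𝓜 𝓝 →ₗ[k] A) := convPull (snd 𝓜 𝓝)

theorem inl_of (f : WithConv (M →ₗ[k] A)) (m : M) (n : N) :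
    inl 𝓜 𝓝 f (of 𝓜 𝓝 (m ⊗ₜ n)) = Coalgebra.counit (R := k) n • f m :=
  map_smul f.ofConv _ _

theorem inr_of (f : WithConv (N →ₗ[k] A)) (m : M) (n : N) :
    inr 𝓜 𝓝 f (of 𝓜 𝓝 (m ⊗ₜ n)) = Coalgebra.counit (R := k) m • f n :=
  map_smul f.ofConv _ _

theorem conv_of (F G : WithConv (STensor 𝓜 𝓝 →ₗ[k] A)) (m : M) (n : N) :
    (F * G) (of 𝓜 𝓝 (m ⊗ₜ n)) = LinearMap.mul' k A (TensorProduct.map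
      (F.ofConv ∘ₗ (of 𝓜 𝓝).toLinearMap) (G.ofConv ∘ₗ (of 𝓜 𝓝).toLinearMap)
      (shuffle (pr 𝓜) (par 𝓝) (Coalgebra.comul (R := k) m ⊗ₜ Coalgebra.comul (R := k) n))) := by
  rw [LinearMap.convMul_apply, comul_of, TensorProduct.map_comp, LinearMap.comp_apply]

/-- The counits fall on `m₂` and `n₁`, the elements that the coproduct exchanges. Being zero in odd
degree, they leave no sign. -/
theorem inl_mul_inr (f : WithConv (M →ₗ[k] A)) (g : WithConv (N →ₗ[k] A)) (m : M) (n : N) :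
    (inl 𝓜 𝓝 f * inr 𝓜 𝓝 g) (of 𝓜 𝓝 (m ⊗ₜ n)) = f m * g n := by
  have h : LinearMap.mul' k A ∘ₗ TensorProduct.map
      ((inl 𝓜 𝓝 f).ofConv ∘ₗ (of 𝓜 𝓝).toLinearMap)
      ((inr 𝓜 𝓝 g).ofConv ∘ₗ (of 𝓜 𝓝).toLinearMap) ∘ₗ shuffle (pr 𝓜) (par 𝓝) =
      LinearMap.mul' k A ∘ₗ TensorProduct.map f.ofConv g.ofConv ∘ₗ
        TensorProduct.map ((TensorProduct.rid k M).toLinearMap ∘ₗ LinearMap.lTensor M Coalgebra.counit)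
        ((TensorProduct.lid k N).toLinearMap ∘ₗ LinearMap.rTensor N Coalgebra.counit) := by
    ext x y u v
    simp [inl_of, inr_of, counit_pr_zero, IsSuperCoalgebra.counit_pr_one]
    rw [smul_comm]
  rw [conv_of]
  refine (LinearMap.congr_fun h (Coalgebra.comul (R := k) m ⊗ₜ Coalgebra.comul (R := k) n)).trans ?_
  simp

variable {𝓜 𝓝} in
-- Now the counits fall on `m₁` and `n₂`, and the exchange of the surviving elements remains as a
-- sign.
theorem inr_mul_inl (f : WithConv (M →ₗ[k] A)) (g : WithConv (N →ₗ[k] A)) {i j : ZMod 2}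
    {m : M} (hm : m ∈ 𝓜 i) {n : N} (hn : n ∈ 𝓝 j) :
    (inr 𝓜 𝓝 g * inl 𝓜 𝓝 f) (of 𝓜 𝓝 (m ⊗ₜ n)) = sgn k (i * j) • (g n * f m) := by
  have h : LinearMap.mul' k A ∘ₗ TensorProduct.map
      ((inr 𝓜 𝓝 g).ofConv ∘ₗ (of 𝓜 𝓝).toLinearMap)
      ((inl 𝓜 𝓝 f).ofConv ∘ₗ (of 𝓜 𝓝).toLinearMap) ∘ₗ shuffle (pr 𝓜) (par 𝓝) =
      LinearMap.mul' k A ∘ₗ (TensorProduct.map g.ofConv (f.ofConv ∘ₗ pr 𝓜 0) +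
          TensorProduct.map (g.ofConv ∘ₗ par 𝓝) (f.ofConv ∘ₗ pr 𝓜 1)) ∘ₗ
        (TensorProduct.comm k M N).toLinearMap ∘ₗ
        TensorProduct.map ((TensorProduct.lid k M).toLinearMap ∘ₗ LinearMap.rTensor M Coalgebra.counit)
        ((TensorProduct.rid k N).toLinearMap ∘ₗ LinearMap.lTensor N Coalgebra.counit) := by
    ext x y u v
    simp [inl_of, inr_of]
  rw [conv_of]
  refine (LinearMap.congr_fun h (Coalgebra.comul (R := k) m ⊗ₜ Coalgebra.comul (R := k) n)).trans ?_
  rcases zmod_two_cases i with rfl | rfl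
  · simp [pr_of_mem hm, pr_of_mem_ne hm (by decide : (0 : ZMod 2) ≠ 1)]
  · simp [pr_of_mem hm, pr_of_mem_ne hm (by decide : (1 : ZMod 2) ≠ 0), par_of_mem hn]

variable {𝓜 𝓝} in
/-- Maps with super-commuting values commute for convolution. -/
theorem inl_commute_inr {f : WithConv (M →ₗ[k] A)} {g : WithConv (N →ₗ[k] A)}
    (h : ∀ i j, ∀ m ∈ 𝓜 i, ∀ n ∈ 𝓝 j, f m * g n = sgn k (i * j) • (g n * f m)) :
    Commute (inl 𝓜 𝓝 f) (inr 𝓜 𝓝 g) :=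
  conv_ext fun i j m hm n hn => by
    rw [inl_mul_inr, inr_mul_inl f g hm hn, h i j m hm n hn]

end

end STensor

/-! ### Super-Hopf algebras in terms of convolution -/

section

variable {k : Type*} [Field k]
  {A : Type*} [Ring A] [Algebra k A] (𝓐 : ZMod 2 → Submodule k A) [GradedAlgebra 𝓐]
  {B : Type*} [Ring B] [Algebra k B] (𝓑 : ZMod 2 → Submodule k B) [GradedAlgebra 𝓑]

theorem graded_tmul_mul_tmul {i j : ZMod 2} (a : A) {b : B} (hb : b ∈ 𝓑 i) {a' : A}
    (ha : a' ∈ 𝓐 j) (b' : B) :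
    GradedTensorProduct.of k 𝓐 𝓑 (a ⊗ₜ b) * GradedTensorProduct.of k 𝓐 𝓑 (a' ⊗ₜ b') =
      sgn k (i * j) • GradedTensorProduct.of k 𝓐 𝓑 ((a * a') ⊗ₜ (b * b')) := by
  rw [← unit_smul]
  exact GradedTensorProduct.tmul_coe_mul_coe_tmul 𝓐 𝓑 a ⟨b, hb⟩ ⟨a', ha⟩ b'

/-- Expresses the product of `ᵍ⊗` through `shuffle`, so that products of super tensor squares and
coproducts of `STensor` obey the same sign rule and can be compared. -/
theorem graded_mul (X Y : A ⊗[k] B) :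
    GradedTensorProduct.of k 𝓐 𝓑 X * GradedTensorProduct.of k 𝓐 𝓑 Y =
      GradedTensorProduct.of k 𝓐 𝓑 (TensorProduct.map (LinearMap.mul' k A) (LinearMap.mul' k B)
        (shuffle (pr 𝓑) (par 𝓐) (X ⊗ₜ Y))) := by
  induction X with
  | zero => simp
  | add X X' h h' => simp only [map_add, add_mul, h, h', TensorProduct.add_tmul]
  | tmul a b =>
    induction Y with
    | zero => simp
    | add Y Y' h h' => simp only [map_add, mul_add, h, h', TensorProduct.tmul_add]
    | tmul a' b' =>
      rw [← pr_add_pr 𝓑 b, ← pr_add_pr 𝓐 a']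
      simp only [TensorProduct.add_tmul, TensorProduct.tmul_add, map_add, add_mul, mul_add]
      simp only [graded_tmul_mul_tmul 𝓐 𝓑 _ (pr_mem 𝓑 _ b) (pr_mem 𝓐 _ a'),
        shuffle_of_mem _ (pr_mem 𝓑 _ b) (pr_mem 𝓐 _ a'), map_smul, TensorProduct.map_tmul,
        LinearMap.mul'_apply]

end

section

variable {k : Type*} [Field k] {B : Type*} [Ring B] [Algebra k B] [Coalgebra k B]
  {𝓑 : ZMod 2 → Submodule k B} [GradedAlgebra 𝓑] {S : B →ₗ[k] B}

theorem SuperRepr.map_comul {b : B} (r : SuperRepr 𝓑 b) {X : Type*} [AddCommGroup X] [Module k X]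
    (f : B ⊗[k] B →ₗ[k] X) :
    f (Coalgebra.comul (R := k) b) = ∑ s, f (r.fst s ⊗ₜ r.snd s) := by
  rw [← r.eq, map_sum]

namespace IsSuperHopf

/-- All terms of the presentation have total degree `l`, so projecting to total degree `i` keeps
everything or nothing. This turns the existential form of gradedness into the equation of
`IsSuperCoalgebra`. -/
theorem comul_pr_aux {l : ZMod 2} {b : B} (r : SuperRepr 𝓑 b) (hr : ∀ s, r.deg₁ s + r.deg₂ s = l)
    (i : ZMod 2) :
    TensorProduct.map (pr 𝓑 0) (pr 𝓑 i) (Coalgebra.comul (R := k) b) +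
      TensorProduct.map (pr 𝓑 1) (pr 𝓑 (i + 1)) (Coalgebra.comul (R := k) b) =
    if i = l then Coalgebra.comul (R := k) b else 0 := by
  rw [← r.eq]
  simp only [map_sum, TensorProduct.map_tmul]
  rw [← Finset.sum_add_distrib]
  have key : ∀ s, pr 𝓑 0 (r.fst s) ⊗ₜ[k] pr 𝓑 i (r.snd s) +
      pr 𝓑 1 (r.fst s) ⊗ₜ[k] pr 𝓑 (i + 1) (r.snd s) =
      if i = l then r.fst s ⊗ₜ[k] r.snd s else 0 := fun s => by
    -- Each component is replaced by its own projection; `pr_pr` then leaves a finite check over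
    -- degrees.
    rw [← pr_of_mem (r.fst_mem s), ← pr_of_mem (r.snd_mem s), ← hr s]
    simp only [pr_pr]
    generalize r.deg₁ s = p
    generalize r.deg₂ s = q
    rcases zmod_two_cases i with rfl | rfl <;> rcases zmod_two_cases p with rfl | rfl <;>
      rcases zmod_two_cases q with rfl | rfl <;> simp [show (1 + 1 : ZMod 2) = 0 by decide]
  rw [Finset.sum_congr rfl fun s _ => key s]
  split_ifs <;> simp

theorem isSuperCoalgebra (h : IsSuperHopf 𝓑 S) : IsSuperCoalgebra 𝓑 where
  comul_pr i m := by
    have h' : ∀ l, TensorProduct.map (pr 𝓑 0) (pr 𝓑 i) (Coalgebra.comul (R := k) (pr 𝓑 l m)) +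
        TensorProduct.map (pr 𝓑 1) (pr 𝓑 (i + 1)) (Coalgebra.comul (R := k) (pr 𝓑 l m)) =
        if i = l then Coalgebra.comul (R := k) (pr 𝓑 l m) else 0 := fun l => by
      obtain ⟨r, hr⟩ := h.comul_graded l _ (pr_mem 𝓑 l m)
      exact comul_pr_aux r hr i
    conv_rhs => rw [← pr_add_pr 𝓑 m]
    simp only [map_add]
    rw [add_add_add_comm, h', h']
    rcases zmod_two_cases i with rfl | rfl <;> simp
  counit_pr_one m := h.counit_graded _ (pr_mem _ _ _)

theorem conv_left (h : IsSuperHopf 𝓑 S) : toConv S * toConv LinearMap.id = 1 :=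
  congrArg toConv h.antipode_left

theorem conv_right (h : IsSuperHopf 𝓑 S) : toConv LinearMap.id * toConv S = 1 :=
  congrArg toConv h.antipode_right

/-- The product of a super-Hopf algebra is a map of coalgebras. -/
def mulHom [IsSuperCoalgebra 𝓑] (h : IsSuperHopf 𝓑 S) : STensor 𝓑 𝓑 →ₗc[k] B where
  toLinearMap := LinearMap.mul' k B ∘ₗ (STensor.of 𝓑 𝓑).symm.toLinearMap
  counit_comp := STensor.hom_ext fun a b => by
    simp [h.counit_mul]
  map_comp_comul := STensor.hom_ext fun a b => by
    rw [LinearMap.comp_apply, STensor.comul_of, ← LinearMap.comp_apply, ← TensorProduct.map_comp]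
    apply (GradedTensorProduct.of k 𝓑 𝓑).injective
    refine Eq.trans ?_ (h.comul_mul a b).symm
    rw [graded_mul]
    rfl

/-- Both sides invert the product `B ⊗ B → B` for convolution on `STensor 𝓑 𝓑`. The pullback of `S`
is a left inverse because the product is a coalgebra map, `inr S * inl S` is a right inverse by
cancelling from the middle, and a left inverse equals a right inverse. -/
theorem antipode_mul [IsSuperCoalgebra 𝓑] (h : IsSuperHopf 𝓑 S) {i j : ZMod 2} {a b : B}
    (ha : a ∈ 𝓑 i) (hb : b ∈ 𝓑 j) : S (a * b) = sgn k (i * j) • (S b * S a) := by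
  have h1 : STensor.inl 𝓑 𝓑 (toConv LinearMap.id) * STensor.inr 𝓑 𝓑 (toConv LinearMap.id) =
      convPull h.mulHom (toConv LinearMap.id) := STensor.conv_ext fun i j m _ n _ => by
    rw [STensor.inl_mul_inr]; rfl
  have h2 : convPull h.mulHom (toConv S) *
      (STensor.inl 𝓑 𝓑 (toConv LinearMap.id) * STensor.inr 𝓑 𝓑 (toConv LinearMap.id)) = 1 := by
    rw [h1, ← map_mul, h.conv_left, map_one]
  have h3 : (STensor.inl 𝓑 𝓑 (toConv LinearMap.id) * STensor.inr 𝓑 𝓑 (toConv LinearMap.id)) *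
      (STensor.inr 𝓑 𝓑 (toConv S) * STensor.inl 𝓑 𝓑 (toConv S)) = 1 := by
    rw [mul_assoc, ← mul_assoc (STensor.inr 𝓑 𝓑 _), ← map_mul (STensor.inr 𝓑 𝓑), h.conv_right,
      map_one, one_mul, ← map_mul, h.conv_right, map_one]
  have h4 := left_inv_eq_right_inv h2 h3
  have h5 := congrArg (fun f => f.ofConv (STensor.of 𝓑 𝓑 (a ⊗ₜ b))) h4
  exact h5.trans (STensor.inr_mul_inl (toConv S) (toConv S) ha hb)

theorem antipode_one (h : IsSuperHopf 𝓑 S) : S 1 = 1 := by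
  have := LinearMap.congr_fun h.antipode_left 1
  simpa [h.comul_one, h.counit_one] using this

variable (𝓑) in
/-- The map `x ⊗ y ↦ (-1)^{|x||y|} f(y) g(x)`. -/
def flipMul (f g : B →ₗ[k] B) : B ⊗[k] B →ₗ[k] B :=
  LinearMap.mul' k B ∘ₗ (TensorProduct.map f (g ∘ₗ pr 𝓑 0) +
    TensorProduct.map (f ∘ₗ par 𝓑) (g ∘ₗ pr 𝓑 1)) ∘ₗ (TensorProduct.comm k B B).toLinearMap

theorem flipMul_of_mem (f g : B →ₗ[k] B) {i j : ZMod 2} {x y : B} (hx : x ∈ 𝓑 i) (hy : y ∈ 𝓑 j) :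
    flipMul 𝓑 f g (x ⊗ₜ y) = sgn k (i * j) • (f y * g x) := by
  rcases zmod_two_cases i with rfl | rfl
  · simp [flipMul, pr_of_mem hx, pr_of_mem_ne hx (by decide : (0 : ZMod 2) ≠ 1)]
  · simp [flipMul, pr_of_mem hx, pr_of_mem_ne hx (by decide : (1 : ZMod 2) ≠ 0), par_of_mem hy]

variable (𝓑) in
theorem tensor_homogeneous_ext {X : Type*} [AddCommGroup X] [Module k X]
    {f g : B ⊗[k] B →ₗ[k] X}
    (h : ∀ i j, ∀ x ∈ 𝓑 i, ∀ y ∈ 𝓑 j, f (x ⊗ₜ y) = g (x ⊗ₜ y)) : f = g := by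
  refine TensorProduct.ext' fun m n => ?_
  rw [← pr_add_pr 𝓑 m, ← pr_add_pr 𝓑 n]
  simp only [TensorProduct.add_tmul, TensorProduct.tmul_add, map_add]
  simp only [h _ _ _ (pr_mem 𝓑 _ _) _ (pr_mem 𝓑 _ _)]

/-- The inverse of a bijective antipode. -/
def invAntipode (S : B →ₗ[k] B) (hS : Function.Bijective S) : B →ₗ[k] B :=
  (LinearEquiv.ofBijective S hS).symm.toLinearMap

@[simp] theorem apply_invAntipode (hS : Function.Bijective S) (x : B) :
    S (invAntipode S hS x) = x :=
  (LinearEquiv.ofBijective S hS).apply_symm_apply x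

/-- As `S` preserves degrees, it already maps the degree `i` part of `S⁻¹ x` to `x`; injectivity
identifies that part with `S⁻¹ x`. -/
theorem invAntipode_mem (h : IsSuperHopf 𝓑 S) (hS : Function.Bijective S) {i : ZMod 2} {x : B}
    (hx : x ∈ 𝓑 i) : invAntipode S hS x ∈ 𝓑 i := by
  have h0 : S (pr 𝓑 i (invAntipode S hS x)) = x := by
    have h1 : pr 𝓑 i (S (invAntipode S hS x)) = x := by rw [apply_invAntipode, pr_of_mem hx]
    conv_rhs => rw [← h1, ← pr_add_pr 𝓑 (invAntipode S hS x)]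
    rw [map_add, map_add]
    rcases zmod_two_cases i with rfl | rfl
    · rw [pr_of_mem (h.antipode_graded _ _ (pr_mem 𝓑 0 _)),
        pr_of_mem_ne (h.antipode_graded _ _ (pr_mem 𝓑 1 _)) (by decide), add_zero]
    · rw [pr_of_mem (h.antipode_graded _ _ (pr_mem 𝓑 1 _)),
        pr_of_mem_ne (h.antipode_graded _ _ (pr_mem 𝓑 0 _)) (by decide), zero_add]
  have h1 : pr 𝓑 i (invAntipode S hS x) = invAntipode S hS x :=
    hS.1 (h0.trans (apply_invAntipode hS x).symm)
  rw [← h1]; exact pr_mem _ _ _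

/-- Applying `S`, which reverses products with a sign, turns the claim into the antipode axiom for
`S`. In effect `S⁻¹` is the antipode for the super-opposite product. -/
theorem flipMul_invAntipode_left [IsSuperCoalgebra 𝓑] (h : IsSuperHopf 𝓑 S)
    (hS : Function.Bijective S) (b : B) :
    flipMul 𝓑 (invAntipode S hS) LinearMap.id (Coalgebra.comul (R := k) b) =
      algebraMap k B (Coalgebra.counit (R := k) b) := by
  have h0 : S ∘ₗ flipMul 𝓑 (invAntipode S hS) LinearMap.id =
      LinearMap.mul' k B ∘ₗ TensorProduct.map S LinearMap.id :=
    tensor_homogeneous_ext 𝓑 fun i j x hx y hy => by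
      simp [flipMul_of_mem _ _ hx hy, h.antipode_mul (h.invAntipode_mem hS hy) hx, smul_smul,
        mul_comm j i]
  apply hS.1
  rw [← LinearMap.comp_apply, h0]
  refine (LinearMap.congr_fun h.antipode_left b).trans ?_
  simp [Algebra.algebraMap_eq_smul_one, h.antipode_one]

theorem flipMul_invAntipode_right [IsSuperCoalgebra 𝓑] (h : IsSuperHopf 𝓑 S)
    (hS : Function.Bijective S) (b : B) :
    flipMul 𝓑 LinearMap.id (invAntipode S hS) (Coalgebra.comul (R := k) b) =
      algebraMap k B (Coalgebra.counit (R := k) b) := by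
  have h0 : S ∘ₗ flipMul 𝓑 LinearMap.id (invAntipode S hS) =
      LinearMap.mul' k B ∘ₗ TensorProduct.map LinearMap.id S :=
    tensor_homogeneous_ext 𝓑 fun i j x hx y hy => by
      simp [flipMul_of_mem _ _ hx hy, h.antipode_mul hy (h.invAntipode_mem hS hx), smul_smul,
        mul_comm j i]
  apply hS.1
  rw [← LinearMap.comp_apply, h0]
  refine (LinearMap.congr_fun h.antipode_right b).trans ?_
  simp [Algebra.algebraMap_eq_smul_one, h.antipode_one]

end IsSuperHopf

end

/-! ### Maps from a super-Hopf algebra and from its opposite -/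

section

variable {k : Type*} [Field k] {B : Type*} [Ring B] [Algebra k B]
  (𝓑 : ZMod 2 → Submodule k B) {A : Type*} [Ring A] [Algebra k A] {A' : Type*} [Ring A']
  [Algebra k A']

/-- Algebra maps from `B` with the super-opposite product `a · b = (-1)^{|a||b|} b a`. -/
structure IsAntiHom (f : B →ₗ[k] A) : Prop where
  map_one : f 1 = 1
  map_mul : ∀ i j, ∀ a ∈ 𝓑 i, ∀ b ∈ 𝓑 j, f a * f b = sgn k (i * j) • f (b * a)

variable {𝓑} in
theorem IsAntiHom.comp {f : B →ₗ[k] A} (hf : IsAntiHom 𝓑 f) (g : A →ₐ[k] A') :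
    IsAntiHom 𝓑 (g.toLinearMap ∘ₗ f) where
  map_one := by simp [hf.map_one]
  map_mul i j a ha b hb := by
    simp [← _root_.map_mul g, hf.map_mul i j a ha b hb]

variable [Coalgebra k B] [GradedAlgebra 𝓑] {S : B →ₗ[k] B}

variable {𝓑}

/-- Puts antimultiplicativity into one equation of the convolution algebra, where its stability
under convolution products is a matter of reordering factors. -/
theorem IsAntiHom.convPull_mulHom [IsSuperCoalgebra 𝓑] (h : IsSuperHopf 𝓑 S) {f : B →ₗ[k] A}
    (hf : IsAntiHom 𝓑 f) :
    convPull h.mulHom (toConv f) = STensor.inr 𝓑 𝓑 (toConv f) * STensor.inl 𝓑 𝓑 (toConv f) :=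
  STensor.conv_ext fun i j a ha b hb => by
    rw [STensor.inr_mul_inl _ _ ha hb]
    change f (a * b) = sgn k (i * j) • (f b * f a)
    rw [hf.map_mul j i b hb a ha, smul_smul, mul_comm j i, sgn_mul_self, one_smul]

/-- The convolution product of super-antihomomorphisms with super-commuting values is a
super-antihomomorphism. -/
theorem IsAntiHom.mul [IsSuperCoalgebra 𝓑] (h : IsSuperHopf 𝓑 S) {f g : B →ₗ[k] A}
    (hf : IsAntiHom 𝓑 f) (hg : IsAntiHom 𝓑 g)
    (hfg : ∀ i j, ∀ a ∈ 𝓑 i, ∀ b ∈ 𝓑 j, f a * g b = sgn k (i * j) • (g b * f a)) :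
    IsAntiHom 𝓑 (toConv f * toConv g).ofConv where
  map_one := by
    change (toConv f * toConv g) 1 = 1
    simp [h.comul_one, hf.map_one, hg.map_one]
  map_mul i j a ha b hb := by
    have h1 : convPull h.mulHom (toConv f * toConv g) =
        STensor.inr 𝓑 𝓑 (toConv f * toConv g) * STensor.inl 𝓑 𝓑 (toConv f * toConv g) := by
      -- Super-commutation lets `inl f` pass `inr g`, which regroups `inr f * inl f * inr g * inl g`
      -- as `inr (f * g) * inl (f * g)`.
      have hc := STensor.inl_commute_inr (𝓜 := 𝓑) (𝓝 := 𝓑) (f := toConv f) (g := toConv g) hfg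
      rw [_root_.map_mul, hf.convPull_mulHom h, hg.convPull_mulHom h, _root_.map_mul,
        _root_.map_mul]
      simp only [mul_assoc]
      rw [← mul_assoc (STensor.inl 𝓑 𝓑 (toConv f)), hc.eq]
      simp only [mul_assoc]
    have h2 := congrArg (fun f => f.ofConv (STensor.of 𝓑 𝓑 (b ⊗ₜ a))) h1
    have h3 := h2.trans (STensor.inr_mul_inl (toConv f * toConv g) (toConv f * toConv g) hb ha)
    change (toConv f * toConv g).ofConv (b * a) = sgn k (j * i) • ((toConv f * toConv g).ofConv a
      * (toConv f * toConv g).ofConv b) at h3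
    rw [h3, smul_smul, mul_comm j i, sgn_mul_self, one_smul]

/-- The convolution product of algebra homomorphisms with super-commuting values is an algebra
homomorphism. -/
def convAlgHom [IsSuperCoalgebra 𝓑] (h : IsSuperHopf 𝓑 S) (f g : B →ₐ[k] A)
    (hfg : ∀ i j, ∀ a ∈ 𝓑 i, ∀ b ∈ 𝓑 j, g a * f b = sgn k (i * j) • (f b * g a)) : B →ₐ[k] A :=
  AlgHom.ofLinearMap (toConv f.toLinearMap * toConv g.toLinearMap).ofConv
    (by
      change (toConv f.toLinearMap * toConv g.toLinearMap) 1 = 1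
      simp [h.comul_one])
    (by
      have h0 : ∀ f : B →ₐ[k] A, convPull h.mulHom (toConv f.toLinearMap) =
          STensor.inl 𝓑 𝓑 (toConv f.toLinearMap) * STensor.inr 𝓑 𝓑 (toConv f.toLinearMap) :=
        fun f => STensor.conv_ext fun i j a ha b hb => by
          rw [STensor.inl_mul_inr]
          exact map_mul f a b
      have h1 : convPull h.mulHom (toConv f.toLinearMap * toConv g.toLinearMap) =
          STensor.inl 𝓑 𝓑 (toConv f.toLinearMap * toConv g.toLinearMap) *
            STensor.inr 𝓑 𝓑 (toConv f.toLinearMap * toConv g.toLinearMap) := by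
        have hc := STensor.inl_commute_inr (𝓜 := 𝓑) (𝓝 := 𝓑) (f := toConv g.toLinearMap)
          (g := toConv f.toLinearMap) hfg
        rw [map_mul, h0, h0, map_mul, map_mul]
        simp only [mul_assoc]
        rw [← mul_assoc (STensor.inl 𝓑 𝓑 (toConv g.toLinearMap)), hc.eq]
        simp only [mul_assoc]
      intro a b
      have h2 := congrArg (fun f => f.ofConv (STensor.of 𝓑 𝓑 (a ⊗ₜ b))) h1
      exact h2.trans (STensor.inl_mul_inr 𝓑 𝓑 _ _ a b))

theorem algHom_conv_antipode (h : IsSuperHopf 𝓑 S) (f : B →ₐ[k] A) :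
    toConv f.toLinearMap * toConv (f.toLinearMap ∘ₗ S) = 1 := by
  have := congrArg (convPush B f) h.conv_right
  rwa [map_mul, map_one] at this

theorem antipode_conv_algHom (h : IsSuperHopf 𝓑 S) (f : B →ₐ[k] A) :
    toConv (f.toLinearMap ∘ₗ S) * toConv f.toLinearMap = 1 := by
  have := congrArg (convPush B f) h.conv_left
  rwa [map_mul, map_one] at this

/-- A super-antihomomorphism is an algebra map from the super-opposite algebra, whose antipode is
`S⁻¹`; hence the inverse is `f ∘ S⁻¹` and not `f ∘ S`. -/
theorem IsAntiHom.conv_invAntipode [IsSuperCoalgebra 𝓑] (h : IsSuperHopf 𝓑 S)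
    (hS : Function.Bijective S) {f : B →ₗ[k] A} (hf : IsAntiHom 𝓑 f) :
    toConv f * toConv (f ∘ₗ IsSuperHopf.invAntipode S hS) = 1 := by
  have h0 : LinearMap.mul' k A ∘ₗ TensorProduct.map f (f ∘ₗ IsSuperHopf.invAntipode S hS) =
      f ∘ₗ IsSuperHopf.flipMul 𝓑 (IsSuperHopf.invAntipode S hS) LinearMap.id :=
    IsSuperHopf.tensor_homogeneous_ext 𝓑 fun i j x hx y hy => by
      simp [IsSuperHopf.flipMul_of_mem _ _ hx hy, hf.map_mul i j _ hx _ (h.invAntipode_mem hS hy)]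
  ext b
  refine (LinearMap.congr_fun h0 (Coalgebra.comul (R := k) b)).trans ?_
  rw [LinearMap.comp_apply, h.flipMul_invAntipode_left hS]
  simp [Algebra.algebraMap_eq_smul_one, hf.map_one]

theorem IsAntiHom.invAntipode_conv [IsSuperCoalgebra 𝓑] (h : IsSuperHopf 𝓑 S)
    (hS : Function.Bijective S) {f : B →ₗ[k] A} (hf : IsAntiHom 𝓑 f) :
    toConv (f ∘ₗ IsSuperHopf.invAntipode S hS) * toConv f = 1 := by
  have h0 : LinearMap.mul' k A ∘ₗ TensorProduct.map (f ∘ₗ IsSuperHopf.invAntipode S hS) f =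
      f ∘ₗ IsSuperHopf.flipMul 𝓑 LinearMap.id (IsSuperHopf.invAntipode S hS) :=
    IsSuperHopf.tensor_homogeneous_ext 𝓑 fun i j x hx y hy => by
      simp [IsSuperHopf.flipMul_of_mem _ _ hx hy, hf.map_mul i j _ (h.invAntipode_mem hS hx) _ hy]
  ext b
  refine (LinearMap.congr_fun h0 (Coalgebra.comul (R := k) b)).trans ?_
  rw [LinearMap.comp_apply, h.flipMul_invAntipode_right hS]
  simp [Algebra.algebraMap_eq_smul_one, hf.map_one]

end

/-! ### The pairing and the cross relation in terms of convolution -/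

section

variable {k : Type*} [Field k]
  {C : Type*} [Ring C] [Algebra k C] [Coalgebra k C] {𝓒 : ZMod 2 → Submodule k C}
  [GradedAlgebra 𝓒] [IsSuperCoalgebra 𝓒]
  {B : Type*} [Ring B] [Algebra k B] [Coalgebra k B] {𝓑 : ZMod 2 → Submodule k B}
  [GradedAlgebra 𝓑] [IsSuperCoalgebra 𝓑]
  {A : Type*} [Ring A] [Algebra k A]

theorem STensor.conv_repr (F G : WithConv (STensor 𝓒 𝓑 →ₗ[k] A)) {c : C} (t : SuperRepr 𝓒 c)
    {b : B} (r : SuperRepr 𝓑 b) : (F * G) (STensor.of 𝓒 𝓑 (c ⊗ₜ b)) =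
      ∑ s, ∑ u, sgn k (t.deg₂ u * r.deg₁ s) • (F (STensor.of 𝓒 𝓑 (t.fst u ⊗ₜ r.fst s)) *
        G (STensor.of 𝓒 𝓑 (t.snd u ⊗ₜ r.snd s))) := by
  rw [STensor.conv_of, ← t.eq, ← r.eq]
  simp only [TensorProduct.tmul_sum, TensorProduct.sum_tmul, map_sum]
  refine Finset.sum_congr rfl fun s _ => Finset.sum_congr rfl fun u _ => ?_
  rw [shuffle_of_mem _ (t.snd_mem u) (r.fst_mem s)]
  simp

theorem IsSuperDual.apply_eq_zero {ev : C →ₗ[k] B →ₗ[k] k} (hev : IsSuperDual 𝓒 𝓑 ev)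
    {i j : ZMod 2} {c : C} (hc : c ∈ 𝓒 i) {b : B} (hb : b ∈ 𝓑 j) (hij : i ≠ j) : ev c b = 0 := by
  have h : ∀ i j : ZMod 2, i ≠ j → i + j ≠ 0 := by decide
  exact hev.graded i j c b hc hb (h i j hij)

/-- Where the pairing does not vanish the two degrees agree, so in a coefficient one may replace the
other. Signs involving `B` become signs involving `C` in this way. -/
theorem IsSuperDual.mul_apply {ev : C →ₗ[k] B →ₗ[k] k} (hev : IsSuperDual 𝓒 𝓑 ev)
    (f : ZMod 2 → k) {i j : ZMod 2} {c : C} (hc : c ∈ 𝓒 i) {b : B} (hb : b ∈ 𝓑 j) :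
    f j * ev c b = f i * ev c b := by
  by_cases h : i = j
  · rw [h]
  · rw [hev.apply_eq_zero hc hb h, mul_zero, mul_zero]

variable (𝓒 𝓑) in
/-- A pairing, as a functional on the super tensor product. -/
def pairing (ev : C →ₗ[k] B →ₗ[k] k) : WithConv (STensor 𝓒 𝓑 →ₗ[k] k) :=
  toConv (TensorProduct.lift ev ∘ₗ (STensor.of 𝓒 𝓑).symm.toLinearMap)

@[simp] theorem pairing_of (ev : C →ₗ[k] B →ₗ[k] k) (c : C) (b : B) :
    pairing 𝓒 𝓑 ev (STensor.of 𝓒 𝓑 (c ⊗ₜ b)) = ev c b := rfl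

/-- As `ev` turns products of `C` into reversed convolutions on `B`, the sum at `c ⊗ b` is `ev(±
S⁻¹(c₂) c₁, b)`, and the first argument collapses to `ε(c) 1`. The sign exchanging `c₂` with `b₁` is
the one exchanging `c₂` with `c₁`, because `ev` pairs equal degrees. -/
theorem pairing_mul_pairing_invAntipode {S : C →ₗ[k] C} (hC : IsSuperHopf 𝓒 S)
    (hS : Function.Bijective S) {ev : C →ₗ[k] B →ₗ[k] k} (hev : IsSuperDual 𝓒 𝓑 ev) :
    pairing 𝓒 𝓑 ev * pairing 𝓒 𝓑 (ev ∘ₗ IsSuperHopf.invAntipode S hS) = 1 := by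
  refine STensor.conv_ext fun i j c _ b _ => ?_
  obtain ⟨t⟩ := SuperRepr.nonempty 𝓒 c
  obtain ⟨r⟩ := SuperRepr.nonempty 𝓑 b
  rw [STensor.conv_repr _ _ t r, Finset.sum_comm]
  have h := congrArg (fun x => ev x b) (hC.flipMul_invAntipode_left hS c)
  simp only [Algebra.algebraMap_eq_smul_one, map_smul, LinearMap.smul_apply, hev.one_left,
    t.map_comul, map_sum, LinearMap.sum_apply] at h
  refine Eq.trans (Finset.sum_congr rfl fun u _ => ?_) h
  rw [IsSuperHopf.flipMul_of_mem _ _ (t.fst_mem u) (t.snd_mem u), map_smul, LinearMap.smul_apply,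
    hev.mul_left _ _ b r, Finset.smul_sum]
  refine Finset.sum_congr rfl fun s _ => ?_
  simp only [pairing_of, smul_eq_mul, LinearMap.comp_apply, LinearMap.id_apply]
  rw [← mul_assoc, ← mul_assoc,
    hev.mul_apply (fun x => sgn k (t.deg₂ u * x)) (t.fst_mem u) (r.fst_mem s), mul_comm (t.deg₂ u)]

theorem pairing_invAntipode_mul_pairing {S : C →ₗ[k] C} (hC : IsSuperHopf 𝓒 S)
    (hS : Function.Bijective S) {ev : C →ₗ[k] B →ₗ[k] k} (hev : IsSuperDual 𝓒 𝓑 ev) :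
    pairing 𝓒 𝓑 (ev ∘ₗ IsSuperHopf.invAntipode S hS) * pairing 𝓒 𝓑 ev = 1 := by
  refine STensor.conv_ext fun i j c _ b _ => ?_
  obtain ⟨t⟩ := SuperRepr.nonempty 𝓒 c
  obtain ⟨r⟩ := SuperRepr.nonempty 𝓑 b
  rw [STensor.conv_repr _ _ t r, Finset.sum_comm]
  have h := congrArg (fun x => ev x b) (hC.flipMul_invAntipode_right hS c)
  simp only [Algebra.algebraMap_eq_smul_one, map_smul, LinearMap.smul_apply, hev.one_left,
    t.map_comul, map_sum, LinearMap.sum_apply] at h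
  refine Eq.trans (Finset.sum_congr rfl fun u _ => ?_) h
  rw [IsSuperHopf.flipMul_of_mem _ _ (t.fst_mem u) (t.snd_mem u), map_smul, LinearMap.smul_apply,
    hev.mul_left _ _ b r, Finset.smul_sum]
  refine Finset.sum_congr rfl fun s _ => ?_
  simp only [pairing_of, smul_eq_mul, LinearMap.comp_apply, LinearMap.id_apply]
  rw [← mul_assoc, ← mul_assoc, hev.mul_apply (fun x => sgn k (t.deg₂ u * x))
    (hC.invAntipode_mem hS (t.fst_mem u)) (r.fst_mem s), mul_comm (t.deg₂ u)]

/-- The left-hand side of the cross relation of the super-double. -/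
theorem cross_left (hC : ∀ (i : ZMod 2) (c : C), c ∈ 𝓒 i →
      ∃ r : SuperRepr 𝓒 c, ∀ s, r.deg₁ s + r.deg₂ s = i) (ev : C →ₗ[k] B →ₗ[k] k)
    (u : C →ₗ[k] A) (v : B →ₗ[k] A) {j : ZMod 2} {c : C} (hc : c ∈ 𝓒 j) (t : SuperRepr 𝓒 c)
    {b : B} (r : SuperRepr 𝓑 b) :
    (STensor.inr 𝓒 𝓑 (toConv v) * STensor.inl 𝓒 𝓑 (toConv u) * scal A (pairing 𝓒 𝓑 ev))
      (STensor.of 𝓒 𝓑 (c ⊗ₜ b)) =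
    ∑ s, ∑ x, (-1 : ℤˣ) ^ (r.deg₁ s * j) • ev (t.snd x) (r.snd s) •
      (v (r.fst s) * u (t.fst x)) := by
  -- The given presentation `t` may contain terms whose total degree is not `j`. The sum depends
  -- only on `Δ c`, through the linear map `Q`, so it may be computed with a presentation `t'` whose
  -- terms all have total degree `j`.
  obtain ⟨t', ht'⟩ := hC j c hc
  rw [STensor.conv_repr _ _ t' r]
  refine Finset.sum_congr rfl fun s _ => ?_
  let Q : C ⊗[k] C →ₗ[k] A := sgn k (r.deg₁ s * j) • (LinearMap.mulLeft k (v (r.fst s)) ∘ₗ u ∘ₗ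
    (TensorProduct.rid k C).toLinearMap ∘ₗ LinearMap.lTensor C (ev.flip (r.snd s)))
  have hQ : ∀ x y, Q (x ⊗ₜ y) = sgn k (r.deg₁ s * j) • ev y (r.snd s) • (v (r.fst s) * u x) :=
    fun x y => by simp [Q]
  refine Eq.trans ?_ ((t'.map_comul Q).symm.trans (t.map_comul Q)) |>.trans ?_
  · refine Finset.sum_congr rfl fun x _ => ?_
    rw [STensor.inr_mul_inl _ _ (t'.fst_mem x) (r.fst_mem s), hQ, scal_apply, pairing_of,
      ← Algebra.commutes, ← Algebra.smul_def, ← ht' x, mul_add, sgn_add,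
      mul_comm (t'.deg₁ x), mul_comm (t'.deg₂ x)]
    simp only [smul_smul]
    congr 1
    ring
  · refine Finset.sum_congr rfl fun x _ => ?_
    rw [hQ, unit_smul k]

/-- The right-hand side of the cross relation of the super-double. -/
theorem cross_right {ev : C →ₗ[k] B →ₗ[k] k} (hev : IsSuperDual 𝓒 𝓑 ev)
    (u : C →ₗ[k] A) (v : B →ₗ[k] A) {c : C} (t : SuperRepr 𝓒 c)
    {b : B} (r : SuperRepr 𝓑 b) :
    (scal A (pairing 𝓒 𝓑 ev) * (STensor.inl 𝓒 𝓑 (toConv u) * STensor.inr 𝓒 𝓑 (toConv v)))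
      (STensor.of 𝓒 𝓑 (c ⊗ₜ b)) =
    ∑ s, ∑ x, (-1 : ℤˣ) ^ (t.deg₁ x * t.deg₂ x) • ev (t.fst x) (r.fst s) •
      (u (t.snd x) * v (r.snd s)) := by
  rw [STensor.conv_repr _ _ t r]
  refine Finset.sum_congr rfl fun s _ => Finset.sum_congr rfl fun x _ => ?_
  rw [STensor.inl_mul_inr, scal_apply, pairing_of, ← Algebra.smul_def, unit_smul k, smul_smul,
    smul_smul, hev.mul_apply (fun y => sgn k (t.deg₂ x * y)) (t.fst_mem x) (r.fst_mem s),
    mul_comm (t.deg₂ x)]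

/-- The cross relation for a product of two super-commuting pairs of maps. -/
theorem cross_mul {p q : WithConv (STensor 𝓒 𝓑 →ₗ[k] k)}
    {u₁ u₂ : WithConv (C →ₗ[k] A)} {v₁ v₂ : WithConv (B →ₗ[k] A)}
    (h12 : ∀ i j, ∀ c ∈ 𝓒 i, ∀ b ∈ 𝓑 j, u₁ c * v₂ b = sgn k (i * j) • (v₂ b * u₁ c))
    (h21 : ∀ i j, ∀ c ∈ 𝓒 i, ∀ b ∈ 𝓑 j, u₂ c * v₁ b = sgn k (i * j) • (v₁ b * u₂ c))
    (h1 : STensor.inr 𝓒 𝓑 v₁ * STensor.inl 𝓒 𝓑 u₁ * scal A p =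
      scal A q * (STensor.inl 𝓒 𝓑 u₁ * STensor.inr 𝓒 𝓑 v₁))
    (h2 : STensor.inr 𝓒 𝓑 v₂ * STensor.inl 𝓒 𝓑 u₂ * scal A q =
      scal A p * (STensor.inl 𝓒 𝓑 u₂ * STensor.inr 𝓒 𝓑 v₂)) :
    STensor.inr 𝓒 𝓑 (v₁ * v₂) * STensor.inl 𝓒 𝓑 (u₁ * u₂) * scal A q =
      scal A q * (STensor.inl 𝓒 𝓑 (u₁ * u₂) * STensor.inr 𝓒 𝓑 (v₁ * v₂)) := by
  have c12 := (STensor.inl_commute_inr (𝓜 := 𝓒) (𝓝 := 𝓑) h12).eq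
  have c21 := (STensor.inl_commute_inr (𝓜 := 𝓒) (𝓝 := 𝓑) h21).eq
  simp only [map_mul]
  generalize STensor.inl 𝓒 𝓑 u₁ = U₁ at *
  generalize STensor.inl 𝓒 𝓑 u₂ = U₂ at *
  generalize STensor.inr 𝓒 𝓑 v₁ = V₁ at *
  generalize STensor.inr 𝓒 𝓑 v₂ = V₂ at *
  -- The second pair trades `q` for `p` and the first trades `p` back for `q`. With `p = 1` and `q =
  -- ev` this assembles the Fock representation; with `p = q = ev`, the coproduct.
  calc V₁ * V₂ * (U₁ * U₂) * scal A q = V₁ * (V₂ * U₁) * U₂ * scal A q := by simp only [mul_assoc]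
    _ = V₁ * U₁ * (V₂ * U₂ * scal A q) := by rw [← c12]; simp only [mul_assoc]
    _ = V₁ * U₁ * scal A p * (U₂ * V₂) := by rw [h2]; simp only [mul_assoc]
    _ = scal A q * (U₁ * (V₁ * U₂) * V₂) := by rw [h1]; simp only [mul_assoc]
    _ = _ := by rw [← c21]; simp only [mul_assoc]

end

/-! ### Contraction of a coalgebra with a functional -/

section Contraction

variable {k E : Type*} [Field k] [AddCommGroup E] [Module k E] [Coalgebra k E]

/-- The contraction `x ↦ f(x₁) x₂`. -/
def contractLeft (f : E →ₗ[k] k) : Module.End k E :=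
  (TensorProduct.lid k E).toLinearMap ∘ₗ LinearMap.rTensor E f ∘ₗ Coalgebra.comul

/-- The contraction `x ↦ x₁ f(x₂)`. -/
def contractRight (f : E →ₗ[k] k) : Module.End k E :=
  (TensorProduct.rid k E).toLinearMap ∘ₗ LinearMap.lTensor E f ∘ₗ Coalgebra.comul

theorem comp_contractLeft (f ψ : E →ₗ[k] k) :
    ψ ∘ₗ contractLeft f = (toConv f * toConv ψ).ofConv := by
  have : ψ ∘ₗ (TensorProduct.lid k E).toLinearMap ∘ₗ LinearMap.rTensor E f =
      LinearMap.mul' k k ∘ₗ TensorProduct.map f ψ := by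
    ext a b; simp
  rw [LinearMap.convMul_def, contractLeft]
  simp only [← LinearMap.comp_assoc] at this ⊢
  rw [this]

theorem comp_contractRight (f ψ : E →ₗ[k] k) :
    ψ ∘ₗ contractRight f = (toConv ψ * toConv f).ofConv := by
  have : ψ ∘ₗ (TensorProduct.rid k E).toLinearMap ∘ₗ LinearMap.lTensor E f =
      LinearMap.mul' k k ∘ₗ TensorProduct.map ψ f := by
    ext a b; simp [mul_comm]
  rw [LinearMap.convMul_def, contractRight]
  simp only [← LinearMap.comp_assoc] at this ⊢
  rw [this]

/-- Functionals separate the points of a vector space, so identities between contractions reduce to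
identities between convolution products. -/
theorem end_ext_of_dual {f g : Module.End k E} (h : ∀ ψ : E →ₗ[k] k, ψ ∘ₗ f = ψ ∘ₗ g) :
    f = g := by
  ext x
  rw [← sub_eq_zero, ← Module.forall_dual_apply_eq_zero_iff k]
  intro φ
  rw [map_sub, sub_eq_zero]
  exact LinearMap.congr_fun (h φ) x

/-- Precomposing a functional `ψ` with `contractLeft f` gives `f * ψ`, so this is associativity of
convolution. The last contraction applied stands next to `ψ`, hence the reversed order. -/
theorem contractLeft_mul (f g : WithConv (E →ₗ[k] k)) :
    contractLeft (f * g).ofConv = contractLeft g.ofConv * contractLeft f.ofConv :=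
  end_ext_of_dual fun ψ => by
    rw [Module.End.mul_eq_comp, ← LinearMap.comp_assoc, comp_contractLeft, comp_contractLeft,
      comp_contractLeft, toConv_ofConv, toConv_ofConv, toConv_ofConv, mul_assoc, toConv_ofConv]

theorem contractRight_mul (f g : WithConv (E →ₗ[k] k)) :
    contractRight (f * g).ofConv = contractRight f.ofConv * contractRight g.ofConv :=
  end_ext_of_dual fun ψ => by
    rw [Module.End.mul_eq_comp, ← LinearMap.comp_assoc, comp_contractRight, comp_contractRight,
      comp_contractRight, toConv_ofConv, toConv_ofConv, toConv_ofConv, mul_assoc, toConv_ofConv]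

theorem contractRight_add (f g : E →ₗ[k] k) :
    contractRight (f + g) = contractRight f + contractRight g := by
  simp [contractRight, LinearMap.lTensor_add, LinearMap.add_comp, LinearMap.comp_add]

theorem contractRight_smul (a : k) (f : E →ₗ[k] k) :
    contractRight (a • f) = a • contractRight f := by
  simp [contractRight, LinearMap.lTensor_smul, LinearMap.smul_comp, LinearMap.comp_smul]

theorem contractLeft_counit : contractLeft (Coalgebra.counit (R := k) (A := E)) = 1 := by
  ext x; simp [contractLeft]

theorem contractRight_counit : contractRight (Coalgebra.counit (R := k) (A := E)) = 1 := by
  ext x; simp [contractRight]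

/-- Contraction with a convolution-invertible functional is injective. -/
theorem contractRight_injective {f f' : WithConv (E →ₗ[k] k)} (h : f' * f = 1) :
    Function.Injective (contractRight f.ofConv) := by
  have h1 := contractRight_mul f' f
  rw [h, LinearMap.convOne_def, ofConv_toConv] at h1
  have h2 : Algebra.linearMap k k ∘ₗ Coalgebra.counit (R := k) (A := E) = Coalgebra.counit := rfl
  rw [h2, contractRight_counit] at h1
  exact Function.LeftInverse.injective (g := contractRight f'.ofConv)
    fun x => (LinearMap.congr_fun h1 x).symm

end Contraction

/-! ### The Fock representation of the super-double -/

theorem sum_comm_outer {α β γ X : Type*} [Fintype α] [Fintype β] [Fintype γ] [AddCommMonoid X]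
    (f : α → β → γ → X) : ∑ a, ∑ b, ∑ c, f a b c = ∑ c, ∑ b, ∑ a, f a b c := by
  rw [Finset.sum_comm, Finset.sum_comm (s := (Finset.univ : Finset γ))]
  exact Finset.sum_congr rfl fun b _ => Finset.sum_comm

/-! ### Graded operators on a tensor product -/

section Degree

variable {k : Type*} [Field k] {M N : Type*} [AddCommGroup M] [Module k M] [AddCommGroup N]
  [Module k N] (𝓜 : ZMod 2 → Submodule k M) [DirectSum.Decomposition 𝓜]
  (𝓝 : ZMod 2 → Submodule k N) [DirectSum.Decomposition 𝓝]

/-- Endomorphisms that are homogeneous of degree `i`. -/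
def IsDeg (i : ZMod 2) (f : Module.End k M) : Prop := ∀ l, ∀ x ∈ 𝓜 l, f x ∈ 𝓜 (i + l)

variable (N) in
/-- Operators on the first factor. -/
def opLeft : Module.End k M →ₐ[k] Module.End k (M ⊗[k] N) := Module.End.rTensorAlgHom k M N

@[simp] theorem opLeft_tmul (f : Module.End k M) (x : M) (y : N) :
    opLeft N f (x ⊗ₜ y) = f x ⊗ₜ y := rfl

/-- Operators on the second factor; those of odd degree anticommute with the odd operators on the
first one. -/
def opRight : Module.End k N →ₐ[k] Module.End k (M ⊗[k] N) :=
  AlgHom.ofLinearMap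
    { toFun := fun g => TensorProduct.map (pr 𝓜 0) g +
        TensorProduct.map (pr 𝓜 1) (par 𝓝 ∘ₗ g ∘ₗ par 𝓝)
      map_add' := fun f g => by
        ext x y
        simp [TensorProduct.tmul_add]
        abel
      map_smul' := fun a f => by
        ext x y
        simp }
    (by
      ext x y
      simp [← TensorProduct.add_tmul, pr_add_pr])
    (fun f g => by
      ext x y
      simp [pr_pr])

theorem opRight_tmul (g : Module.End k N) (x : M) (y : N) :
    opRight 𝓜 𝓝 g (x ⊗ₜ y) = pr 𝓜 0 x ⊗ₜ g y + pr 𝓜 1 x ⊗ₜ par 𝓝 (g (par 𝓝 y)) := by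
  simp [opRight]

variable {𝓜 𝓝}

/-- Conjugation by the parity multiplies an operator of degree `j` by `(-1)^j`, so the definition by
projections amounts to the Koszul sign rule. -/
theorem opRight_tmul_of_mem {j l : ZMod 2} {g : Module.End k N} (hg : IsDeg 𝓝 j g) {x : M}
    (hx : x ∈ 𝓜 l) (y : N) : opRight 𝓜 𝓝 g (x ⊗ₜ y) = sgn k (j * l) • (x ⊗ₜ[k] g y) := by
  have h : ∀ y, par 𝓝 (g (par 𝓝 y)) = sgn k j • g y := fun y => by
    have : par 𝓝 ∘ₗ g ∘ₗ par 𝓝 = sgn k j • g := homogeneous_ext 𝓝 fun i x hx => by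
      simp only [LinearMap.comp_apply, LinearMap.smul_apply, par_of_mem hx, map_smul,
        par_of_mem (hg _ _ hx), smul_smul, sgn_add]
      rw [mul_comm (sgn k j), sgn_mul_sgn_mul]
    exact LinearMap.congr_fun this y
  rw [opRight_tmul, h]
  rcases zmod_two_cases l with rfl | rfl
  · simp [pr_of_mem hx, pr_of_mem_ne hx (by decide : (0 : ZMod 2) ≠ 1)]
  · simp [pr_of_mem hx, pr_of_mem_ne hx (by decide : (1 : ZMod 2) ≠ 0)]

theorem opLeft_mul_opRight {i j : ZMod 2} {f : Module.End k M} (hf : IsDeg 𝓜 i f)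
    {g : Module.End k N} (hg : IsDeg 𝓝 j g) :
    opLeft N f * opRight 𝓜 𝓝 g = sgn k (i * j) • (opRight 𝓜 𝓝 g * opLeft N f) := by
  refine TensorProduct.ext (homogeneous_ext 𝓜 fun l x hx => ?_)
  ext y
  simp [opRight_tmul_of_mem hg hx, opRight_tmul_of_mem hg (hf _ _ hx), smul_smul, ← sgn_add]
  congr 2
  -- Comparing two products of signs comes down to an identity between exponents. It may use `2x =
  -- 0` and `x² = x`, so it is checked on all values of `ZMod 2`.
  exact (by decide : ∀ i j l : ZMod 2, j * l = i * j + j * (i + l)) i j l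

end Degree

section

variable {k : Type*} [Field k] {B : Type*} [Ring B] [Algebra k B]
  {𝓑 : ZMod 2 → Submodule k B} [GradedAlgebra 𝓑] {S : B →ₗ[k] B}

theorem par_one : par 𝓑 (1 : B) = 1 := by
  rw [par_of_mem (SetLike.GradedOne.one_mem : (1 : B) ∈ 𝓑 0), sgn_zero, one_smul]

theorem par_mul (a b : B) : par 𝓑 (a * b) = par 𝓑 a * par 𝓑 b := by
  rw [← pr_add_pr 𝓑 a, ← pr_add_pr 𝓑 b]
  simp only [mul_add, add_mul, map_add]
  have h : ∀ i j, par 𝓑 (pr 𝓑 i a * pr 𝓑 j b) = par 𝓑 (pr 𝓑 i a) * par 𝓑 (pr 𝓑 j b) :=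
    fun i j => by
      rw [par_of_mem (SetLike.GradedMul.mul_mem (pr_mem 𝓑 i a) (pr_mem 𝓑 j b)), par_pr, par_pr,
        sgn_add, smul_mul_smul_comm]
  simp only [h]

variable [Coalgebra k B]

theorem IsSuperHopf.comul_mul_repr (h : IsSuperHopf 𝓑 S) {a b : B} (r : SuperRepr 𝓑 a)
    (t : SuperRepr 𝓑 b) {X : Type*} [AddCommGroup X] [Module k X] (f : B ⊗[k] B →ₗ[k] X) :
    f (Coalgebra.comul (R := k) (a * b)) =
      ∑ s, ∑ u, sgn k (r.deg₂ s * t.deg₁ u) •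
        f ((r.fst s * t.fst u) ⊗ₜ (r.snd s * t.snd u)) := by
  have h0 : Coalgebra.comul (R := k) (a * b) = TensorProduct.map (LinearMap.mul' k B)
      (LinearMap.mul' k B) (shuffle (pr 𝓑) (par 𝓑)
        (Coalgebra.comul (R := k) a ⊗ₜ Coalgebra.comul (R := k) b)) := by
    apply (GradedTensorProduct.of k 𝓑 𝓑).injective
    rw [h.comul_mul, graded_mul]
  rw [h0, ← r.eq, ← t.eq]
  simp only [TensorProduct.tmul_sum, TensorProduct.sum_tmul, map_sum]
  rw [Finset.sum_comm]
  refine Finset.sum_congr rfl fun s _ => Finset.sum_congr rfl fun u _ => ?_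
  rw [shuffle_of_mem _ (r.snd_mem s) (t.fst_mem u)]
  simp

end

/-! ### Multiplication and contraction operators on `C`, on `B` and on `C ⊗ B` -/

section Fock

variable {k : Type*} [Field k]
  {C : Type*} [Ring C] [Algebra k C] [Coalgebra k C] {𝓒 : ZMod 2 → Submodule k C}
  [GradedAlgebra 𝓒] [IsSuperCoalgebra 𝓒] {SC : C →ₗ[k] C}
  {B : Type*} [Ring B] [Algebra k B] [Coalgebra k B] {𝓑 : ZMod 2 → Submodule k B}
  [GradedAlgebra 𝓑] [IsSuperCoalgebra 𝓑] {SB : B →ₗ[k] B}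
  {ev : C →ₗ[k] B →ₗ[k] k}

theorem IsSuperDual.conv_left (hev : IsSuperDual 𝓒 𝓑 ev) (c d : C) :
    ev (c * d) = (toConv (ev d) * toConv (ev c)).ofConv := by
  ext b
  obtain ⟨r⟩ := SuperRepr.nonempty 𝓑 b
  rw [hev.mul_left c d b r]
  change _ = LinearMap.mul' k k (TensorProduct.map (ev d) (ev c) (Coalgebra.comul (R := k) b))
  rw [← LinearMap.comp_apply, r.map_comul]
  rfl

theorem IsSuperDual.conv_right (hev : IsSuperDual 𝓒 𝓑 ev) (a b : B) :
    ev.flip (a * b) = (toConv (ev.flip b) * toConv (ev.flip a)).ofConv := by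
  ext c
  obtain ⟨r⟩ := SuperRepr.nonempty 𝓒 c
  rw [LinearMap.flip_apply, hev.mul_right c a b r]
  change _ = LinearMap.mul' k k (TensorProduct.map (ev.flip b) (ev.flip a)
    (Coalgebra.comul (R := k) c))
  rw [← LinearMap.comp_apply, r.map_comul]
  rfl

theorem contractLeft_repr {f : C →ₗ[k] k} {x : C} (t : SuperRepr 𝓒 x) :
    contractLeft f x = ∑ u, f (t.fst u) • t.snd u := by
  change ((TensorProduct.lid k C).toLinearMap ∘ₗ LinearMap.rTensor C f)
    (Coalgebra.comul (R := k) x) = _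
  rw [t.map_comul]; simp

theorem contractRight_repr {f : C →ₗ[k] k} {x : C} (t : SuperRepr 𝓒 x) :
    contractRight f x = ∑ u, f (t.snd u) • t.fst u := by
  change ((TensorProduct.rid k C).toLinearMap ∘ₗ LinearMap.lTensor C f)
    (Coalgebra.comul (R := k) x) = _
  rw [t.map_comul]; simp

variable (𝓒) in
/-- Multiplication by `C` with the super-opposite product, on `C`. -/
def fockMulC : C →ₗ[k] Module.End k C :=
  TensorProduct.curry (IsSuperHopf.flipMul 𝓒 LinearMap.id LinearMap.id)

theorem fockMulC_of_mem {i l : ZMod 2} {c x : C} (hc : c ∈ 𝓒 i) (hx : x ∈ 𝓒 l) :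
    fockMulC 𝓒 c x = sgn k (i * l) • (x * c) :=
  IsSuperHopf.flipMul_of_mem _ _ hc hx

theorem isDeg_fockMulC {i : ZMod 2} {c : C} (hc : c ∈ 𝓒 i) : IsDeg 𝓒 i (fockMulC 𝓒 c) :=
  fun l x hx => by
    rw [fockMulC_of_mem hc hx, add_comm]
    exact Submodule.smul_mem _ _ (SetLike.GradedMul.mul_mem hx hc)

theorem fockMulC_one_right (c : C) : fockMulC 𝓒 c 1 = c := by
  rw [← pr_add_pr 𝓒 c, map_add, LinearMap.add_apply,
    fockMulC_of_mem (pr_mem 𝓒 _ _) SetLike.GradedOne.one_mem,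
    fockMulC_of_mem (pr_mem 𝓒 _ _) SetLike.GradedOne.one_mem]
  simp

theorem isAntiHom_fockMulC : IsAntiHom 𝓒 (fockMulC 𝓒) where
  map_one := homogeneous_ext 𝓒 fun i x hx => by
    rw [fockMulC_of_mem SetLike.GradedOne.one_mem hx]; simp
  map_mul i j a ha b hb := homogeneous_ext 𝓒 fun l x hx => by
    rw [Module.End.mul_apply, fockMulC_of_mem hb hx, map_smul,
      fockMulC_of_mem ha (SetLike.GradedMul.mul_mem hx hb), LinearMap.smul_apply,
      fockMulC_of_mem (SetLike.GradedMul.mul_mem hb ha) hx, smul_smul, smul_smul, ← sgn_add,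
      ← sgn_add, mul_assoc]
    congr 2
    exact (by decide : ∀ i j l : ZMod 2, j * l + i * (l + j) = i * j + (j + i) * l) i j l

/-- The action of `B` on `C` by contraction. -/
def fockContrB (hev : IsSuperDual 𝓒 𝓑 ev) : B →ₐ[k] Module.End k C :=
  AlgHom.ofLinearMap
    -- The extra sign `(-1)^{|b|}` is the one needed in `fock_cross_C`; since `par` is an algebra
    -- map, it does not disturb multiplicativity.
    { toFun := fun b => contractLeft (ev.flip (par 𝓑 b))
      map_add' := fun a b => by
        ext x; obtain ⟨t⟩ := SuperRepr.nonempty 𝓒 x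
        simp [contractLeft_repr t, add_smul, Finset.sum_add_distrib]
      map_smul' := fun a b => by
        ext x; obtain ⟨t⟩ := SuperRepr.nonempty 𝓒 x
        simp [contractLeft_repr t, mul_smul, Finset.smul_sum] }
    (by
      change contractLeft (ev.flip (par 𝓑 1)) = 1
      rw [par_one, ← contractLeft_counit]
      congr 1
      ext c; exact hev.one_right c)
    -- Both `ev.flip` and `contractLeft` reverse products, and the two reversals cancel.
    (fun a b => by
      change contractLeft (ev.flip (par 𝓑 (a * b))) = _
      rw [par_mul, hev.conv_right, contractLeft_mul]; rfl)

theorem fockContrB_repr (hev : IsSuperDual 𝓒 𝓑 ev) {j : ZMod 2} {b : B} (hb : b ∈ 𝓑 j) {x : C}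
    (t : SuperRepr 𝓒 x) :
    fockContrB hev b x = ∑ u, (sgn k j * ev (t.fst u) b) • t.snd u := by
  change contractLeft (ev.flip (par 𝓑 b)) x = _
  rw [contractLeft_repr t, par_of_mem hb]
  simp

/-- Only the terms with `|x₁| = |b|` survive, and for these `|x₂| = |b| + |x|` modulo 2. -/
theorem isDeg_fockContrB (hC : IsSuperHopf 𝓒 SC) (hev : IsSuperDual 𝓒 𝓑 ev) {j : ZMod 2} {b : B}
    (hb : b ∈ 𝓑 j) : IsDeg 𝓒 j (fockContrB hev b) := fun l x hx => by
  obtain ⟨t, ht⟩ := hC.comul_graded l x hx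
  rw [fockContrB_repr hev hb t]
  refine Submodule.sum_mem _ fun u _ => ?_
  by_cases h : t.deg₁ u = j
  · refine Submodule.smul_mem _ _ ?_
    have : j + l = t.deg₂ u := by
      rw [← ht u, h, ← add_assoc, CharTwo.add_self_eq_zero, zero_add]
    rw [this]; exact t.snd_mem u
  · rw [hev.apply_eq_zero (t.fst_mem u) hb h, mul_zero, zero_smul]
    exact Submodule.zero_mem _

theorem fockContrB_one_right (hC : IsSuperHopf 𝓒 SC) (hev : IsSuperDual 𝓒 𝓑 ev) (b : B) :
    fockContrB hev b 1 = Coalgebra.counit (R := k) b • (1 : C) := by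
  change contractLeft (ev.flip (par 𝓑 b)) 1 = _
  simp [contractLeft, hC.comul_one, hev.one_left]

/-- This is the Leibniz rule for contracting a product `x c`: `Δ` is multiplicative and `ev(x₁ c₁,
b) = ev(c₁, b₁) ev(x₁, b₂)`. Only one of the two pairings of the cross relation appears, the other
being replaced by `1`. -/
theorem fock_cross_C (hC : IsSuperHopf 𝓒 SC) (hB : IsSuperHopf 𝓑 SB)
    (hev : IsSuperDual 𝓒 𝓑 ev) :
    STensor.inr 𝓒 𝓑 (toConv (fockContrB hev).toLinearMap) *
      STensor.inl 𝓒 𝓑 (toConv (fockMulC 𝓒)) * scal (Module.End k C) 1 =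
    scal (Module.End k C) (pairing 𝓒 𝓑 ev) * (STensor.inl 𝓒 𝓑 (toConv (fockMulC 𝓒)) *
      STensor.inr 𝓒 𝓑 (toConv (fockContrB hev).toLinearMap)) := by
  refine STensor.conv_ext fun i j c hc b hb => ?_
  obtain ⟨t, ht⟩ := hC.comul_graded i c hc
  obtain ⟨r, hr⟩ := hB.comul_graded j b hb
  rw [map_one, mul_one, STensor.inr_mul_inl _ _ hc hb, cross_right hev _ _ t r]
  refine homogeneous_ext 𝓒 fun l x hx => ?_
  obtain ⟨w, hw⟩ := hC.comul_graded l x hx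
  have hL : fockContrB hev b (x * c) = ∑ p, ∑ u, (sgn k (w.deg₂ p * t.deg₁ u) * (sgn k j *
      ∑ s, ev (t.fst u) (r.fst s) * ev (w.fst p) (r.snd s))) • (w.snd p * t.snd u) := by
    change ((TensorProduct.lid k C).toLinearMap ∘ₗ LinearMap.rTensor C (ev.flip (par 𝓑 b)))
      (Coalgebra.comul (R := k) (x * c)) = _
    rw [hC.comul_mul_repr w t]
    refine Finset.sum_congr rfl fun p _ => Finset.sum_congr rfl fun u _ => ?_
    simp [par_of_mem hb, hev.mul_left _ _ b r, smul_smul]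
  change sgn k (i * j) • fockContrB hev b (fockMulC 𝓒 c x) = _
  rw [fockMulC_of_mem hc hx, map_smul, hL]
  simp only [LinearMap.sum_apply, LinearMap.smul_apply, Module.End.mul_apply,
    AlgHom.toLinearMap_apply, fockContrB_repr hev (r.snd_mem _) w, map_sum, map_smul,
    fockMulC_of_mem (t.snd_mem _) (w.snd_mem _), Finset.smul_sum, Finset.mul_sum, Finset.sum_smul,
    unit_smul k, smul_smul]
  rw [sum_comm_outer]
  refine Finset.sum_congr rfl fun s _ => Finset.sum_congr rfl fun u _ =>
    Finset.sum_congr rfl fun p _ => ?_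
  congr 1
  -- Terms whose paired degrees differ vanish on both sides; for the others, the equalities of
  -- degrees make the signs match.
  by_cases h1 : t.deg₁ u = r.deg₁ s
  · by_cases h2 : w.deg₁ p = r.deg₂ s
    · rw [mul_assoc (sgn k (r.deg₂ s)), mul_comm (ev (w.fst p) _) (sgn k _)]
      simp only [← mul_assoc]
      rw [mul_right_comm _ (ev (t.fst u) (r.fst s)) (sgn k (r.deg₂ s)),
        mul_right_comm _ (ev (t.fst u) (r.fst s)) (sgn k _)]
      simp only [← sgn_add]
      congr 3
      rw [← ht u, ← hr s, ← hw p, h1, h2]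
      exact (by decide : ∀ a b c d : ZMod 2, (a + b) * (a + c) + (a + b) * (c + d) + d * a +
        (a + c) = a * b + c + b * d) _ _ _ _
    · simp [hev.apply_eq_zero (w.fst_mem p) (r.snd_mem s) h2]
  · simp [hev.apply_eq_zero (t.fst_mem u) (r.fst_mem s) h1]

/-- The action of `C` on `B` by contraction. -/
def fockContrC (𝓒 : ZMod 2 → Submodule k C) [GradedAlgebra 𝓒]
    (𝓑 : ZMod 2 → Submodule k B) [GradedAlgebra 𝓑] (ev : C →ₗ[k] B →ₗ[k] k) :
    C →ₗ[k] Module.End k B where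
  -- For odd `c` the parity acts after the contraction, which produces the sign `(-1)^{|c||y₁|}`
  -- without a choice of presentation of `y`.
  toFun c := contractRight (ev (pr 𝓒 0 c)) + par 𝓑 ∘ₗ contractRight (ev (pr 𝓒 1 c))
  map_add' c d := by
    simp only [map_add, contractRight_add, LinearMap.comp_add]
    abel
  map_smul' a c := by
    simp only [map_smul, contractRight_smul, LinearMap.comp_smul, smul_add, RingHom.id_apply]

theorem fockContrC_repr {i : ZMod 2} {c : C} (hc : c ∈ 𝓒 i) {y : B} (w : SuperRepr 𝓑 y) :
    fockContrC 𝓒 𝓑 ev c y = ∑ p, (sgn k (i * w.deg₁ p) * ev c (w.snd p)) • w.fst p := by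
  change contractRight (ev (pr 𝓒 0 c)) y + par 𝓑 (contractRight (ev (pr 𝓒 1 c)) y) = _
  rcases zmod_two_cases i with rfl | rfl
  · simp [pr_of_mem hc, pr_of_mem_ne hc (by decide : (0 : ZMod 2) ≠ 1), contractRight_repr w]
  · simp [pr_of_mem hc, pr_of_mem_ne hc (by decide : (1 : ZMod 2) ≠ 0), contractRight_repr w,
      par_of_mem (w.fst_mem _), smul_smul, mul_comm]

theorem isDeg_contractRight (hB : IsSuperHopf 𝓑 SB) (hev : IsSuperDual 𝓒 𝓑 ev) {i : ZMod 2}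
    {c : C} (hc : c ∈ 𝓒 i) : IsDeg 𝓑 i (contractRight (ev c)) := fun l y hy => by
  obtain ⟨w, hw⟩ := hB.comul_graded l y hy
  rw [contractRight_repr w]
  refine Submodule.sum_mem _ fun p _ => ?_
  by_cases h : i = w.deg₂ p
  · refine Submodule.smul_mem _ _ ?_
    have : i + l = w.deg₁ p := by
      rw [← hw p, ← h, add_comm (w.deg₁ p), ← add_assoc, CharTwo.add_self_eq_zero, zero_add]
    rw [this]; exact w.fst_mem p
  · rw [hev.apply_eq_zero hc (w.snd_mem p) h, zero_smul]
    exact Submodule.zero_mem _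

theorem fockContrC_of_mem (hB : IsSuperHopf 𝓑 SB) (hev : IsSuperDual 𝓒 𝓑 ev) {i l : ZMod 2}
    {c : C} (hc : c ∈ 𝓒 i) {y : B} (hy : y ∈ 𝓑 l) :
    fockContrC 𝓒 𝓑 ev c y = sgn k (i * (i + l)) • contractRight (ev c) y := by
  change contractRight (ev (pr 𝓒 0 c)) y + par 𝓑 (contractRight (ev (pr 𝓒 1 c)) y) = _
  have hd := isDeg_contractRight hB hev hc l y hy
  rcases zmod_two_cases i with rfl | rfl
  · simp [pr_of_mem hc, pr_of_mem_ne hc (by decide : (0 : ZMod 2) ≠ 1), contractRight]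
  · simp [pr_of_mem hc, pr_of_mem_ne hc (by decide : (1 : ZMod 2) ≠ 0), par_of_mem hd]
    simp [contractRight]

theorem isDeg_fockContrC (hB : IsSuperHopf 𝓑 SB) (hev : IsSuperDual 𝓒 𝓑 ev) {i : ZMod 2} {c : C}
    (hc : c ∈ 𝓒 i) : IsDeg 𝓑 i (fockContrC 𝓒 𝓑 ev c) := fun l y hy => by
  rw [fockContrC_of_mem hB hev hc hy]
  exact Submodule.smul_mem _ _ (isDeg_contractRight hB hev hc l y hy)

/-- The pairing reverses products of `C` and `contractRight` keeps their order, so the order is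
reversed once; the parity attached to odd contractions supplies the super-sign. -/
theorem isAntiHom_fockContrC (hB : IsSuperHopf 𝓑 SB)
    (hev : IsSuperDual 𝓒 𝓑 ev) : IsAntiHom 𝓒 (fockContrC 𝓒 𝓑 ev) where
  map_one := homogeneous_ext 𝓑 fun i y hy => by
    rw [fockContrC_of_mem hB hev SetLike.GradedOne.one_mem hy]
    have : ev 1 = Coalgebra.counit := by ext b; exact hev.one_left b
    simp [this, contractRight_counit]
  map_mul i j a ha b hb := homogeneous_ext 𝓑 fun l y hy => by
    rw [Module.End.mul_apply, fockContrC_of_mem hB hev hb hy, map_smul,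
      fockContrC_of_mem hB hev ha (isDeg_contractRight hB hev hb l y hy), LinearMap.smul_apply,
      fockContrC_of_mem hB hev (SetLike.GradedMul.mul_mem hb ha) hy, hev.conv_left,
      contractRight_mul, Module.End.mul_apply, smul_smul, smul_smul, ← sgn_add, ← sgn_add]
    congr 2
    exact (by decide : ∀ i j l : ZMod 2, j * (j + l) + i * (i + (j + l)) =
      i * j + (j + i) * (j + i + l)) i j l

/-- The complementary half: the Leibniz rule for contracting `b y`, by `ev(c, b₂ y₂) = ev(c₁, y₂)
ev(c₂, b₂)`. Here the pairing stands on the left and `1` on the right. -/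
theorem fock_cross_B (hC : IsSuperHopf 𝓒 SC) (hB : IsSuperHopf 𝓑 SB)
    (hev : IsSuperDual 𝓒 𝓑 ev) :
    STensor.inr 𝓒 𝓑 (toConv (Algebra.lmul k B).toLinearMap) *
      STensor.inl 𝓒 𝓑 (toConv (fockContrC 𝓒 𝓑 ev)) *
        scal (Module.End k B) (pairing 𝓒 𝓑 ev) =
    scal (Module.End k B) 1 * (STensor.inl 𝓒 𝓑 (toConv (fockContrC 𝓒 𝓑 ev)) *
      STensor.inr 𝓒 𝓑 (toConv (Algebra.lmul k B).toLinearMap)) := by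
  refine STensor.conv_ext fun i j c hc b hb => ?_
  obtain ⟨t, ht⟩ := hC.comul_graded i c hc
  obtain ⟨r⟩ := SuperRepr.nonempty 𝓑 b
  rw [map_one, one_mul, STensor.inl_mul_inr, cross_left hC.comul_graded _ _ _ hc t r]
  refine LinearMap.ext fun y => ?_
  obtain ⟨w⟩ := SuperRepr.nonempty 𝓑 y
  have hR : fockContrC 𝓒 𝓑 ev c (b * y) = ∑ s, ∑ p, (sgn k (r.deg₂ s * w.deg₁ p) *
      (sgn k (i * (r.deg₁ s + w.deg₁ p)) *
        ∑ u, ev (t.fst u) (w.snd p) * ev (t.snd u) (r.snd s))) • (r.fst s * w.fst p) := by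
    have h0 : fockContrC 𝓒 𝓑 ev c (b * y) = (if i = 0 then LinearMap.id else par 𝓑)
        (((TensorProduct.rid k B).toLinearMap ∘ₗ LinearMap.lTensor B (ev c))
          (Coalgebra.comul (R := k) (b * y))) := by
      change contractRight (ev (pr 𝓒 0 c)) _ + par 𝓑 (contractRight (ev (pr 𝓒 1 c)) _) = _
      rcases zmod_two_cases i with rfl | rfl
      · simp [pr_of_mem hc, pr_of_mem_ne hc (by decide : (0 : ZMod 2) ≠ 1), contractRight]
      · simp [pr_of_mem hc, pr_of_mem_ne hc (by decide : (1 : ZMod 2) ≠ 0), contractRight]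
    rw [h0, hB.comul_mul_repr r w]
    simp only [map_sum, map_smul]
    refine Finset.sum_congr rfl fun s _ => Finset.sum_congr rfl fun p _ => ?_
    rw [mul_smul]
    congr 1
    rw [← hev.mul_right c _ _ t]
    rcases zmod_two_cases i with rfl | rfl
    · simp
    · simp [par_of_mem (SetLike.GradedMul.mul_mem (r.fst_mem s) (w.fst_mem p)), smul_smul, mul_comm]
  change _ = fockContrC 𝓒 𝓑 ev c (b * y)
  rw [hR]
  have hm : ∀ a b : B, Algebra.lmul k B a b = a * b := fun _ _ => rfl
  simp only [LinearMap.sum_apply, LinearMap.smul_apply, Module.End.mul_apply,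
    AlgHom.toLinearMap_apply, hm, fockContrC_repr (t.fst_mem _) w, Finset.mul_sum,
    Finset.sum_smul, unit_smul k, smul_smul, Finset.smul_sum, mul_smul_comm]
  refine Finset.sum_congr rfl fun s _ => ?_
  rw [Finset.sum_comm]
  refine Finset.sum_congr rfl fun u _ => Finset.sum_congr rfl fun p _ => ?_
  congr 1
  by_cases h1 : t.deg₂ p = r.deg₂ s
  · have key : sgn k (r.deg₁ s * i) * sgn k (t.deg₁ p * w.deg₁ u) =
        sgn k (r.deg₂ s * w.deg₁ u) * sgn k (i * (r.deg₁ s + w.deg₁ u)) := by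
      rw [← sgn_add, ← sgn_add, ← ht p, ← h1]
      congr 1
      exact (by decide : ∀ a b c d : ZMod 2, a * (b + c) + b * d = c * d + (b + c) * (a + d)) _ _ _ _
    linear_combination (ev (t.fst p) (w.snd u) * ev (t.snd p) (r.snd s)) * key
  · simp [hev.apply_eq_zero (t.snd_mem p) (r.snd_mem s) h1]

/-- The action of `C` on the Fock space `C ⊗ B`. -/
def fockC (ev : C →ₗ[k] B →ₗ[k] k) (𝓒 : ZMod 2 → Submodule k C) [GradedAlgebra 𝓒]
    (𝓑 : ZMod 2 → Submodule k B) [GradedAlgebra 𝓑] : C →ₗ[k] Module.End k (C ⊗[k] B) :=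
  (toConv ((opLeft B).toLinearMap ∘ₗ fockMulC 𝓒) *
    toConv ((opRight 𝓒 𝓑).toLinearMap ∘ₗ fockContrC 𝓒 𝓑 ev)).ofConv

theorem isAntiHom_fockC (hC : IsSuperHopf 𝓒 SC) (hB : IsSuperHopf 𝓑 SB)
    (hev : IsSuperDual 𝓒 𝓑 ev) : IsAntiHom 𝓒 (fockC ev 𝓒 𝓑) :=
  IsAntiHom.mul hC (isAntiHom_fockMulC.comp _) ((isAntiHom_fockContrC hB hev).comp _)
    fun _ _ _ ha _ hb => opLeft_mul_opRight (isDeg_fockMulC ha) (isDeg_fockContrC hB hev hb)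

theorem isDeg_lmul {i : ZMod 2} {b : B} (hb : b ∈ 𝓑 i) : IsDeg 𝓑 i (Algebra.lmul k B b) :=
  fun _ _ hy => SetLike.GradedMul.mul_mem hb hy

theorem opRight_mul_opLeft {M N : Type*} [AddCommGroup M] [Module k M] [AddCommGroup N]
    [Module k N] {𝓜 : ZMod 2 → Submodule k M} [DirectSum.Decomposition 𝓜]
    {𝓝 : ZMod 2 → Submodule k N} [DirectSum.Decomposition 𝓝]
    {i j : ZMod 2} {f : Module.End k M} (hf : IsDeg 𝓜 i f)
    {g : Module.End k N} (hg : IsDeg 𝓝 j g) :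
    opRight 𝓜 𝓝 g * opLeft N f = sgn k (j * i) • (opLeft N f * opRight 𝓜 𝓝 g) := by
  rw [opLeft_mul_opRight hf hg, smul_smul, mul_comm j i, sgn_mul_self, one_smul]

/-- The action of `B` on the Fock space `C ⊗ B`. -/
def fockB (hC : IsSuperHopf 𝓒 SC) (hB : IsSuperHopf 𝓑 SB) (hev : IsSuperDual 𝓒 𝓑 ev) :
    B →ₐ[k] Module.End k (C ⊗[k] B) :=
  convAlgHom hB ((opLeft B).comp (fockContrB hev)) ((opRight 𝓒 𝓑).comp (Algebra.lmul k B))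
    fun _ _ _ ha _ hb => opRight_mul_opLeft (isDeg_fockContrB hC hev hb) (isDeg_lmul ha)

/-- `fock_cross_C` trades `1` for `ev` and `fock_cross_B` trades `ev` for `1`; the mixed pairs of
operators act on different tensor factors and super-commute. -/
theorem fock_cross (hC : IsSuperHopf 𝓒 SC) (hB : IsSuperHopf 𝓑 SB)
    (hev : IsSuperDual 𝓒 𝓑 ev) :
    STensor.inr 𝓒 𝓑 (toConv (fockB hC hB hev).toLinearMap) *
      STensor.inl 𝓒 𝓑 (toConv (fockC ev 𝓒 𝓑)) * scal _ (pairing 𝓒 𝓑 ev) =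
    scal _ (pairing 𝓒 𝓑 ev) * (STensor.inl 𝓒 𝓑 (toConv (fockC ev 𝓒 𝓑)) *
      STensor.inr 𝓒 𝓑 (toConv (fockB hC hB hev).toLinearMap)) := by
  refine cross_mul (p := 1) ?_ ?_ ?_ ?_
  · exact fun _ _ _ hc _ hb => opLeft_mul_opRight (isDeg_fockMulC hc) (isDeg_lmul hb)
  · exact fun _ _ _ hc _ hb => opRight_mul_opLeft (isDeg_fockContrB hC hev hb)
      (isDeg_fockContrC hB hev hc)
  · have h := congrArg (convPush (STensor 𝓒 𝓑) (opLeft (k := k) (M := C) B))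
      (fock_cross_C hC hB hev)
    simp only [map_mul, convPush_scal] at h
    exact h
  · have h := congrArg (convPush (STensor 𝓒 𝓑) (opRight 𝓒 𝓑)) (fock_cross_B hC hB hev)
    simp only [map_mul, convPush_scal] at h
    exact h

theorem STensor.comul_repr {c : C} (t : SuperRepr 𝓒 c) {b : B} (r : SuperRepr 𝓑 b) :
    Coalgebra.comul (R := k) (STensor.of 𝓒 𝓑 (c ⊗ₜ b)) =
      ∑ s, ∑ u, sgn k (t.deg₂ u * r.deg₁ s) • (STensor.of 𝓒 𝓑 (t.fst u ⊗ₜ r.fst s) ⊗ₜ[k]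
        STensor.of 𝓒 𝓑 (t.snd u ⊗ₜ r.snd s)) := by
  rw [STensor.comul_of, ← t.eq, ← r.eq]
  simp only [TensorProduct.tmul_sum, TensorProduct.sum_tmul, map_sum]
  refine Finset.sum_congr rfl fun s _ => Finset.sum_congr rfl fun u _ => ?_
  rw [shuffle_of_mem _ (t.snd_mem u) (r.fst_mem s)]
  simp

theorem counit_mul_sgn {i j : ZMod 2} {b : B} (hb : b ∈ 𝓑 j) :
    sgn k (i * j) * Coalgebra.counit (R := k) b = Coalgebra.counit (R := k) b := by
  rcases zmod_two_cases j with rfl | rfl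
  · simp
  · rw [counit_of_mem_one 𝓑 hb, mul_zero]

/-- The action of `D(B)` on the vacuum is the contraction with the pairing. -/
theorem fock_vacuum (hC : IsSuperHopf 𝓒 SC) (hB : IsSuperHopf 𝓑 SB)
    (hev : IsSuperDual 𝓒 𝓑 ev) (c : C) (b : B) :
    STensor.of 𝓒 𝓑 ((fockC ev 𝓒 𝓑 c * fockB hC hB hev b) (1 ⊗ₜ 1)) =
      contractRight (pairing 𝓒 𝓑 ev).ofConv (STensor.of 𝓒 𝓑 (c ⊗ₜ b)) := by
  obtain ⟨t⟩ := SuperRepr.nonempty 𝓒 c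
  obtain ⟨r⟩ := SuperRepr.nonempty 𝓑 b
  have h1 := STensor.inl_mul_inr 𝓒 𝓑 (toConv (fockC ev 𝓒 𝓑))
    (toConv (fockB hC hB hev).toLinearMap) c b
  -- Exchanging the two contractions gathers the operators on the first factor `C` to the left of
  -- those on the second factor `B`.
  have h2 : STensor.inl 𝓒 𝓑 (toConv (fockC ev 𝓒 𝓑)) *
      STensor.inr 𝓒 𝓑 (toConv (fockB hC hB hev).toLinearMap) =
      (STensor.inl 𝓒 𝓑 (toConv ((opLeft B).toLinearMap ∘ₗ fockMulC 𝓒)) *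
        STensor.inr 𝓒 𝓑 (toConv ((opLeft B).comp (fockContrB hev)).toLinearMap)) *
      (STensor.inl 𝓒 𝓑 (toConv ((opRight 𝓒 𝓑).toLinearMap ∘ₗ fockContrC 𝓒 𝓑 ev)) *
        STensor.inr 𝓒 𝓑 (toConv ((opRight 𝓒 𝓑).comp (Algebra.lmul k B)).toLinearMap)) := by
    have hc := STensor.inl_commute_inr (𝓜 := 𝓒) (𝓝 := 𝓑)
      (f := toConv ((opRight 𝓒 𝓑).toLinearMap ∘ₗ fockContrC 𝓒 𝓑 ev))
      (g := toConv ((opLeft B).comp (fockContrB hev)).toLinearMap)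
      (fun _ _ _ hc _ hb => opRight_mul_opLeft (isDeg_fockContrB hC hev hb)
        (isDeg_fockContrC hB hev hc))
    have hH : toConv (fockB hC hB hev).toLinearMap =
        toConv ((opLeft B).comp (fockContrB hev)).toLinearMap *
          toConv ((opRight 𝓒 𝓑).comp (Algebra.lmul k B)).toLinearMap := rfl
    rw [hH, fockC, toConv_ofConv, map_mul, map_mul]
    simp only [mul_assoc]
    rw [← mul_assoc (STensor.inl 𝓒 𝓑 (toConv ((opRight 𝓒 𝓑).toLinearMap ∘ₗ fockContrC 𝓒 𝓑 ev))),
      hc.eq]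
    simp only [mul_assoc]
  have hb : ∑ s, Coalgebra.counit (R := k) (r.fst s) • r.snd s = b := by
    have := r.map_comul ((TensorProduct.lid k B).toLinearMap ∘ₗ
      LinearMap.rTensor B Coalgebra.counit)
    simpa using this.symm
  -- On the vacuum, `b₁` contracts `1` to `ε(b₁)` and `c₁` multiplies it to `c₁`, while on the other
  -- factor `b₂` creates `b₂`, which `c₂` contracts. The factor `ε(b₁)` removes the sign and
  -- restores `b`.
  have hL : (fockC ev 𝓒 𝓑 c * fockB hC hB hev b) (1 ⊗ₜ 1) =
      ∑ u, t.fst u ⊗ₜ[k] fockContrC 𝓒 𝓑 ev (t.snd u) b := by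
    refine (LinearMap.congr_fun (h1.symm.trans (by rw [h2])) ((1 : C) ⊗ₜ[k] (1 : B))).trans ?_
    rw [STensor.conv_repr _ _ t r, Finset.sum_comm, LinearMap.sum_apply]
    refine Finset.sum_congr rfl fun u _ => ?_
    conv_rhs => rw [← hb, map_sum, TensorProduct.tmul_sum]
    rw [LinearMap.sum_apply]
    refine Finset.sum_congr rfl fun s _ => ?_
    rw [STensor.inl_mul_inr, STensor.inl_mul_inr]
    change sgn k _ • opLeft B (fockMulC 𝓒 (t.fst u)) (opLeft B (fockContrB hev (r.fst s))
      (opRight 𝓒 𝓑 (fockContrC 𝓒 𝓑 ev (t.snd u)) (opRight 𝓒 𝓑 (Algebra.lmul k B (r.snd s))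
        (1 ⊗ₜ 1)))) = _
    have h0 : ∀ (g : Module.End k B) (y : B), opRight 𝓒 𝓑 g (1 ⊗ₜ y) = 1 ⊗ₜ g y := fun g y => by
      rw [opRight_tmul, pr_of_mem (SetLike.GradedOne.one_mem : (1 : C) ∈ 𝓒 0),
        pr_of_mem_ne (SetLike.GradedOne.one_mem : (1 : C) ∈ 𝓒 0) (by decide),
        TensorProduct.zero_tmul, add_zero]
    have hm : Algebra.lmul k B (r.snd s) 1 = r.snd s := mul_one (r.snd s)
    rw [h0, h0, hm, opLeft_tmul, opLeft_tmul, fockContrB_one_right hC hev, map_smul,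
      fockMulC_one_right, map_smul, TensorProduct.tmul_smul, ← TensorProduct.smul_tmul', smul_smul,
      counit_mul_sgn (r.fst_mem s)]
  rw [hL]
  change _ = ((TensorProduct.rid k _).toLinearMap ∘ₗ
    LinearMap.lTensor _ (pairing 𝓒 𝓑 ev).ofConv) (Coalgebra.comul (R := k) _)
  rw [STensor.comul_repr t r, Finset.sum_comm]
  simp only [map_sum, map_smul]
  refine Finset.sum_congr rfl fun u _ => ?_
  rw [fockContrC_repr (t.snd_mem u) r, TensorProduct.tmul_sum, map_sum]
  refine Finset.sum_congr rfl fun s _ => ?_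
  rw [LinearMap.comp_apply, LinearMap.lTensor_tmul, pairing_of, LinearEquiv.coe_coe,
    TensorProduct.rid_tmul, smul_smul, TensorProduct.tmul_smul, map_smul]

end Fock

/-! ### The algebra of the super-double -/

section

variable {k : Type*} [Field k] {B : Type*} [Ring B] [Algebra k B]
  (𝓑 : ZMod 2 → Submodule k B) [GradedAlgebra 𝓑]

/-- The parity involution of a superalgebra. -/
def parHom : B →ₐ[k] B := AlgHom.ofLinearMap (par 𝓑) par_one par_mul

variable {𝓑} in
theorem IsAntiHom.comp_par {A : Type*} [Ring A] [Algebra k A] {f : B →ₗ[k] A}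
    (hf : IsAntiHom 𝓑 f) : IsAntiHom 𝓑 (f ∘ₗ par 𝓑) where
  map_one := by simp [par_one, hf.map_one]
  map_mul i j a ha b hb := by
    simp only [LinearMap.comp_apply, par_of_mem ha, par_of_mem hb, par_mul, map_smul,
      smul_mul_smul_comm, hf.map_mul i j a ha b hb]
    rw [smul_comm, mul_comm (sgn k j) (sgn k i)]

end

section

variable {k : Type*} [Field k]
  {M : Type*} [AddCommGroup M] [Module k M] [Coalgebra k M]
  (𝓜 : ZMod 2 → Submodule k M) [DirectSum.Decomposition 𝓜] [IsSuperCoalgebra 𝓜]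
  {N : Type*} [AddCommGroup N] [Module k N] [Coalgebra k N]
  (𝓝 : ZMod 2 → Submodule k N) [DirectSum.Decomposition 𝓝] [IsSuperCoalgebra 𝓝]

/-- The parity involution of a super tensor product. -/
def STensor.parCoalgHom : STensor 𝓜 𝓝 →ₗc[k] STensor 𝓜 𝓝 where
  toLinearMap := (STensor.of 𝓜 𝓝).toLinearMap ∘ₗ TensorProduct.map (par 𝓜) (par 𝓝) ∘ₗ
    (STensor.of 𝓜 𝓝).symm.toLinearMap
  counit_comp := STensor.hom_ext fun m n => by simp
  map_comp_comul := STensor.hom_ext fun m n => by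
    have h : TensorProduct.map (TensorProduct.map (par 𝓜) (par 𝓝))
        (TensorProduct.map (par 𝓜) (par 𝓝)) ∘ₗ shuffle (pr 𝓜) (par 𝓝) =
        shuffle (pr 𝓜) (par 𝓝) ∘ₗ TensorProduct.map (TensorProduct.map (par 𝓜) (par 𝓜))
          (TensorProduct.map (par 𝓝) (par 𝓝)) := by
      have hp : ∀ i y, par 𝓜 (pr 𝓜 i y) = pr 𝓜 i (par 𝓜 y) := fun i y => by
        rcases zmod_two_cases i with rfl | rfl <;> simp [par, pr_pr]
      ext x y u v
      simp [hp]
    have h' := LinearMap.congr_fun h (Coalgebra.comul (R := k) m ⊗ₜ Coalgebra.comul (R := k) n)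
    simp only [LinearMap.comp_apply, TensorProduct.map_tmul, ← comul_par] at h'
    simp only [LinearMap.comp_apply, LinearEquiv.coe_coe, LinearEquiv.symm_apply_apply,
      TensorProduct.map_tmul]
    rw [STensor.comul_of, STensor.comul_of, ← h', ← LinearMap.comp_apply, ← TensorProduct.map_comp,
      ← LinearMap.comp_apply (TensorProduct.map (STensor.of 𝓜 𝓝).toLinearMap _),
      ← TensorProduct.map_comp]
    rfl

end

namespace Double

section Algebra

variable {k : Type*} [Field k]
  {C : Type*} [Ring C] [Algebra k C] [Coalgebra k C] {𝓒 : ZMod 2 → Submodule k C}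
  [GradedAlgebra 𝓒] [IsSuperCoalgebra 𝓒] {SC : C →ₗ[k] C}
  {B : Type*} [Ring B] [Algebra k B] [Coalgebra k B] {𝓑 : ZMod 2 → Submodule k B}
  [GradedAlgebra 𝓑] [IsSuperCoalgebra 𝓑] {SB : B →ₗ[k] B}
  {ev : C →ₗ[k] B →ₗ[k] k} {A : Type*} [Ring A] [Algebra k A]

variable (𝓒 𝓑 ev) in
/-- The projection from the free algebra. -/
def mk : TensorAlgebra k (C × B) →ₐ[k] Double 𝓒 𝓑 ev := RingQuot.mkAlgHom k (DoubleRel 𝓒 𝓑 ev)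

variable (𝓒 𝓑 ev) in
theorem mk_surjective : Function.Surjective (mk 𝓒 𝓑 ev) :=
  RingQuot.mkAlgHom_surjective k (DoubleRel 𝓒 𝓑 ev)

variable (ev) in
/-- The cross relation, in the convolution algebra. -/
def Cross (u : C →ₗ[k] A) (v : B →ₐ[k] A) : Prop :=
  STensor.inr 𝓒 𝓑 (toConv v.toLinearMap) * STensor.inl 𝓒 𝓑 (toConv u) *
      scal A (pairing 𝓒 𝓑 ev) =
    scal A (pairing 𝓒 𝓑 ev) * (STensor.inl 𝓒 𝓑 (toConv u) *
      STensor.inr 𝓒 𝓑 (toConv v.toLinearMap))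

/-- The universal property of the super-double. -/
def lift (hC : IsSuperHopf 𝓒 SC) (hev : IsSuperDual 𝓒 𝓑 ev) (u : C →ₗ[k] A) (v : B →ₐ[k] A)
    (hu : IsAntiHom 𝓒 u) (h : Cross (𝓒 := 𝓒) (𝓑 := 𝓑) ev u v) : Double 𝓒 𝓑 ev →ₐ[k] A :=
  RingQuot.liftAlgHom k ⟨TensorAlgebra.lift k (u.coprod v.toLinearMap), by
    have hc : ∀ c, TensorAlgebra.lift k (u.coprod v.toLinearMap) (dgenC k C B c) = u c :=
      fun c => by simp [dgenC]
    have hb : ∀ b, TensorAlgebra.lift k (u.coprod v.toLinearMap) (dgenB k C B b) = v b :=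
      fun b => by simp [dgenB]
    intro x y hxy
    induction hxy with
    | oneC => rw [hc, hu.map_one, map_one]
    | mulC i j c d hi hj =>
      rw [map_mul, unit_smul k, map_smul, hc, hc, hc, hu.map_mul i j c hi d hj]
    | oneB => rw [hb, map_one, map_one]
    | mulB a b => rw [map_mul, hb, hb, hb, map_mul]
    | cross b j c hj r t =>
      have h1 := cross_left hC.comul_graded ev u v.toLinearMap hj t r
      have h2 := cross_right hev u v.toLinearMap t r
      have h3 := h1.symm.trans ((congrArg (fun f => f.ofConv (STensor.of 𝓒 𝓑 (c ⊗ₜ b))) h).trans h2)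
      simp only [unit_smul k, AlgHom.toLinearMap_apply] at h3
      simp only [map_sum, unit_smul k, map_smul, map_mul, hc, hb]
      exact h3⟩

@[simp] theorem lift_inC (hC : IsSuperHopf 𝓒 SC) (hev : IsSuperDual 𝓒 𝓑 ev) (u : C →ₗ[k] A)
    (v : B →ₐ[k] A) (hu : IsAntiHom 𝓒 u) (h : Cross (𝓒 := 𝓒) (𝓑 := 𝓑) ev u v) (c : C) :
    lift hC hev u v hu h (inC 𝓒 𝓑 ev c) = u c := by
  change RingQuot.liftAlgHom k _ (RingQuot.mkAlgHom k _ (dgenC k C B c)) = u c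
  rw [RingQuot.liftAlgHom_mkAlgHom_apply]
  simp [dgenC]

@[simp] theorem lift_inB (hC : IsSuperHopf 𝓒 SC) (hev : IsSuperDual 𝓒 𝓑 ev) (u : C →ₗ[k] A)
    (v : B →ₐ[k] A) (hu : IsAntiHom 𝓒 u) (h : Cross (𝓒 := 𝓒) (𝓑 := 𝓑) ev u v) (b : B) :
    lift hC hev u v hu h (inB 𝓒 𝓑 ev b) = v b := by
  change RingQuot.liftAlgHom k _ (RingQuot.mkAlgHom k _ (dgenB k C B b)) = v b
  rw [RingQuot.liftAlgHom_mkAlgHom_apply]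
  simp [dgenB]

theorem mk_rel {x y : TensorAlgebra k (C × B)} (h : DoubleRel 𝓒 𝓑 ev x y) :
    mk 𝓒 𝓑 ev x = mk 𝓒 𝓑 ev y := RingQuot.mkAlgHom_rel k h

theorem algHom_ext {f g : Double 𝓒 𝓑 ev →ₐ[k] A}
    (hc : ∀ c, f (inC 𝓒 𝓑 ev c) = g (inC 𝓒 𝓑 ev c))
    (hb : ∀ b, f (inB 𝓒 𝓑 ev b) = g (inB 𝓒 𝓑 ev b)) : f = g := by
  apply RingQuot.ringQuot_ext'
  apply TensorAlgebra.hom_ext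
  apply LinearMap.prod_ext
  · ext c; exact hc c
  · ext b; exact hb b

variable (𝓒 𝓑 ev) in
theorem isAntiHom_inC : IsAntiHom 𝓒 (inC 𝓒 𝓑 ev) where
  map_one := (mk_rel DoubleRel.oneC).trans (map_one _)
  map_mul i j a ha b hb := by
    have := mk_rel (DoubleRel.mulC (𝓒 := 𝓒) (𝓑 := 𝓑) (ev := ev) i j a b ha hb)
    rw [unit_smul k] at this
    exact ((map_mul _ _ _).symm.trans this).trans (map_smul _ _ _)

variable (𝓒 𝓑 ev) in
/-- The inclusion of `B`, as an algebra map. -/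
def inBHom : B →ₐ[k] Double 𝓒 𝓑 ev :=
  AlgHom.ofLinearMap (inB 𝓒 𝓑 ev) ((mk_rel DoubleRel.oneB).trans (map_one _))
    fun a b => (mk_rel (DoubleRel.mulB a b)).symm.trans (map_mul _ _ _)

@[simp] theorem inBHom_apply (b : B) : inBHom 𝓒 𝓑 ev b = inB 𝓒 𝓑 ev b := rfl

theorem cross_in (hC : IsSuperHopf 𝓒 SC) (hev : IsSuperDual 𝓒 𝓑 ev) :
    Cross (𝓒 := 𝓒) (𝓑 := 𝓑) ev (inC 𝓒 𝓑 ev) (inBHom 𝓒 𝓑 ev) := by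
  refine STensor.conv_ext fun i j c hc b _ => ?_
  obtain ⟨t⟩ := SuperRepr.nonempty 𝓒 c
  obtain ⟨r⟩ := SuperRepr.nonempty 𝓑 b
  rw [cross_left hC.comul_graded ev _ _ hc t r, cross_right hev _ _ t r]
  have h := mk_rel (DoubleRel.cross (ev := ev) b i c hc r t)
  simp only [unit_smul k, map_sum, map_smul, map_mul] at h ⊢
  exact h

/-- The linear map `c ⊗ b ↦ c b`, on the super tensor product. -/
theorem pair_eq (x : C ⊗[k] B) : pair 𝓒 𝓑 ev x = (STensor.inl 𝓒 𝓑 (toConv (inC 𝓒 𝓑 ev)) *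
    STensor.inr 𝓒 𝓑 (toConv (inBHom 𝓒 𝓑 ev).toLinearMap)) (STensor.of 𝓒 𝓑 x) := by
  induction x with
  | zero => simp only [map_zero]
  | add x y hx hy => simp only [map_add, hx, hy]
  | tmul c b => rw [STensor.inl_mul_inr]; rfl

theorem pair_tmul (c : C) (b : B) :
    pair 𝓒 𝓑 ev (c ⊗ₜ b) = inC 𝓒 𝓑 ev c * inB 𝓒 𝓑 ev b := rfl

/-- Straightening: multiplying the cross relation by `ev⁻¹` gives `V * U = ev * U * V * ev⁻¹`, whose
values stay in the range of `pair` because convolving with functionals cannot leave a subspace. -/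
theorem inB_mul_inC_mem (hC : IsSuperHopf 𝓒 SC) (hSC : Function.Bijective SC)
    (hev : IsSuperDual 𝓒 𝓑 ev) (b : B) (c : C) :
    inB 𝓒 𝓑 ev b * inC 𝓒 𝓑 ev c ∈ LinearMap.range (pair 𝓒 𝓑 ev) := by
  set U := STensor.inl 𝓒 𝓑 (toConv (inC 𝓒 𝓑 ev)) with hU
  set V := STensor.inr 𝓒 𝓑 (toConv (inBHom 𝓒 𝓑 ev).toLinearMap) with hV
  have h1 : V * U = scal _ (pairing 𝓒 𝓑 ev) * (U * V *
      scal _ (pairing 𝓒 𝓑 (ev ∘ₗ IsSuperHopf.invAntipode SC hSC))) := by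
    have := congrArg (· * scal _ (pairing 𝓒 𝓑 (ev ∘ₗ IsSuperHopf.invAntipode SC hSC)))
      (cross_in hC hev)
    simp only [mul_assoc] at this
    rw [← map_mul, pairing_mul_pairing_invAntipode hC hSC hev, map_one, mul_one] at this
    simpa only [mul_assoc] using this
  have h2 : ∀ x, (V * U) x ∈ LinearMap.range (pair 𝓒 𝓑 ev) := by
    rw [h1]
    refine conv_mem _ (conv_mem' _ fun x => ?_)
    exact ⟨(STensor.of 𝓒 𝓑).symm x, by rw [pair_eq]; simp [hU, hV]⟩
  have h3 : ∀ i j, inB 𝓒 𝓑 ev (pr 𝓑 j b) * inC 𝓒 𝓑 ev (pr 𝓒 i c) ∈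
      LinearMap.range (pair 𝓒 𝓑 ev) := fun i j => by
    have h4 := h2 (STensor.of 𝓒 𝓑 (pr 𝓒 i c ⊗ₜ pr 𝓑 j b))
    rw [STensor.inr_mul_inl _ _ (pr_mem _ _ _) (pr_mem _ _ _)] at h4
    have h5 := Submodule.smul_mem _ (sgn k (i * j)) h4
    rwa [smul_smul, sgn_mul_self, one_smul] at h5
  rw [← pr_add_pr 𝓑 b, ← pr_add_pr 𝓒 c, map_add, map_add, mul_add, add_mul, add_mul]
  exact add_mem (add_mem (h3 _ _) (h3 _ _)) (add_mem (h3 _ _) (h3 _ _))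

theorem inC_mul_inC_mem (c d : C) (b : B) :
    inC 𝓒 𝓑 ev c * (inC 𝓒 𝓑 ev d * inB 𝓒 𝓑 ev b) ∈ LinearMap.range (pair 𝓒 𝓑 ev) := by
  have h : ∀ i j, inC 𝓒 𝓑 ev (pr 𝓒 i c) * (inC 𝓒 𝓑 ev (pr 𝓒 j d) * inB 𝓒 𝓑 ev b) ∈
      LinearMap.range (pair 𝓒 𝓑 ev) := fun i j => by
    rw [← mul_assoc, (isAntiHom_inC 𝓒 𝓑 ev).map_mul i j _ (pr_mem _ _ _) _ (pr_mem _ _ _),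
      smul_mul_assoc]
    exact Submodule.smul_mem _ _ ⟨_, pair_tmul _ _⟩
  rw [← pr_add_pr 𝓒 c, ← pr_add_pr 𝓒 d, map_add, map_add]
  simp only [mul_add, add_mul]
  exact add_mem (add_mem (h _ _) (h _ _)) (add_mem (h _ _) (h _ _))

/-- The range contains `1` and is stable under left multiplication by the generators, hence is
everything. -/
theorem pair_surjective (hC : IsSuperHopf 𝓒 SC) (hSC : Function.Bijective SC)
    (hev : IsSuperDual 𝓒 𝓑 ev) : Function.Surjective (pair 𝓒 𝓑 ev) := by
  set R := LinearMap.range (pair 𝓒 𝓑 ev) with hR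
  have hCl : ∀ c, ∀ x ∈ R, inC 𝓒 𝓑 ev c * x ∈ R := by
    rintro c _ ⟨x, rfl⟩
    induction x with
    | zero => rw [map_zero, mul_zero]; exact zero_mem _
    | add x y hx hy => rw [map_add, mul_add]; exact add_mem hx hy
    | tmul d b => exact inC_mul_inC_mem c d b
  -- Needed for `b (d a)`: after straightening `b d`, the factor `a` is still to be multiplied in
  -- from the right.
  have hBr : ∀ b, ∀ x ∈ R, x * inB 𝓒 𝓑 ev b ∈ R := by
    rintro b _ ⟨x, rfl⟩
    induction x with
    | zero => rw [map_zero, zero_mul]; exact zero_mem _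
    | add x y hx hy => rw [map_add, add_mul]; exact add_mem hx hy
    | tmul d a =>
      rw [pair_tmul, mul_assoc]
      exact ⟨d ⊗ₜ (a * b), by rw [pair_tmul]; exact congrArg _ (map_mul (inBHom 𝓒 𝓑 ev) a b)⟩
  have hBl : ∀ b, ∀ x ∈ R, inB 𝓒 𝓑 ev b * x ∈ R := by
    rintro b _ ⟨x, rfl⟩
    induction x with
    | zero => rw [map_zero, mul_zero]; exact zero_mem _
    | add x y hx hy => rw [map_add, mul_add]; exact add_mem hx hy
    | tmul d a =>
      rw [pair_tmul, ← mul_assoc]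
      exact hBr a _ (inB_mul_inC_mem hC hSC hev b d)
  have h1 : (1 : Double 𝓒 𝓑 ev) ∈ R := ⟨1 ⊗ₜ 1, by
    rw [pair_tmul, (isAntiHom_inC 𝓒 𝓑 ev).map_one, ← inBHom_apply, map_one, mul_one]⟩
  have key : ∀ z : TensorAlgebra k (C × B), ∀ x ∈ R,
      mk 𝓒 𝓑 ev z * x ∈ R := by
    intro z
    induction z using TensorAlgebra.induction with
    | algebraMap r =>
      intro x hx
      rw [AlgHom.commutes, Algebra.algebraMap_eq_smul_one, smul_mul_assoc, one_mul]
      exact Submodule.smul_mem _ _ hx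
    | ι p =>
      intro x hx
      have : TensorAlgebra.ι k p = dgenC k C B p.1 + dgenB k C B p.2 := by
        simp [dgenC, dgenB, ← map_add]
      rw [this, map_add, add_mul]
      exact add_mem (hCl p.1 x hx) (hBl p.2 x hx)
    | mul a b ha hb =>
      intro x hx
      rw [map_mul, mul_assoc]
      exact ha _ (hb _ hx)
    | add a b ha hb =>
      intro x hx
      rw [map_add, add_mul]
      exact add_mem (ha _ hx) (hb _ hx)
  intro x
  obtain ⟨z, rfl⟩ := mk_surjective 𝓒 𝓑 ev x
  have := key z 1 h1
  rwa [mul_one] at this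

/-- The value of the Fock representation on the vacuum determines `x` up to contraction with `ev`.
What makes this injective is that `ev` is convolution-invertible; nondegeneracy plays no role. -/
theorem pair_injective (hC : IsSuperHopf 𝓒 SC) (hSC : Function.Bijective SC)
    (hB : IsSuperHopf 𝓑 SB) (hev : IsSuperDual 𝓒 𝓑 ev) : Function.Injective (pair 𝓒 𝓑 ev) := by
  let ρ : Double 𝓒 𝓑 ev →ₐ[k] Module.End k (C ⊗[k] B) :=
    lift hC hev (fockC ev 𝓒 𝓑) (fockB hC hB hev) (isAntiHom_fockC hC hB hev)
      (fock_cross hC hB hev)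
  have hρC : ∀ c, ρ (inC 𝓒 𝓑 ev c) = fockC ev 𝓒 𝓑 c := lift_inC _ _ _ _ _ _
  have hρB : ∀ b, ρ (inB 𝓒 𝓑 ev b) = fockB hC hB hev b := lift_inB _ _ _ _ _ _
  have h : ∀ x, STensor.of 𝓒 𝓑 (ρ (pair 𝓒 𝓑 ev x) (1 ⊗ₜ 1)) =
      contractRight (pairing 𝓒 𝓑 ev).ofConv (STensor.of 𝓒 𝓑 x) := fun x => by
    induction x with
    | zero => simp
    | add x y hx hy => simp only [map_add, LinearMap.add_apply, hx, hy]
    | tmul c b => rw [pair_tmul, map_mul, hρC, hρB, fock_vacuum]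
  intro x y hxy
  have := contractRight_injective (pairing_invAntipode_mul_pairing hC hSC hev)
    ((h x).symm.trans ((by rw [hxy]) : _ = _) |>.trans (h y))
  exact (STensor.of 𝓒 𝓑).injective this

end Algebra

end Double

/-! ### The grading of the super-double -/

section

variable {k : Type*} [Field k] {A : Type*} [Ring A] [Algebra k A]

/-- The eigenspaces of an involution form a grading. -/
@[reducible]
def gradedAlgebraOfInvolution (h2 : (2 : k) ≠ 0) (𝓐 : ZMod 2 → Submodule k A) (τ : A →ₐ[k] A)
    (hτ : ∀ x, τ (τ x) = x) (h𝓐 : ∀ i x, x ∈ 𝓐 i ↔ τ x = sgn k i • x) : GradedAlgebra 𝓐 := by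
  have h0 : ∀ x, (2 : k)⁻¹ • (x + τ x) ∈ 𝓐 0 := fun x => by
    rw [h𝓐, map_smul, map_add, hτ, sgn_zero, one_smul, add_comm]
  have h1 : ∀ x, (2 : k)⁻¹ • (x - τ x) ∈ 𝓐 1 := fun x => by
    rw [h𝓐, map_smul, map_sub, hτ, sgn_one, smul_comm, neg_one_smul, neg_sub]
  have half : ∀ x : A, (2 : k)⁻¹ • (x + x) = x := fun x => by
    rw [← two_smul k, inv_smul_smul₀ h2]
  let p0 : A →ₗ[k] 𝓐 0 := LinearMap.codRestrict _ ((2 : k)⁻¹ • (LinearMap.id + τ.toLinearMap)) h0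
  let p1 : A →ₗ[k] 𝓐 1 := LinearMap.codRestrict _ ((2 : k)⁻¹ • (LinearMap.id - τ.toLinearMap)) h1
  have hp0 : ∀ x, (p0 x : A) = (2 : k)⁻¹ • (x + τ x) := fun x => rfl
  have hp1 : ∀ x, (p1 x : A) = (2 : k)⁻¹ • (x - τ x) := fun x => rfl
  exact
  { one_mem := by rw [h𝓐, map_one, sgn_zero, one_smul]
    mul_mem := fun i j a b ha hb => by
      rw [h𝓐] at ha hb ⊢
      rw [map_mul, ha, hb, smul_mul_smul_comm, sgn_add]
    toDecomposition := DirectSum.Decomposition.ofLinearMap 𝓐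
      (DirectSum.lof k _ (fun i => 𝓐 i) 0 ∘ₗ p0 + DirectSum.lof k _ (fun i => 𝓐 i) 1 ∘ₗ p1)
      (by
        ext x
        simp only [LinearMap.comp_apply, LinearMap.add_apply, map_add, DirectSum.coeLinearMap_lof,
          hp0, hp1, LinearMap.id_apply]
        rw [← smul_add, add_add_sub_cancel, half])
      (by
        apply DirectSum.linearMap_ext
        intro i
        ext1 x
        have hx := (h𝓐 i x).1 x.2
        simp only [LinearMap.comp_apply, LinearMap.add_apply, DirectSum.coeLinearMap_lof,
          LinearMap.id_apply]
        rcases zmod_two_cases i with rfl | rfl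
        · have e0 : p0 x = x := Subtype.ext (by rw [hp0, hx, sgn_zero, one_smul, half])
          have e1 : p1 x = 0 := Subtype.ext (by rw [hp1, hx, sgn_zero, one_smul, sub_self, smul_zero]; rfl)
          rw [e0, e1, map_zero, add_zero]
        · have e0 : p0 x = 0 := Subtype.ext (by
            rw [hp0, hx, sgn_one, neg_one_smul, add_neg_cancel, smul_zero]; rfl)
          have e1 : p1 x = x := Subtype.ext (by
            rw [hp1, hx, sgn_one, neg_one_smul, sub_neg_eq_add, half])
          rw [e0, e1, map_zero, zero_add]) }

end

namespace Double

variable {k : Type*} [Field k]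
  {C : Type*} [Ring C] [Algebra k C] [Coalgebra k C] {𝓒 : ZMod 2 → Submodule k C}
  [GradedAlgebra 𝓒] [IsSuperCoalgebra 𝓒] {SC : C →ₗ[k] C}
  {B : Type*} [Ring B] [Algebra k B] [Coalgebra k B] {𝓑 : ZMod 2 → Submodule k B}
  [GradedAlgebra 𝓑] [IsSuperCoalgebra 𝓑] {SB : B →ₗ[k] B}
  {ev : C →ₗ[k] B →ₗ[k] k}

/-- The parity involution of the super-double. -/
def parity (hC : IsSuperHopf 𝓒 SC) (hev : IsSuperDual 𝓒 𝓑 ev) :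
    Double 𝓒 𝓑 ev →ₐ[k] Double 𝓒 𝓑 ev :=
  lift hC hev (inC 𝓒 𝓑 ev ∘ₗ par 𝓒) ((inBHom 𝓒 𝓑 ev).comp (parHom 𝓑))
    (isAntiHom_inC 𝓒 𝓑 ev).comp_par (by
      -- The parity of `STensor 𝓒 𝓑` is a coalgebra map and fixes the even functional `ev`, so the
      -- relation for the twisted inclusions is the pullback of the original one.
      have hl : convPull (STensor.parCoalgHom 𝓒 𝓑) (STensor.inl 𝓒 𝓑 (toConv (inC 𝓒 𝓑 ev))) =
          STensor.inl 𝓒 𝓑 (toConv (inC 𝓒 𝓑 ev ∘ₗ par 𝓒)) :=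
        STensor.conv_ext fun i j c _ b _ => by
          change STensor.inl 𝓒 𝓑 (toConv (inC 𝓒 𝓑 ev)) (STensor.of 𝓒 𝓑 (par 𝓒 c ⊗ₜ par 𝓑 b)) = _
          rw [STensor.inl_of, STensor.inl_of, counit_par]; rfl
      have hr : convPull (STensor.parCoalgHom 𝓒 𝓑)
          (STensor.inr 𝓒 𝓑 (toConv (inBHom 𝓒 𝓑 ev).toLinearMap)) =
          STensor.inr 𝓒 𝓑 (toConv ((inBHom 𝓒 𝓑 ev).comp (parHom 𝓑)).toLinearMap) :=
        STensor.conv_ext fun i j c _ b _ => by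
          change STensor.inr 𝓒 𝓑 (toConv (inBHom 𝓒 𝓑 ev).toLinearMap)
              (STensor.of 𝓒 𝓑 (par 𝓒 c ⊗ₜ par 𝓑 b)) = _
          rw [STensor.inr_of, STensor.inr_of, counit_par]; rfl
      have he : convPull (STensor.parCoalgHom 𝓒 𝓑) (scal (Double 𝓒 𝓑 ev) (pairing 𝓒 𝓑 ev)) =
          scal (Double 𝓒 𝓑 ev) (pairing 𝓒 𝓑 ev) :=
        STensor.conv_ext fun i j c hc b hb => by
          change scal _ (pairing 𝓒 𝓑 ev) (STensor.of 𝓒 𝓑 (par 𝓒 c ⊗ₜ par 𝓑 b)) = _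
          rw [scal_apply, scal_apply, pairing_of, pairing_of, par_of_mem hc, par_of_mem hb]
          simp only [map_smul, LinearMap.smul_apply, smul_eq_mul]
          rw [← hev.mul_apply (sgn k) hc hb, sgn_mul_sgn_mul]
      have h := congrArg (convPull (STensor.parCoalgHom 𝓒 𝓑)) (cross_in hC hev)
      simp only [map_mul, hl, hr, he] at h
      exact h)

theorem parity_inC (hC : IsSuperHopf 𝓒 SC) (hev : IsSuperDual 𝓒 𝓑 ev) (c : C) :
    parity hC hev (inC 𝓒 𝓑 ev c) = inC 𝓒 𝓑 ev (par 𝓒 c) := lift_inC _ _ _ _ _ _ _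

theorem parity_inB (hC : IsSuperHopf 𝓒 SC) (hev : IsSuperDual 𝓒 𝓑 ev) (b : B) :
    parity hC hev (inB 𝓒 𝓑 ev b) = inB 𝓒 𝓑 ev (par 𝓑 b) := lift_inB _ _ _ _ _ _ _

theorem parity_parity (hC : IsSuperHopf 𝓒 SC) (hev : IsSuperDual 𝓒 𝓑 ev) (x : Double 𝓒 𝓑 ev) :
    parity hC hev (parity hC hev x) = x := by
  have h : (parity hC hev).comp (parity hC hev) = AlgHom.id k (Double 𝓒 𝓑 ev) :=
    algHom_ext (fun c => by simp [parity_inC]) (fun b => by simp [parity_inB])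
  exact AlgHom.congr_fun h x

theorem inC_mul_inB_mem {i j : ZMod 2} {c : C} (hc : c ∈ 𝓒 i) {b : B} (hb : b ∈ 𝓑 j) :
    inC 𝓒 𝓑 ev c * inB 𝓒 𝓑 ev b ∈ grading 𝓒 𝓑 ev (i + j) :=
  Submodule.subset_span ⟨i, j, c, b, hc, hb, rfl, rfl⟩

theorem inB_one : inB 𝓒 𝓑 ev 1 = 1 := map_one (inBHom 𝓒 𝓑 ev)

theorem inC_mem {i : ZMod 2} {c : C} (hc : c ∈ 𝓒 i) : inC 𝓒 𝓑 ev c ∈ grading 𝓒 𝓑 ev i := by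
  have := inC_mul_inB_mem (ev := ev) hc (SetLike.GradedOne.one_mem (A := 𝓑))
  rwa [inB_one, mul_one, add_zero] at this

theorem inB_mem {i : ZMod 2} {b : B} (hb : b ∈ 𝓑 i) : inB 𝓒 𝓑 ev b ∈ grading 𝓒 𝓑 ev i := by
  have := inC_mul_inB_mem (ev := ev) (SetLike.GradedOne.one_mem (A := 𝓒)) hb
  rwa [(isAntiHom_inC 𝓒 𝓑 ev).map_one, one_mul, zero_add] at this

theorem parity_of_mem (hC : IsSuperHopf 𝓒 SC) (hev : IsSuperDual 𝓒 𝓑 ev) {i : ZMod 2}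
    {x : Double 𝓒 𝓑 ev} (hx : x ∈ grading 𝓒 𝓑 ev i) : parity hC hev x = sgn k i • x := by
  induction hx using Submodule.span_induction with
  | mem x h =>
    obtain ⟨j, l, c, b, hc, hb, rfl, rfl⟩ := h
    rw [map_mul, parity_inC, parity_inB, par_of_mem hc, par_of_mem hb, map_smul, map_smul,
      smul_mul_smul_comm, sgn_add]
  | zero => simp
  | add x y _ _ hx hy => rw [map_add, hx, hy, smul_add]
  | smul a x _ hx => rw [map_smul, hx, smul_comm]

theorem exists_add_mem_grading (hC : IsSuperHopf 𝓒 SC) (hSC : Function.Bijective SC)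
    (hev : IsSuperDual 𝓒 𝓑 ev) (x : Double 𝓒 𝓑 ev) (i : ZMod 2) :
    ∃ y ∈ grading 𝓒 𝓑 ev i, ∃ z ∈ grading 𝓒 𝓑 ev (i + 1), x = y + z := by
  obtain ⟨w, rfl⟩ := pair_surjective hC hSC hev x
  suffices h : pair 𝓒 𝓑 ev w ∈ grading 𝓒 𝓑 ev i ⊔ grading 𝓒 𝓑 ev (i + 1) by
    obtain ⟨y, hy, z, hz, h⟩ := Submodule.mem_sup.1 h
    exact ⟨y, hy, z, hz, h.symm⟩
  have hle : ∀ j, grading 𝓒 𝓑 ev j ≤ grading 𝓒 𝓑 ev i ⊔ grading 𝓒 𝓑 ev (i + 1) := fun j => by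
    have : ∀ i j : ZMod 2, j = i ∨ j = i + 1 := by decide
    rcases this i j with rfl | rfl
    · exact le_sup_left
    · exact le_sup_right
  induction w with
  | zero => rw [map_zero]; exact zero_mem _
  | add x y hx hy => rw [map_add]; exact add_mem hx hy
  | tmul c b =>
    rw [← pr_add_pr 𝓒 c, ← pr_add_pr 𝓑 b]
    simp only [TensorProduct.add_tmul, TensorProduct.tmul_add, map_add, pair_tmul]
    have h := fun m n => hle _ (inC_mul_inB_mem (ev := ev) (pr_mem 𝓒 m c) (pr_mem 𝓑 n b))
    exact add_mem (add_mem (h _ _) (h _ _)) (add_mem (h _ _) (h _ _))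

/-- Spanning splits any `x` into parts of degrees `i` and `i + 1`. For an eigenvector, the second
part equals its own negative, hence is zero because `2 ≠ 0`. -/
theorem mem_grading_iff (h2 : (2 : k) ≠ 0) (hC : IsSuperHopf 𝓒 SC) (hSC : Function.Bijective SC)
    (hev : IsSuperDual 𝓒 𝓑 ev) (i : ZMod 2) (x : Double 𝓒 𝓑 ev) :
    x ∈ grading 𝓒 𝓑 ev i ↔ parity hC hev x = sgn k i • x := by
  refine ⟨parity_of_mem hC hev, fun h => ?_⟩
  obtain ⟨y, hy, z, hz, rfl⟩ := exists_add_mem_grading hC hSC hev x i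
  rw [map_add, parity_of_mem hC hev hy, parity_of_mem hC hev hz, smul_add, sgn_add, sgn_one,
    mul_neg_one, neg_smul] at h
  have h3 : (2 : k) • sgn k i • z = 0 := by
    have := add_left_cancel h
    rw [two_smul]
    nth_rewrite 1 [← this]
    exact neg_add_cancel _
  have h4 : z = 0 := by
    have h5 := (smul_eq_zero.1 h3).resolve_left h2
    rw [← one_smul k z, ← sgn_mul_self k i, mul_smul, h5, smul_zero]
  rw [h4, add_zero]
  exact hy

/-- The grading of the super-double is an algebra grading. -/
@[reducible]
def gradedAlgebra (h2 : (2 : k) ≠ 0) (hC : IsSuperHopf 𝓒 SC) (hSC : Function.Bijective SC)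
    (hev : IsSuperDual 𝓒 𝓑 ev) : GradedAlgebra (grading 𝓒 𝓑 ev) :=
  gradedAlgebraOfInvolution h2 _ (parity hC hev) (parity_parity hC hev)
    (mem_grading_iff h2 hC hSC hev)

end Double

/-! ### The coproduct of the super-double -/

section

variable {k : Type*} [Field k]

/-- A coalgebra structure, transported along a linear equivalence. -/
@[reducible]
def coalgebraOfEquiv {E D : Type*} [AddCommGroup E] [Module k E] [Coalgebra k E] [AddCommGroup D]
    [Module k D] (e : E ≃ₗ[k] D) : Coalgebra k D where
  comul := TensorProduct.map e.toLinearMap e.toLinearMap ∘ₗ Coalgebra.comul ∘ₗ e.symm.toLinearMap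
  counit := Coalgebra.counit ∘ₗ e.symm.toLinearMap
  coassoc := by
    ext x
    have h := congrArg (TensorProduct.map e.toLinearMap
      (TensorProduct.map e.toLinearMap e.toLinearMap)) (Coalgebra.coassoc_apply (R := k) (e.symm x))
    have hl : ∀ z : E ⊗[k] E, TensorProduct.assoc k D D D (LinearMap.rTensor D
        (TensorProduct.map e.toLinearMap e.toLinearMap ∘ₗ Coalgebra.comul ∘ₗ e.symm.toLinearMap)
        (TensorProduct.map e.toLinearMap e.toLinearMap z)) = TensorProduct.map e.toLinearMap
          (TensorProduct.map e.toLinearMap e.toLinearMap)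
          (TensorProduct.assoc k E E E (LinearMap.rTensor E Coalgebra.comul z)) := fun z => by
      induction z with
      | zero => simp
      | add a b ha hb => simp only [map_add, ha, hb]
      | tmul a b =>
        simp only [TensorProduct.map_tmul, LinearEquiv.coe_coe, LinearMap.rTensor_tmul,
          LinearMap.comp_apply, LinearEquiv.symm_apply_apply]
        generalize Coalgebra.comul (R := k) a = w
        induction w with
        | zero => simp
        | add a b ha hb => simp only [map_add, TensorProduct.add_tmul, ha, hb]
        | tmul a b => simp
    have hr : ∀ z : E ⊗[k] E, LinearMap.lTensor D
        (TensorProduct.map e.toLinearMap e.toLinearMap ∘ₗ Coalgebra.comul ∘ₗ e.symm.toLinearMap)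
        (TensorProduct.map e.toLinearMap e.toLinearMap z) = TensorProduct.map e.toLinearMap
          (TensorProduct.map e.toLinearMap e.toLinearMap)
          (LinearMap.lTensor E Coalgebra.comul z) := fun z => by
      induction z with
      | zero => simp
      | add a b ha hb => simp only [map_add, ha, hb]
      | tmul a b => simp
    exact (hl _).trans (h.trans (hr _).symm)
  rTensor_counit_comp_comul := by
    ext x
    have h := congrArg (TensorProduct.map LinearMap.id e.toLinearMap)
      (Coalgebra.rTensor_counit_comul (R := k) (e.symm x))
    simp only [LinearMap.comp_apply, LinearEquiv.coe_coe]
    generalize Coalgebra.comul (R := k) (e.symm x) = z at h ⊢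
    have h' : LinearMap.rTensor D (Coalgebra.counit ∘ₗ e.symm.toLinearMap) ∘ₗ
        TensorProduct.map e.toLinearMap e.toLinearMap =
        TensorProduct.map LinearMap.id e.toLinearMap ∘ₗ
          LinearMap.rTensor E (Coalgebra.counit (R := k)) := by
      ext; simp
    exact (LinearMap.congr_fun h' z).trans (h.trans (by simp))
  lTensor_counit_comp_comul := by
    ext x
    have h := congrArg (TensorProduct.map e.toLinearMap LinearMap.id)
      (Coalgebra.lTensor_counit_comul (R := k) (e.symm x))
    simp only [LinearMap.comp_apply, LinearEquiv.coe_coe]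
    generalize Coalgebra.comul (R := k) (e.symm x) = z at h ⊢
    have h' : LinearMap.lTensor D (Coalgebra.counit ∘ₗ e.symm.toLinearMap) ∘ₗ
        TensorProduct.map e.toLinearMap e.toLinearMap =
        TensorProduct.map e.toLinearMap LinearMap.id ∘ₗ
          LinearMap.lTensor E (Coalgebra.counit (R := k)) := by
      ext; simp
    exact (LinearMap.congr_fun h' z).trans (h.trans (by simp))

/-- A linear equivalence is a coalgebra map for the transported structure. -/
def coalgHomOfEquiv {E D : Type*} [AddCommGroup E] [Module k E] [Coalgebra k E] [AddCommGroup D]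
    [Module k D] (e : E ≃ₗ[k] D) : letI := coalgebraOfEquiv e; E →ₗc[k] D :=
  letI := coalgebraOfEquiv e
  { e.toLinearMap with
    counit_comp := by
      ext x
      change Coalgebra.counit (R := k) (e.symm (e x)) = _
      rw [e.symm_apply_apply]
    map_comp_comul := by
      ext x
      change _ = TensorProduct.map e.toLinearMap e.toLinearMap
        (Coalgebra.comul (R := k) (e.symm (e x)))
      rw [e.symm_apply_apply]
      rfl }

end

section

variable {k : Type*} [Field k]
  {A : Type*} [Ring A] [Algebra k A] (𝓐 : ZMod 2 → Submodule k A) [GradedAlgebra 𝓐]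
  {B : Type*} [Ring B] [Algebra k B] (𝓑 : ZMod 2 → Submodule k B) [GradedAlgebra 𝓑]

theorem includeLeft_mul_includeRight (a : A) (b : B) :
    GradedTensorProduct.includeLeft 𝓐 𝓑 a * GradedTensorProduct.includeRight 𝓐 𝓑 b =
      GradedTensorProduct.of k 𝓐 𝓑 (a ⊗ₜ b) :=
  GradedTensorProduct.tmul_one_mul_one_tmul 𝓐 𝓑 a b

variable {𝓐 𝓑} in
theorem includeLeft_mul_includeRight_comm {i j : ZMod 2} {a : A} (ha : a ∈ 𝓐 i) {b : B}
    (hb : b ∈ 𝓑 j) :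
    GradedTensorProduct.includeLeft 𝓐 𝓑 a * GradedTensorProduct.includeRight 𝓐 𝓑 b =
      sgn k (i * j) •
        (GradedTensorProduct.includeRight 𝓐 𝓑 b * GradedTensorProduct.includeLeft 𝓐 𝓑 a) := by
  have h := graded_tmul_mul_tmul 𝓐 𝓑 (1 : A) hb ha (1 : B)
  rw [one_mul, mul_one, mul_comm j i] at h
  have h' : GradedTensorProduct.includeRight 𝓐 𝓑 b * GradedTensorProduct.includeLeft 𝓐 𝓑 a =
    sgn k (i * j) • GradedTensorProduct.of k 𝓐 𝓑 (a ⊗ₜ b) := h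
  rw [h', smul_smul, sgn_mul_self, one_smul, includeLeft_mul_includeRight]

variable {𝓐 𝓑} in
theorem includeRight_mul_includeLeft_comm {i j : ZMod 2} {b : B} (hb : b ∈ 𝓑 i) {a : A}
    (ha : a ∈ 𝓐 j) :
    GradedTensorProduct.includeRight 𝓐 𝓑 b * GradedTensorProduct.includeLeft 𝓐 𝓑 a =
      sgn k (i * j) •
        (GradedTensorProduct.includeLeft 𝓐 𝓑 a * GradedTensorProduct.includeRight 𝓐 𝓑 b) := by
  rw [includeLeft_mul_includeRight_comm ha hb, smul_smul, mul_comm j i, sgn_mul_self, one_smul]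

theorem pr_map {M N : Type*} [AddCommGroup M] [Module k M] [AddCommGroup N] [Module k N]
    (𝓜 : ZMod 2 → Submodule k M) [DirectSum.Decomposition 𝓜]
    (𝓝 : ZMod 2 → Submodule k N) [DirectSum.Decomposition 𝓝] (f : M →ₗ[k] N)
    (hf : ∀ i, ∀ x ∈ 𝓜 i, f x ∈ 𝓝 i) (i : ZMod 2) (x : M) : pr 𝓝 i (f x) = f (pr 𝓜 i x) := by
  have : pr 𝓝 i ∘ₗ f = f ∘ₗ pr 𝓜 i := homogeneous_ext 𝓜 fun j x hx => by
    by_cases h : j = i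
    · subst h
      simp [pr_of_mem hx, pr_of_mem (hf _ _ hx)]
    · simp [pr_of_mem_ne hx h, pr_of_mem_ne (hf _ _ hx) h]
  exact LinearMap.congr_fun this x

theorem par_map {M N : Type*} [AddCommGroup M] [Module k M] [AddCommGroup N] [Module k N]
    (𝓜 : ZMod 2 → Submodule k M) [DirectSum.Decomposition 𝓜]
    (𝓝 : ZMod 2 → Submodule k N) [DirectSum.Decomposition 𝓝] (f : M →ₗ[k] N)
    (hf : ∀ i, ∀ x ∈ 𝓜 i, f x ∈ 𝓝 i) (x : M) : par 𝓝 (f x) = f (par 𝓜 x) := by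
  simp [par, pr_map 𝓜 𝓝 f hf]

end

namespace Double

section Hopf

variable {k : Type*} [Field k]
  {C : Type*} [Ring C] [Algebra k C] [Coalgebra k C] {𝓒 : ZMod 2 → Submodule k C}
  [GradedAlgebra 𝓒] [IsSuperCoalgebra 𝓒] {SC : C →ₗ[k] C}
  {B : Type*} [Ring B] [Algebra k B] [Coalgebra k B] {𝓑 : ZMod 2 → Submodule k B}
  [GradedAlgebra 𝓑] [IsSuperCoalgebra 𝓑] {SB : B →ₗ[k] B}
  {ev : C →ₗ[k] B →ₗ[k] k} [GradedAlgebra (grading 𝓒 𝓑 ev)]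

variable (𝓒 𝓑 ev) in
/-- The inclusion as the left factor of the super tensor square. -/
abbrev incl₁ : Double 𝓒 𝓑 ev →ₐ[k] (grading 𝓒 𝓑 ev ᵍ⊗[k] grading 𝓒 𝓑 ev) :=
  GradedTensorProduct.includeLeft (grading 𝓒 𝓑 ev) (grading 𝓒 𝓑 ev)

variable (𝓒 𝓑 ev) in
/-- The inclusion as the right factor of the super tensor square. -/
abbrev incl₂ : Double 𝓒 𝓑 ev →ₐ[k] (grading 𝓒 𝓑 ev ᵍ⊗[k] grading 𝓒 𝓑 ev) :=
  GradedTensorProduct.includeRight (grading 𝓒 𝓑 ev) (grading 𝓒 𝓑 ev)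

variable (𝓒 𝓑 ev) in
/-- The coproduct on `C`. -/
def comulC : C →ₗ[k] (grading 𝓒 𝓑 ev ᵍ⊗[k] grading 𝓒 𝓑 ev) :=
  (toConv ((incl₁ 𝓒 𝓑 ev).toLinearMap ∘ₗ inC 𝓒 𝓑 ev) *
    toConv ((incl₂ 𝓒 𝓑 ev).toLinearMap ∘ₗ inC 𝓒 𝓑 ev)).ofConv

variable (ev) in
/-- The coproduct on `B`. -/
def comulB (hB : IsSuperHopf 𝓑 SB) : B →ₐ[k] (grading 𝓒 𝓑 ev ᵍ⊗[k] grading 𝓒 𝓑 ev) :=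
  have h : ∀ i j, ∀ a ∈ 𝓑 i, ∀ b ∈ 𝓑 j,
      ((incl₂ 𝓒 𝓑 ev).comp (inBHom 𝓒 𝓑 ev)) a * ((incl₁ 𝓒 𝓑 ev).comp (inBHom 𝓒 𝓑 ev)) b =
        sgn k (i * j) • (((incl₁ 𝓒 𝓑 ev).comp (inBHom 𝓒 𝓑 ev)) b *
          ((incl₂ 𝓒 𝓑 ev).comp (inBHom 𝓒 𝓑 ev)) a) :=
    fun _ _ _ ha _ hb => includeRight_mul_includeLeft_comm (inB_mem ha) (inB_mem hb)
  convAlgHom hB ((incl₁ 𝓒 𝓑 ev).comp (inBHom 𝓒 𝓑 ev)) ((incl₂ 𝓒 𝓑 ev).comp (inBHom 𝓒 𝓑 ev)) h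

theorem isAntiHom_comulC (hC : IsSuperHopf 𝓒 SC) : IsAntiHom 𝓒 (comulC 𝓒 𝓑 ev) :=
  ((isAntiHom_inC 𝓒 𝓑 ev).comp (incl₁ 𝓒 𝓑 ev)).mul hC ((isAntiHom_inC 𝓒 𝓑 ev).comp (incl₂ 𝓒 𝓑 ev))
    fun _ _ _ ha _ hb => includeLeft_mul_includeRight_comm (inC_mem ha) (inC_mem hb)

/-- The two copies of `D(B)` in the super tensor square super-commute and each satisfies the cross
relation, so `cross_mul` applies with both functionals equal to `ev`. -/
theorem cross_comul (hC : IsSuperHopf 𝓒 SC) (hB : IsSuperHopf 𝓑 SB) (hev : IsSuperDual 𝓒 𝓑 ev) :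
    Cross (𝓒 := 𝓒) (𝓑 := 𝓑) ev (comulC 𝓒 𝓑 ev) (comulB (𝓒 := 𝓒) ev hB) := by
  have h1 := congrArg (convPush _ (incl₁ 𝓒 𝓑 ev)) (cross_in (𝓑 := 𝓑) hC hev)
  have h2 := congrArg (convPush _ (incl₂ 𝓒 𝓑 ev)) (cross_in (𝓑 := 𝓑) hC hev)
  rw [map_mul, map_mul, map_mul, map_mul, convPush_scal] at h1 h2
  exact cross_mul (𝓒 := 𝓒) (𝓑 := 𝓑)
    (fun _ _ _ ha _ hb => includeLeft_mul_includeRight_comm (inC_mem ha) (inB_mem hb))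
    (fun _ _ _ ha _ hb => includeRight_mul_includeLeft_comm (inC_mem ha) (inB_mem hb)) h1 h2

/-- The coproduct, as an algebra map. -/
def comulHom (hC : IsSuperHopf 𝓒 SC) (hB : IsSuperHopf 𝓑 SB) (hev : IsSuperDual 𝓒 𝓑 ev) :
    Double 𝓒 𝓑 ev →ₐ[k] (grading 𝓒 𝓑 ev ᵍ⊗[k] grading 𝓒 𝓑 ev) :=
  lift hC hev (comulC 𝓒 𝓑 ev) (comulB ev hB) (isAntiHom_comulC hC) (cross_comul hC hB hev)

theorem conv_include {M : Type*} [AddCommGroup M] [Module k M] [Coalgebra k M]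
    (f : M →ₗ[k] Double 𝓒 𝓑 ev) (m : M) :
    (toConv ((incl₁ 𝓒 𝓑 ev).toLinearMap ∘ₗ f) * toConv ((incl₂ 𝓒 𝓑 ev).toLinearMap ∘ₗ f)) m =
    GradedTensorProduct.of k _ _ (TensorProduct.map f f (Coalgebra.comul (R := k) m)) := by
  rw [LinearMap.convMul_apply]
  generalize Coalgebra.comul (R := k) m = z
  induction z with
  | zero => simp
  | add x y hx hy => simp only [map_add, hx, hy]
  | tmul x y =>
    exact includeLeft_mul_includeRight _ _ _ _

theorem comulHom_inC (hC : IsSuperHopf 𝓒 SC) (hB : IsSuperHopf 𝓑 SB) (hev : IsSuperDual 𝓒 𝓑 ev)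
    (c : C) : comulHom hC hB hev (inC 𝓒 𝓑 ev c) = GradedTensorProduct.of k _ _
      (TensorProduct.map (inC 𝓒 𝓑 ev) (inC 𝓒 𝓑 ev) (Coalgebra.comul (R := k) c)) := by
  rw [comulHom, lift_inC]
  exact conv_include _ _

theorem comulHom_inB (hC : IsSuperHopf 𝓒 SC) (hB : IsSuperHopf 𝓑 SB) (hev : IsSuperDual 𝓒 𝓑 ev)
    (b : B) : comulHom hC hB hev (inB 𝓒 𝓑 ev b) = GradedTensorProduct.of k _ _
      (TensorProduct.map (inB 𝓒 𝓑 ev) (inB 𝓒 𝓑 ev) (Coalgebra.comul (R := k) b)) := by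
  have h := conv_include (ev := ev) (inBHom 𝓒 𝓑 ev).toLinearMap b
  have h' : (inBHom 𝓒 𝓑 ev).toLinearMap = inB 𝓒 𝓑 ev := rfl
  have h'' : comulB (𝓒 := 𝓒) ev hB b =
    (toConv ((incl₁ 𝓒 𝓑 ev).toLinearMap ∘ₗ (inBHom 𝓒 𝓑 ev).toLinearMap) *
      toConv ((incl₂ 𝓒 𝓑 ev).toLinearMap ∘ₗ (inBHom 𝓒 𝓑 ev).toLinearMap)) b := rfl
  rw [comulHom, lift_inB, h'', h, h']

/-- The inclusions preserve degree, so the exchange sign of the product in the super tensor square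
is that of the coproduct of `STensor 𝓒 𝓑`. -/
theorem map_mul_shuffle (X : C ⊗[k] C) (Y : B ⊗[k] B) :
    TensorProduct.map (LinearMap.mul' k _) (LinearMap.mul' k _)
      (shuffle (pr (grading 𝓒 𝓑 ev)) (par (grading 𝓒 𝓑 ev))
        (TensorProduct.map (inC 𝓒 𝓑 ev) (inC 𝓒 𝓑 ev) X ⊗ₜ
          TensorProduct.map (inB 𝓒 𝓑 ev) (inB 𝓒 𝓑 ev) Y)) =
    TensorProduct.map (pair 𝓒 𝓑 ev) (pair 𝓒 𝓑 ev) (shuffle (pr 𝓒) (par 𝓑) (X ⊗ₜ Y)) := by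
  induction X with
  | zero => simp
  | add x y hx hy => simp only [map_add, TensorProduct.add_tmul, hx, hy]
  | tmul x x' =>
    induction Y with
    | zero => simp
    | add x y hx hy => simp only [map_add, TensorProduct.tmul_add, hx, hy]
    | tmul y y' =>
      simp [shuffle_tmul, pair_tmul, pr_map 𝓒 (grading 𝓒 𝓑 ev) (inC 𝓒 𝓑 ev) fun _ _ => inC_mem,
        par_map 𝓑 (grading 𝓒 𝓑 ev) (inB 𝓒 𝓑 ev) fun _ _ => inB_mem]

/-- The counit, as an algebra map. -/
def counitHom (hC : IsSuperHopf 𝓒 SC) (hB : IsSuperHopf 𝓑 SB) (hev : IsSuperDual 𝓒 𝓑 ev) :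
    Double 𝓒 𝓑 ev →ₐ[k] k :=
  lift hC hev Coalgebra.counit
    (AlgHom.ofLinearMap Coalgebra.counit hB.counit_one hB.counit_mul)
    { map_one := hC.counit_one
      map_mul := fun i j a ha b hb => by
        rw [hC.counit_mul]
        rcases zmod_two_cases i with rfl | rfl
        · simp [mul_comm]
        · simp [hC.counit_graded a ha] }
    (by
      -- Counits are the units for convolution, so both sides of the cross relation reduce to the
      -- pairing.
      have h1 : STensor.inl 𝓒 𝓑 (toConv (Coalgebra.counit (R := k) (A := C))) = 1 :=
        map_one (STensor.inl 𝓒 𝓑 (A := k))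
      have h2 : STensor.inr 𝓒 𝓑 (toConv (AlgHom.ofLinearMap (Coalgebra.counit (R := k) (A := B))
          hB.counit_one hB.counit_mul).toLinearMap) = 1 :=
        map_one (STensor.inr 𝓒 𝓑 (A := k))
      rw [Cross, h1, h2, mul_one, one_mul, mul_one])

theorem counitHom_inC (hC : IsSuperHopf 𝓒 SC) (hB : IsSuperHopf 𝓑 SB) (hev : IsSuperDual 𝓒 𝓑 ev)
    (c : C) : counitHom hC hB hev (inC 𝓒 𝓑 ev c) = Coalgebra.counit (R := k) c :=
  lift_inC _ _ _ _ _ _ _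

theorem counitHom_inB (hC : IsSuperHopf 𝓒 SC) (hB : IsSuperHopf 𝓑 SB) (hev : IsSuperDual 𝓒 𝓑 ev)
    (b : B) : counitHom hC hB hev (inB 𝓒 𝓑 ev b) = Coalgebra.counit (R := k) b :=
  lift_inB _ _ _ _ _ _ _

variable [Coalgebra k (Double 𝓒 𝓑 ev)]

/-- The coalgebra structure of `D(B)` enters only through the coalgebra map `P`, so its construction
by transport need not be unfolded. -/
theorem comul_pair (P : STensor 𝓒 𝓑 →ₗc[k] Double 𝓒 𝓑 ev)
    (hP : ∀ x, P (STensor.of 𝓒 𝓑 x) = pair 𝓒 𝓑 ev x)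
    (c : C) (b : B) : Coalgebra.comul (R := k) (pair 𝓒 𝓑 ev (c ⊗ₜ b)) =
    TensorProduct.map (pair 𝓒 𝓑 ev) (pair 𝓒 𝓑 ev) (shuffle (pr 𝓒) (par 𝓑)
      (Coalgebra.comul (R := k) c ⊗ₜ Coalgebra.comul (R := k) b)) := by
  have hP' : P.toLinearMap ∘ₗ (STensor.of 𝓒 𝓑).toLinearMap = pair 𝓒 𝓑 ev := LinearMap.ext hP
  have h := LinearMap.congr_fun P.map_comp_comul (STensor.of 𝓒 𝓑 (c ⊗ₜ b))
  rw [LinearMap.comp_apply, LinearMap.comp_apply, STensor.comul_of, ← LinearMap.comp_apply,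
    ← TensorProduct.map_comp, hP'] at h
  have h' : P.toLinearMap (STensor.of 𝓒 𝓑 (c ⊗ₜ b)) = pair 𝓒 𝓑 ev (c ⊗ₜ b) := hP _
  rw [h'] at h
  exact h.symm

theorem of_comul_pair (hC : IsSuperHopf 𝓒 SC) (hB : IsSuperHopf 𝓑 SB) (hev : IsSuperDual 𝓒 𝓑 ev)
    (P : STensor 𝓒 𝓑 →ₗc[k] Double 𝓒 𝓑 ev)
    (hP : ∀ x, P (STensor.of 𝓒 𝓑 x) = pair 𝓒 𝓑 ev x)
    (c : C) (b : B) : GradedTensorProduct.of k (grading 𝓒 𝓑 ev) (grading 𝓒 𝓑 ev)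
      (Coalgebra.comul (R := k) (pair 𝓒 𝓑 ev (c ⊗ₜ b))) =
    comulHom hC hB hev (pair 𝓒 𝓑 ev (c ⊗ₜ b)) := by
  rw [comul_pair P hP, pair_tmul, map_mul, comulHom_inC, comulHom_inB, graded_mul, map_mul_shuffle]

/-- Joins the two descriptions of the coproduct: the transported one is coassociative, the one given
by the universal property is multiplicative, and they agree on the products `c b`, which span. -/
theorem of_comul (hC : IsSuperHopf 𝓒 SC) (hB : IsSuperHopf 𝓑 SB) (hev : IsSuperDual 𝓒 𝓑 ev)
    (P : STensor 𝓒 𝓑 →ₗc[k] Double 𝓒 𝓑 ev)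
    (hP : ∀ x, P (STensor.of 𝓒 𝓑 x) = pair 𝓒 𝓑 ev x)
    (hp : Function.Surjective (pair 𝓒 𝓑 ev)) (x : Double 𝓒 𝓑 ev) :
    GradedTensorProduct.of k (grading 𝓒 𝓑 ev) (grading 𝓒 𝓑 ev) (Coalgebra.comul (R := k) x) =
      comulHom hC hB hev x := by
  obtain ⟨w, rfl⟩ := hp x
  induction w with
  | zero => simp only [map_zero]
  | add x y hx hy => simp only [map_add, hx, hy]
  | tmul c b => exact of_comul_pair hC hB hev P hP c b

theorem counit_eq (hC : IsSuperHopf 𝓒 SC) (hB : IsSuperHopf 𝓑 SB) (hev : IsSuperDual 𝓒 𝓑 ev)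
    (P : STensor 𝓒 𝓑 →ₗc[k] Double 𝓒 𝓑 ev)
    (hP : ∀ x, P (STensor.of 𝓒 𝓑 x) = pair 𝓒 𝓑 ev x)
    (hp : Function.Surjective (pair 𝓒 𝓑 ev)) (x : Double 𝓒 𝓑 ev) :
    Coalgebra.counit (R := k) x = counitHom hC hB hev x := by
  obtain ⟨w, rfl⟩ := hp x
  induction w with
  | zero => simp only [map_zero]
  | add x y hx hy => simp only [map_add, hx, hy]
  | tmul c b =>
    rw [← hP, CoalgHomClass.counit_comp_apply, hP, pair_tmul, map_mul, counitHom_inC,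
      counitHom_inB, STensor.counit_of]

end Hopf

end Double

/-! ### The super-double is a super-Hopf algebra -/

section

variable {k : Type*} [Field k] {D : Type*} [Ring D] [Algebra k D] {𝓓 : ZMod 2 → Submodule k D}
  [GradedAlgebra 𝓓]

theorem map_pr_tmul {i j l : ZMod 2} (h : j + l = i) {x y : D} (hx : x ∈ 𝓓 j) (hy : y ∈ 𝓓 l) :
    TensorProduct.map (pr 𝓓 0) (pr 𝓓 i) (x ⊗ₜ[k] y) +
      TensorProduct.map (pr 𝓓 1) (pr 𝓓 (i + 1)) (x ⊗ₜ y) = x ⊗ₜ y := by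
  have h11 : (1 + 1 : ZMod 2) = 0 := by decide
  subst h
  rcases zmod_two_cases j with rfl | rfl
  · simp [pr_of_mem hx, pr_of_mem_ne hx (by decide : (0 : ZMod 2) ≠ 1), pr_of_mem hy]
  · have h : 1 + l + 1 = l := by rw [add_comm 1 l, add_assoc, h11, add_zero]
    simp [pr_of_mem hx, pr_of_mem_ne hx (by decide : (1 : ZMod 2) ≠ 0), h, pr_of_mem hy]

/-- In an arbitrary presentation, each second component is projected to the complementary degree `i
- deg₁ s`, written `i + deg₁ s` in `ZMod 2`; the hypothesis says that this does not change the sum.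
-/
theorem exists_superRepr [Coalgebra k D] {i : ZMod 2} {x : D}
    (h : TensorProduct.map (pr 𝓓 0) (pr 𝓓 i) (Coalgebra.comul (R := k) x) +
      TensorProduct.map (pr 𝓓 1) (pr 𝓓 (i + 1)) (Coalgebra.comul (R := k) x) =
        Coalgebra.comul (R := k) x) :
    ∃ r : SuperRepr 𝓓 x, ∀ s, r.deg₁ s + r.deg₂ s = i := by
  obtain ⟨r⟩ := SuperRepr.nonempty 𝓓 x
  refine ⟨⟨r.n, r.fst, fun s => pr 𝓓 (i + r.deg₁ s) (r.snd s), r.deg₁, fun s => i + r.deg₁ s,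
    r.fst_mem, fun s => pr_mem _ _ _, ?_⟩, fun s => ?_⟩
  · rw [← h, ← r.eq, map_sum, map_sum, ← Finset.sum_add_distrib]
    refine Finset.sum_congr rfl fun s _ => ?_
    have hs := r.fst_mem s
    rw [TensorProduct.map_tmul, TensorProduct.map_tmul]
    rcases zmod_two_cases (r.deg₁ s) with h0 | h0 <;> rw [h0] at hs ⊢
    · simp [pr_of_mem hs, pr_of_mem_ne hs (by decide : (0 : ZMod 2) ≠ 1)]
    · simp [pr_of_mem hs, pr_of_mem_ne hs (by decide : (1 : ZMod 2) ≠ 0)]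
  · rw [add_left_comm, CharTwo.add_self_eq_zero, add_zero]

end

namespace Double

section Hopf

variable {k : Type*} [Field k]
  {C : Type*} [Ring C] [Algebra k C] [Coalgebra k C] {𝓒 : ZMod 2 → Submodule k C}
  [GradedAlgebra 𝓒] [IsSuperCoalgebra 𝓒] {SC : C →ₗ[k] C}
  {B : Type*} [Ring B] [Algebra k B] [Coalgebra k B] {𝓑 : ZMod 2 → Submodule k B}
  [GradedAlgebra 𝓑] [IsSuperCoalgebra 𝓑] {SB : B →ₗ[k] B}
  {ev : C →ₗ[k] B →ₗ[k] k}

theorem pair_bijective (hC : IsSuperHopf 𝓒 SC) (hSC : Function.Bijective SC)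
    (hB : IsSuperHopf 𝓑 SB) (hev : IsSuperDual 𝓒 𝓑 ev) : Function.Bijective (pair 𝓒 𝓑 ev) :=
  ⟨pair_injective hC hSC hB hev, pair_surjective hC hSC hev⟩

variable (ev) in
/-- The antipode, on the super tensor product. -/
def antipodeAux (hSC : Function.Bijective SC) (SB : B →ₗ[k] B) :
    WithConv (STensor 𝓒 𝓑 →ₗ[k] Double 𝓒 𝓑 ev) :=
  STensor.inr 𝓒 𝓑 (toConv (inB 𝓒 𝓑 ev ∘ₗ SB)) *
    STensor.inl 𝓒 𝓑 (toConv (inC 𝓒 𝓑 ev ∘ₗ IsSuperHopf.invAntipode SC hSC))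

/-- The antipode of the super-double. -/
def antipode (hp : Function.Bijective (pair 𝓒 𝓑 ev)) (hSC : Function.Bijective SC)
    (SB : B →ₗ[k] B) : Double 𝓒 𝓑 ev →ₗ[k] Double 𝓒 𝓑 ev :=
  (antipodeAux ev hSC SB).ofConv ∘ₗ (STensor.of 𝓒 𝓑).toLinearMap ∘ₗ
    (LinearEquiv.ofBijective _ hp).symm.toLinearMap

theorem antipode_pair (hp : Function.Bijective (pair 𝓒 𝓑 ev)) (hSC : Function.Bijective SC)
    (SB : B →ₗ[k] B) (x : C ⊗[k] B) : antipode hp hSC SB (pair 𝓒 𝓑 ev x) =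
      antipodeAux ev hSC SB (STensor.of 𝓒 𝓑 x) := by
  have h : (LinearEquiv.ofBijective _ hp).symm (pair 𝓒 𝓑 ev x) = x :=
    (LinearEquiv.ofBijective _ hp).symm_apply_apply x
  change (antipodeAux ev hSC SB).ofConv (STensor.of 𝓒 𝓑
    ((LinearEquiv.ofBijective _ hp).symm (pair 𝓒 𝓑 ev x))) = _
  rw [h]

variable [GradedAlgebra (grading 𝓒 𝓑 ev)] [Coalgebra k (Double 𝓒 𝓑 ev)]

theorem map_pr_comul (hC : IsSuperHopf 𝓒 SC) (hB : IsSuperHopf 𝓑 SB)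
    (P : STensor 𝓒 𝓑 →ₗc[k] Double 𝓒 𝓑 ev)
    (hP : ∀ x, P (STensor.of 𝓒 𝓑 x) = pair 𝓒 𝓑 ev x)
    {i : ZMod 2} {x : Double 𝓒 𝓑 ev} (hx : x ∈ grading 𝓒 𝓑 ev i) :
    TensorProduct.map (pr (grading 𝓒 𝓑 ev) 0) (pr (grading 𝓒 𝓑 ev) i)
        (Coalgebra.comul (R := k) x) +
      TensorProduct.map (pr (grading 𝓒 𝓑 ev) 1) (pr (grading 𝓒 𝓑 ev) (i + 1))
        (Coalgebra.comul (R := k) x) = Coalgebra.comul (R := k) x := by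
  induction hx using Submodule.span_induction with
  | mem x h =>
    obtain ⟨j, l, c, b, hc, hb, rfl, rfl⟩ := h
    obtain ⟨t, ht⟩ := hC.comul_graded j c hc
    obtain ⟨r, hr⟩ := hB.comul_graded l b hb
    rw [← pair_tmul, comul_pair P hP, ← t.eq, ← r.eq]
    simp only [TensorProduct.tmul_sum, TensorProduct.sum_tmul, map_sum]
    rw [← Finset.sum_add_distrib]
    refine Finset.sum_congr rfl fun s _ => ?_
    rw [← Finset.sum_add_distrib]
    refine Finset.sum_congr rfl fun u _ => ?_
    rw [shuffle_of_mem _ (t.snd_mem _) (r.fst_mem _)]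
    simp only [map_smul, ← smul_add]
    congr 1
    rw [TensorProduct.map_tmul (pair 𝓒 𝓑 ev) (pair 𝓒 𝓑 ev)]
    refine map_pr_tmul ?_ (inC_mul_inB_mem (t.fst_mem _) (r.fst_mem _))
      (inC_mul_inB_mem (t.snd_mem _) (r.snd_mem _))
    rw [← ht u, ← hr s]
    abel
  | zero => simp
  | add x y _ _ hx hy =>
    simp only [map_add]
    nth_rewrite 3 [← hx]
    nth_rewrite 3 [← hy]
    abel
  | smul a x _ hx =>
    simp only [map_smul]
    rw [← smul_add, hx]

theorem antipode_mem (hC : IsSuperHopf 𝓒 SC) (hB : IsSuperHopf 𝓑 SB) (hSC : Function.Bijective SC)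
    (hp : Function.Bijective (pair 𝓒 𝓑 ev)) {i : ZMod 2} {x : Double 𝓒 𝓑 ev}
    (hx : x ∈ grading 𝓒 𝓑 ev i) : antipode hp hSC SB x ∈ grading 𝓒 𝓑 ev i := by
  induction hx using Submodule.span_induction with
  | mem x h =>
    obtain ⟨j, l, c, b, hc, hb, rfl, rfl⟩ := h
    rw [← pair_tmul, antipode_pair, antipodeAux, STensor.inr_mul_inl _ _ hc hb]
    refine Submodule.smul_mem _ _ ?_
    rw [add_comm]
    exact SetLike.GradedMul.mul_mem (inB_mem (hB.antipode_graded _ _ hb))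
      (inC_mem (hC.invAntipode_mem hSC hc))
  | zero => rw [map_zero]; exact zero_mem _
  | add x y _ _ hx hy => rw [map_add]; exact add_mem hx hy
  | smul a x _ hx => rw [map_smul]; exact Submodule.smul_mem _ _ hx

theorem convPull_antipode (hSC : Function.Bijective SC) (P : STensor 𝓒 𝓑 →ₗc[k] Double 𝓒 𝓑 ev)
    (hP : ∀ x, P (STensor.of 𝓒 𝓑 x) = pair 𝓒 𝓑 ev x)
    (hp : Function.Bijective (pair 𝓒 𝓑 ev)) :
    convPull P (toConv (antipode hp hSC SB)) = antipodeAux ev hSC SB :=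
  STensor.conv_ext fun i j c _ b _ => by
    change antipode hp hSC SB (P (STensor.of 𝓒 𝓑 (c ⊗ₜ b))) = _
    rw [hP, antipode_pair]

theorem convPull_id (P : STensor 𝓒 𝓑 →ₗc[k] Double 𝓒 𝓑 ev)
    (hP : ∀ x, P (STensor.of 𝓒 𝓑 x) = pair 𝓒 𝓑 ev x) : convPull P (toConv LinearMap.id) =
      STensor.inl 𝓒 𝓑 (toConv (inC 𝓒 𝓑 ev)) *
    STensor.inr 𝓒 𝓑 (toConv (inBHom 𝓒 𝓑 ev).toLinearMap) :=
  STensor.conv_ext fun i j c _ b _ => by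
    change P (STensor.of 𝓒 𝓑 (c ⊗ₜ b)) = _
    rw [hP, pair_eq]

theorem convPull_injective (P : STensor 𝓒 𝓑 →ₗc[k] Double 𝓒 𝓑 ev)
    (hP : ∀ x, P (STensor.of 𝓒 𝓑 x) = pair 𝓒 𝓑 ev x)
    (hp : Function.Bijective (pair 𝓒 𝓑 ev)) :
    Function.Injective (convPull (A := Double 𝓒 𝓑 ev) P) := fun f g h =>
  ofConv_injective (LinearMap.ext fun x => by
    obtain ⟨w, rfl⟩ := hp.2 x
    have := congrArg (fun F => F.ofConv (STensor.of 𝓒 𝓑 w)) h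
    change f (P _) = g (P _) at this
    rwa [hP] at this)

theorem isSuperHopf (hC : IsSuperHopf 𝓒 SC) (hB : IsSuperHopf 𝓑 SB)
    (hev : IsSuperDual 𝓒 𝓑 ev) (hSC : Function.Bijective SC)
    (P : STensor 𝓒 𝓑 →ₗc[k] Double 𝓒 𝓑 ev)
    (hP : ∀ x, P (STensor.of 𝓒 𝓑 x) = pair 𝓒 𝓑 ev x)
    (hp : Function.Bijective (pair 𝓒 𝓑 ev)) :
    IsSuperHopf (grading 𝓒 𝓑 ev) (antipode hp hSC SB) where
  comul_graded i b hb := exists_superRepr (map_pr_comul hC hB P hP hb)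
  counit_graded b hb := by
    induction hb using Submodule.span_induction with
    | mem x h =>
      obtain ⟨j, l, c, b, hc, hb, hjl, rfl⟩ := h
      rw [counit_eq hC hB hev P hP hp.2, map_mul, counitHom_inC, counitHom_inB]
      rcases zmod_two_cases j with rfl | rfl
      · rw [zero_add] at hjl
        rw [hB.counit_graded b (hjl ▸ hb), mul_zero]
      · rw [hC.counit_graded c hc, zero_mul]
    | zero => rw [map_zero]
    | add x y _ _ hx hy => rw [map_add, hx, hy, add_zero]
    | smul a x _ hx => rw [map_smul, hx, smul_zero]
  comul_one := by
    exact (of_comul hC hB hev P hP hp.2 1).trans (map_one (comulHom hC hB hev))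
  comul_mul a b := by
    rw [of_comul hC hB hev P hP hp.2, of_comul hC hB hev P hP hp.2, of_comul hC hB hev P hP hp.2,
      map_mul]
  counit_one := by rw [counit_eq hC hB hev P hP hp.2, map_one]
  counit_mul a b := by
    rw [counit_eq hC hB hev P hP hp.2, counit_eq hC hB hev P hP hp.2,
      counit_eq hC hB hev P hP hp.2, map_mul]
  antipode_graded i b hb := antipode_mem hC hB hSC hp hb
  antipode_left := by
    -- Pulled back along `P`, the identity is `U * V` and the antipode is `V⁻¹ * U⁻¹`, with `U`
    -- inverted through `S⁻¹` on `C` and `V` through the antipode of `B`; the product cancels from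
    -- the middle.
    have h : toConv (antipode hp hSC SB) * toConv LinearMap.id = 1 := by
      apply convPull_injective P hP hp
      rw [map_mul, map_one, convPull_antipode hSC P hP hp, convPull_id P hP, antipodeAux, mul_assoc,
        ← mul_assoc (STensor.inl 𝓒 𝓑 _), ← map_mul,
        (isAntiHom_inC 𝓒 𝓑 ev).invAntipode_conv hC hSC, map_one, one_mul, ← map_mul]
      have := antipode_conv_algHom hB (inBHom 𝓒 𝓑 ev)
      exact (congrArg _ this).trans (map_one _)
    exact congrArg ofConv h
  antipode_right := by
    have h : toConv LinearMap.id * toConv (antipode hp hSC SB) = 1 := by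
      apply convPull_injective P hP hp
      have h' : STensor.inr 𝓒 𝓑 (toConv (inBHom 𝓒 𝓑 ev).toLinearMap) *
          STensor.inr 𝓒 𝓑 (toConv (inB 𝓒 𝓑 ev ∘ₗ SB)) = 1 := by
        rw [← map_mul]
        exact (congrArg _ (algHom_conv_antipode hB (inBHom 𝓒 𝓑 ev))).trans (map_one _)
      rw [map_mul, map_one, convPull_antipode hSC P hP hp, convPull_id P hP, antipodeAux, mul_assoc,
        ← mul_assoc (STensor.inr 𝓒 𝓑 _), h', one_mul, ← map_mul,
        (isAntiHom_inC 𝓒 𝓑 ev).conv_invAntipode hC hSC, map_one]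
    exact congrArg ofConv h

end Hopf

section

variable {k : Type*} [Field k]
  {C : Type*} [Ring C] [Algebra k C] [Coalgebra k C] {𝓒 : ZMod 2 → Submodule k C}
  [GradedAlgebra 𝓒] [IsSuperCoalgebra 𝓒] {SC : C →ₗ[k] C}
  {B : Type*} [Ring B] [Algebra k B] [Coalgebra k B] {𝓑 : ZMod 2 → Submodule k B}
  [GradedAlgebra 𝓑] [IsSuperCoalgebra 𝓑] {SB : B →ₗ[k] B}
  {ev : C →ₗ[k] B →ₗ[k] k} [GradedAlgebra (grading 𝓒 𝓑 ev)]

/-- The linear equivalence `c ⊗ b ↦ c b`, on the super tensor product. -/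
def pairEquiv (hp : Function.Bijective (pair 𝓒 𝓑 ev)) : STensor 𝓒 𝓑 ≃ₗ[k] Double 𝓒 𝓑 ev :=
  (STensor.of 𝓒 𝓑).symm.trans (LinearEquiv.ofBijective _ hp)

theorem isCoproduct (hC : IsSuperHopf 𝓒 SC) (hSC : Function.Bijective SC) (hB : IsSuperHopf 𝓑 SB)
    (hev : IsSuperDual 𝓒 𝓑 ev) (hp : Function.Bijective (pair 𝓒 𝓑 ev)) :
    letI := coalgebraOfEquiv (pairEquiv hp)
    IsCoproduct 𝓒 𝓑 ev :=
  letI := coalgebraOfEquiv (pairEquiv hp)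
  let P := coalgHomOfEquiv (pairEquiv hp)
  have hP : ∀ x, P (STensor.of 𝓒 𝓑 x) = pair 𝓒 𝓑 ev x := fun _ => rfl
  have hC1 : inC 𝓒 𝓑 ev 1 = 1 := (isAntiHom_inC 𝓒 𝓑 ev).map_one
  { isSuperHopf := ⟨antipode hp hSC SB, isSuperHopf hC hB hev hSC P hP hp⟩
    pair_bijective := hp
    inC_injective := fun x y h => by
      have h1 : pair 𝓒 𝓑 ev (x ⊗ₜ 1) = pair 𝓒 𝓑 ev (y ⊗ₜ 1) := by rw [pair_tmul, pair_tmul, h]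
      -- The counit of `B` provides a retraction of `c ↦ c ⊗ 1`.
      have h2 := congrArg ((TensorProduct.rid k C).toLinearMap ∘ₗ
        LinearMap.lTensor C Coalgebra.counit) (hp.1 h1)
      simpa [hB.counit_one] using h2
    inB_injective := fun x y h => by
      have h1 : pair 𝓒 𝓑 ev (1 ⊗ₜ x) = pair 𝓒 𝓑 ev (1 ⊗ₜ y) := by rw [pair_tmul, pair_tmul, h]
      have h2 := congrArg ((TensorProduct.lid k B).toLinearMap ∘ₗ
        LinearMap.rTensor B Coalgebra.counit) (hp.1 h1)
      simpa [hC.counit_one] using h2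
    comul_B := fun b => (GradedTensorProduct.of k (grading 𝓒 𝓑 ev) (grading 𝓒 𝓑 ev)).injective
      ((of_comul hC hB hev P hP hp.2 _).trans (comulHom_inB hC hB hev b))
    comul_C := fun c => (GradedTensorProduct.of k (grading 𝓒 𝓑 ev) (grading 𝓒 𝓑 ev)).injective
      ((of_comul hC hB hev P hP hp.2 _).trans (comulHom_inC hC hB hev c))
    counit_B := fun b => (counit_eq hC hB hev P hP hp.2 _).trans (counitHom_inB hC hB hev b)
    counit_C := fun c => (counit_eq hC hB hev P hP hp.2 _).trans (counitHom_inC hC hB hev c) }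

end

end Double

/-! ### The group algebra -/

section GroupAlgebra

variable {k : Type*} [Field k]

theorem Zh.linear_ext {N : Type*} [AddCommGroup N] [Module k N] {f g : Zh k →ₗ[k] N}
    (h : ∀ i, f (gp k i) = g (gp k i)) : f = g :=
  AddMonoidAlgebra.lhom_ext' fun i => LinearMap.ext_ring (h i)

variable (k) in
theorem gp_zero : gp k 0 = 1 := rfl

variable (k) in
theorem gp_mul_gp (i j : ZMod 2) : gp k i * gp k j = gp k (i + j) := by
  rw [gp, gp, AddMonoidAlgebra.single_mul_single, one_mul, gp]

theorem Zh.algHom_ext {A : Type*} [Ring A] [Algebra k A] {f g : Zh k →ₐ[k] A}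
    (h : f (gp k 1) = g (gp k 1)) : f = g := by
  apply AlgHom.toLinearMap_injective
  refine Zh.linear_ext fun i => ?_
  rcases zmod_two_cases i with rfl | rfl
  · rw [gp_zero]; exact (map_one f).trans (map_one g).symm
  · exact h

@[simp] theorem comul_gp (i : ZMod 2) :
    Coalgebra.comul (R := k) (gp k i) = gp k i ⊗ₜ[k] gp k i := by
  simp [gp]

@[simp] theorem counit_gp (i : ZMod 2) : Coalgebra.counit (R := k) (gp k i) = 1 := by
  simp [gp]

variable (k) in
/-- The automorphism `g^j ↦ (-1)^{ij} g^j`. -/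
def Zh.signHom (i : ZMod 2) : Zh k →ₐ[k] Zh k :=
  AddMonoidAlgebra.lift k (Zh k) (ZMod 2)
    { toFun := fun j => sgn k (i * j.toAdd) • gp k j.toAdd
      map_one' := by simp [gp_zero]
      map_mul' := fun a b => by
        rw [toAdd_mul, mul_add, sgn_add, smul_mul_smul_comm, gp_mul_gp] }

@[simp] theorem Zh.signHom_gp (i j : ZMod 2) : Zh.signHom k i (gp k j) = sgn k (i * j) • gp k j := by
  rw [Zh.signHom, gp, AddMonoidAlgebra.lift_single, one_smul]
  rfl

variable (k) in
/-- The action of the group algebra by sign automorphisms. -/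
def Zh.signAction : Zh k →ₐ[k] Module.End k (Zh k) :=
  AddMonoidAlgebra.lift k (Module.End k (Zh k)) (ZMod 2)
    { toFun := fun i => (Zh.signHom k i.toAdd).toLinearMap
      map_one' := Zh.linear_ext fun i => by simp
      map_mul' := fun a b => Zh.linear_ext fun i => by
        rw [Module.End.mul_apply]
        simp only [AlgHom.toLinearMap_apply, Zh.signHom_gp, map_smul, smul_smul, toAdd_mul]
        rw [mul_comm (sgn k _), ← sgn_add, ← add_mul] }

@[simp] theorem Zh.signAction_gp_gp (i j : ZMod 2) :
    Zh.signAction k (gp k i) (gp k j) = sgn k (i * j) • gp k j := by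
  rw [Zh.signAction, gp, AddMonoidAlgebra.lift_single, one_smul]
  exact Zh.signHom_gp i j

end GroupAlgebra

/-! ### The algebra of the bosonisation -/

section Bosonisation

variable {k : Type*} [Field k] {D : Type*} [Ring D] [Algebra k D] (𝓓 : ZMod 2 → Submodule k D)

section

variable [GradedAlgebra 𝓓]

/-- The coaction `x ↦ x ⊗ g^{|x|}`. -/
def coact : D →ₐ[k] D ⊗[k] Zh k :=
  have h : ∀ i, ∀ x ∈ 𝓓 i, ((TensorProduct.mk k D (Zh k)).flip (gp k 0) ∘ₗ pr 𝓓 0 +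
      (TensorProduct.mk k D (Zh k)).flip (gp k 1) ∘ₗ pr 𝓓 1) x = x ⊗ₜ gp k i := fun i x hx => by
    rcases zmod_two_cases i with rfl | rfl
    · simp [pr_of_mem hx, pr_of_mem_ne hx (by decide : (0 : ZMod 2) ≠ 1)]
    · simp [pr_of_mem hx, pr_of_mem_ne hx (by decide : (1 : ZMod 2) ≠ 0)]
  AlgHom.ofLinearMap ((TensorProduct.mk k D (Zh k)).flip (gp k 0) ∘ₗ pr 𝓓 0 +
      (TensorProduct.mk k D (Zh k)).flip (gp k 1) ∘ₗ pr 𝓓 1)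
    (by rw [h 0 1 (SetLike.GradedOne.one_mem)]; rfl)
    (by
      -- Multiplicativity as an equality of bilinear maps can be tested on homogeneous elements.
      rw [LinearMap.map_mul_iff]
      refine homogeneous_ext 𝓓 fun i x hx => homogeneous_ext 𝓓 fun j y hy => ?_
      simp only [LinearMap.compr₂_apply, LinearMap.compl₂_apply, LinearMap.comp_apply (LinearMap.mul k _),
        LinearMap.mul_apply']
      rw [h _ _ (SetLike.GradedMul.mul_mem hx hy), h _ _ hx, h _ _ hy,
        Algebra.TensorProduct.tmul_mul_tmul, gp_mul_gp])

variable {𝓓} in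
theorem coact_of_mem {i : ZMod 2} {x : D} (hx : x ∈ 𝓓 i) : coact 𝓓 x = x ⊗ₜ gp k i := by
  change (TensorProduct.mk k D (Zh k)).flip (gp k 0) (pr 𝓓 0 x) +
      (TensorProduct.mk k D (Zh k)).flip (gp k 1) (pr 𝓓 1 x) = _
  rcases zmod_two_cases i with rfl | rfl
  · simp [pr_of_mem hx, pr_of_mem_ne hx (by decide : (0 : ZMod 2) ≠ 1)]
  · simp [pr_of_mem hx, pr_of_mem_ne hx (by decide : (1 : ZMod 2) ≠ 0)]

end

namespace Bos

/-- The projection from the free algebra. -/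
def mk : TensorAlgebra k (Zh k × D) →ₐ[k] Bos 𝓓 := RingQuot.mkAlgHom k (BosRel 𝓓)

theorem mk_surjective : Function.Surjective (mk 𝓓) := RingQuot.mkAlgHom_surjective k (BosRel 𝓓)

variable {𝓓} in
theorem mk_rel {x y : TensorAlgebra k (Zh k × D)} (h : BosRel 𝓓 x y) : mk 𝓓 x = mk 𝓓 y :=
  RingQuot.mkAlgHom_rel k h

/-- The inclusion of the group algebra, as an algebra map. -/
def inHHom : Zh k →ₐ[k] Bos 𝓓 :=
  AlgHom.ofLinearMap (inH 𝓓) ((mk_rel BosRel.oneH).trans (map_one _))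
    fun a b => (mk_rel (BosRel.mulH a b)).symm.trans (map_mul _ _ _)

/-- The inclusion of the superalgebra, as an algebra map. -/
def inDHom : D →ₐ[k] Bos 𝓓 :=
  AlgHom.ofLinearMap (inD 𝓓) ((mk_rel BosRel.oneD).trans (map_one _))
    fun a b => (mk_rel (BosRel.mulD a b)).symm.trans (map_mul _ _ _)

@[simp] theorem inHHom_apply (h : Zh k) : inHHom 𝓓 h = inH 𝓓 h := rfl

@[simp] theorem inDHom_apply (x : D) : inDHom 𝓓 x = inD 𝓓 x := rfl

theorem inH_one : inH 𝓓 1 = 1 := map_one (inHHom 𝓓)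

theorem inD_one : inD 𝓓 1 = 1 := map_one (inDHom 𝓓)

theorem inH_mul (x y : Zh k) : inH 𝓓 (x * y) = inH 𝓓 x * inH 𝓓 y := map_mul (inHHom 𝓓) x y

theorem inD_mul (x y : D) : inD 𝓓 (x * y) = inD 𝓓 x * inD 𝓓 y := map_mul (inDHom 𝓓) x y

variable {𝓓} in
theorem inD_mul_inH {i : ZMod 2} {x : D} (hx : x ∈ 𝓓 i) (j : ZMod 2) :
    inD 𝓓 x * inH 𝓓 (gp k j) = sgn k (i * j) • (inH 𝓓 (gp k j) * inD 𝓓 x) := by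
  rcases zmod_two_cases j with rfl | rfl
  · rw [gp_zero, inH_one, mul_one, one_mul, mul_zero, sgn_zero, one_smul]
  · have h := mk_rel (BosRel.act i x hx)
    rw [unit_smul k, map_mul, map_smul, map_mul] at h
    rw [mul_one]
    exact h

theorem pair_tmul (h : Zh k) (x : D) : pair 𝓓 (h ⊗ₜ x) = inH 𝓓 h * inD 𝓓 x := rfl

variable {𝓓} {A : Type*} [Ring A] [Algebra k A]

/-- The universal property of the bosonisation. -/
def lift (u : Zh k →ₐ[k] A) (v : D →ₐ[k] A)
    (h : ∀ i, ∀ x ∈ 𝓓 i, v x * u (gp k 1) = sgn k i • (u (gp k 1) * v x)) : Bos 𝓓 →ₐ[k] A :=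
  RingQuot.liftAlgHom k ⟨TensorAlgebra.lift k (u.toLinearMap.coprod v.toLinearMap), by
    have hu : ∀ c, TensorAlgebra.lift k (u.toLinearMap.coprod v.toLinearMap) (bgenH k D c) = u c :=
      fun c => by simp [bgenH]
    have hv : ∀ b, TensorAlgebra.lift k (u.toLinearMap.coprod v.toLinearMap) (bgenD k D b) = v b :=
      fun b => by simp [bgenD]
    intro x y hxy
    induction hxy with
    | oneH => rw [hu, map_one, map_one]
    | mulH a b => rw [map_mul, hu, hu, hu, map_mul]
    | oneD => rw [hv, map_one, map_one]
    | mulD a b => rw [map_mul, hv, hv, hv, map_mul]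
    | act i x hx => rw [unit_smul k, map_mul, map_smul, map_mul, hu, hv, h i x hx]⟩

@[simp] theorem lift_inH (u : Zh k →ₐ[k] A) (v : D →ₐ[k] A)
    (h : ∀ i, ∀ x ∈ 𝓓 i, v x * u (gp k 1) = sgn k i • (u (gp k 1) * v x)) (c : Zh k) :
    lift u v h (inH 𝓓 c) = u c := by
  change RingQuot.liftAlgHom k _ (RingQuot.mkAlgHom k _ (bgenH k D c)) = u c
  rw [RingQuot.liftAlgHom_mkAlgHom_apply]
  simp [bgenH]

@[simp] theorem lift_inD (u : Zh k →ₐ[k] A) (v : D →ₐ[k] A)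
    (h : ∀ i, ∀ x ∈ 𝓓 i, v x * u (gp k 1) = sgn k i • (u (gp k 1) * v x)) (x : D) :
    lift u v h (inD 𝓓 x) = v x := by
  change RingQuot.liftAlgHom k _ (RingQuot.mkAlgHom k _ (bgenD k D x)) = v x
  rw [RingQuot.liftAlgHom_mkAlgHom_apply]
  simp [bgenD]

theorem algHom_ext {f g : Bos 𝓓 →ₐ[k] A} (hg : f (inH 𝓓 (gp k 1)) = g (inH 𝓓 (gp k 1)))
    (hx : ∀ x, f (inD 𝓓 x) = g (inD 𝓓 x)) : f = g := by
  have hH : f.comp (inHHom 𝓓) = g.comp (inHHom 𝓓) := Zh.algHom_ext hg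
  apply RingQuot.ringQuot_ext'
  apply TensorAlgebra.hom_ext
  apply LinearMap.prod_ext
  · exact LinearMap.ext fun c => AlgHom.congr_fun hH c
  · exact LinearMap.ext hx

variable [GradedAlgebra 𝓓]

variable (𝓓) in
-- The range contains `1` and absorbs left multiplication by the generators, `x g^j = ± g^j x` doing
-- the reordering.
theorem pair_surjective : Function.Surjective (pair 𝓓) := by
  set R := LinearMap.range (pair 𝓓) with hR
  have hHl : ∀ h, ∀ x ∈ R, inH 𝓓 h * x ∈ R := by
    rintro h _ ⟨x, rfl⟩
    induction x with
    | zero => rw [map_zero, mul_zero]; exact zero_mem _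
    | add x y hx hy => rw [map_add, mul_add]; exact add_mem hx hy
    | tmul h' x =>
      rw [pair_tmul, ← mul_assoc, ← inH_mul]
      exact ⟨_, pair_tmul _ _ _⟩
  have hDl : ∀ y, ∀ x ∈ R, inD 𝓓 y * x ∈ R := by
    rintro y _ ⟨x, rfl⟩
    induction x with
    | zero => rw [map_zero, mul_zero]; exact zero_mem _
    | add x y hx hy => rw [map_add, mul_add]; exact add_mem hx hy
    | tmul h x =>
      have h1 : ∀ i j, inD 𝓓 (pr 𝓓 i y) * (inH 𝓓 (gp k j) * inD 𝓓 x) ∈ R := fun i j => by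
        rw [← mul_assoc, inD_mul_inH (pr_mem _ _ _), smul_mul_assoc, mul_assoc, ← inD_mul]
        exact Submodule.smul_mem _ _ ⟨_, pair_tmul _ _ _⟩
      have h2 : ∀ j, inD 𝓓 y * (inH 𝓓 (gp k j) * inD 𝓓 x) ∈ R := fun j => by
        rw [← pr_add_pr 𝓓 y, map_add, add_mul]
        exact add_mem (h1 _ _) (h1 _ _)
      rw [pair_tmul]
      induction h using AddMonoidAlgebra.induction_linear with
      | zero => rw [map_zero, zero_mul, mul_zero]; exact zero_mem _
      | add a b ha hb => rw [map_add, add_mul, mul_add]; exact add_mem ha hb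
      | single i a =>
        have : (AddMonoidAlgebra.single i a : Zh k) = a • gp k i := by simp [gp]
        rw [this, map_smul, smul_mul_assoc, mul_smul_comm]
        exact Submodule.smul_mem _ _ (h2 i)
  have h1 : (1 : Bos 𝓓) ∈ R := ⟨1 ⊗ₜ 1, by rw [pair_tmul, inH_one, inD_one, mul_one]⟩
  have key : ∀ z : TensorAlgebra k (Zh k × D), ∀ x ∈ R, mk 𝓓 z * x ∈ R := by
    intro z
    induction z using TensorAlgebra.induction with
    | algebraMap r =>
      intro x hx
      rw [AlgHom.commutes, Algebra.algebraMap_eq_smul_one, smul_mul_assoc, one_mul]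
      exact Submodule.smul_mem _ _ hx
    | ι p =>
      intro x hx
      have : TensorAlgebra.ι k p = bgenH k D p.1 + bgenD k D p.2 := by
        simp [bgenH, bgenD, ← map_add]
      rw [this, map_add, add_mul]
      exact add_mem (hHl p.1 x hx) (hDl p.2 x hx)
    | mul a b ha hb =>
      intro x hx
      rw [map_mul, mul_assoc]
      exact ha _ (hb _ hx)
    | add a b ha hb =>
      intro x hx
      rw [map_add, add_mul]
      exact add_mem (ha _ hx) (hb _ hx)
  intro x
  obtain ⟨z, rfl⟩ := mk_surjective 𝓓 x
  have := key z 1 h1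
  rwa [mul_one] at this

variable (𝓓) in
/-- A faithful representation of the bosonisation. -/
def rep : Bos 𝓓 →ₐ[k] D ⊗[k] Module.End k (Zh k) :=
  lift (Algebra.TensorProduct.includeRight.comp (Algebra.lmul k (Zh k)))
    ((Algebra.TensorProduct.map (AlgHom.id k D) (Zh.signAction k)).comp (coact 𝓓))
    fun i x hx => by
      -- The operator `g^j ↦ (-1)^{ij} g^j` and multiplication by `g` commute up to `(-1)^i`, the
      -- relation required between `x` of degree `i` and `g`.
      have h : Zh.signAction k (gp k i) * Algebra.lmul k (Zh k) (gp k 1) =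
          sgn k i • (Algebra.lmul k (Zh k) (gp k 1) * Zh.signAction k (gp k i)) :=
        Zh.linear_ext fun j => by
          simp [gp_mul_gp, mul_add, sgn_add, smul_smul]
      rw [Algebra.coe_lmul_eq_mul] at h
      simp [coact_of_mem hx, h]

variable (𝓓) in
-- The sign operators fix `1`, so evaluating the representation of `h x` at `1` in the second factor
-- returns `x ⊗ h`.
theorem pair_injective : Function.Injective (pair 𝓓) := by
  have h : ∀ w, (TensorProduct.comm k D (Zh k)).toLinearMap (LinearMap.lTensor D
      (LinearMap.applyₗ (1 : Zh k)) (rep 𝓓 (pair 𝓓 w))) = w := fun w => by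
    induction w with
    | zero => simp
    | add x y hx hy => simp only [map_add, hx, hy]
    | tmul h x =>
      have h1 : ∀ i, ∀ y ∈ 𝓓 i, (TensorProduct.comm k D (Zh k)).toLinearMap (LinearMap.lTensor D
          (LinearMap.applyₗ (1 : Zh k)) (rep 𝓓 (pair 𝓓 (h ⊗ₜ y)))) = h ⊗ₜ y := fun i y hy => by
        have h2 : Zh.signAction k (gp k i) 1 = 1 := by
          rw [← gp_zero, Zh.signAction_gp_gp, mul_zero, sgn_zero, one_smul]
        rw [pair_tmul, map_mul, rep, lift_inH, lift_inD]
        simp [coact_of_mem hy, h2]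
      rw [← pr_add_pr 𝓓 x]
      simp only [TensorProduct.tmul_add, map_add, h1 _ _ (pr_mem 𝓓 _ _)]
  exact fun x y hxy => by rw [← h x, ← h y, hxy]

end Bos

end Bosonisation

/-! ### The Hopf algebra structure of the bosonisation -/

namespace Bos

section Coproduct

variable {k : Type*} [Field k] {D : Type*} [Ring D] [Algebra k D] {𝓓 : ZMod 2 → Submodule k D}
  [GradedAlgebra 𝓓]

theorem linear_ext {N : Type*} [AddCommGroup N] [Module k N] {f g : Bos 𝓓 →ₗ[k] N}
    (h : ∀ j i, ∀ x ∈ 𝓓 i, f (inH 𝓓 (gp k j) * inD 𝓓 x) = g (inH 𝓓 (gp k j) * inD 𝓓 x)) :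
    f = g := by
  have h1 : f ∘ₗ pair 𝓓 = g ∘ₗ pair 𝓓 := by
    apply TensorProduct.ext
    refine Zh.linear_ext fun j => homogeneous_ext 𝓓 fun i x hx => ?_
    exact h j i x hx
  ext y
  obtain ⟨w, rfl⟩ := pair_surjective 𝓓 y
  exact LinearMap.congr_fun h1 w

variable (𝓓) in
/-- The algebra map `x ↦ x ⊗ g^{|x|}`. -/
def coactHom : D →ₐ[k] Bos 𝓓 ⊗[k] Bos 𝓓 :=
  (Algebra.TensorProduct.map (inDHom 𝓓) (inHHom 𝓓)).comp (coact 𝓓)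

theorem coactHom_of_mem {i : ZMod 2} {x : D} (hx : x ∈ 𝓓 i) :
    coactHom 𝓓 x = inD 𝓓 x ⊗ₜ inH 𝓓 (gp k i) := by
  simp [coactHom, coact_of_mem hx]

/-- The power `g^{|a|}` in the second leg commutes with `b` up to `(-1)^{|a||b|}`. Thus an ordinary
tensor product reproduces the super sign rule, which is the purpose of bosonisation. -/
theorem coactHom_comm ⦃i j : ZMod 2⦄ (a : 𝓓 i) (b : 𝓓 j) :
    coactHom 𝓓 a * (Algebra.TensorProduct.includeRight (R := k) (A := Bos 𝓓)).comp (inDHom 𝓓) b =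
      (-1 : ℤˣ) ^ (j * i) •
        ((Algebra.TensorProduct.includeRight (R := k) (A := Bos 𝓓)).comp (inDHom 𝓓) b *
          coactHom 𝓓 a) := by
  rw [unit_smul k, coactHom_of_mem a.2]
  simp only [AlgHom.comp_apply, Algebra.TensorProduct.includeRight_apply, inDHom_apply,
    Algebra.TensorProduct.tmul_mul_tmul, one_mul, mul_one]
  rw [inD_mul_inH b.2, TensorProduct.tmul_smul, smul_smul, sgn_mul_self, one_smul]

variable (𝓓) in
/-- The algebra map `x ⊗ y ↦ x ⊗ g^{|x|} y`, on the super tensor square. -/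
def boson : (𝓓 ᵍ⊗[k] 𝓓) →ₐ[k] Bos 𝓓 ⊗[k] Bos 𝓓 :=
  GradedTensorProduct.lift 𝓓 𝓓 (coactHom 𝓓) (Algebra.TensorProduct.includeRight.comp (inDHom 𝓓))
    coactHom_comm

variable (𝓓) in
/-- The linear map `x ⊗ y ↦ x ⊗ g^{|x|} y`. -/
def bosonLin : D ⊗[k] D →ₗ[k] Bos 𝓓 ⊗[k] Bos 𝓓 :=
  (boson 𝓓).toLinearMap ∘ₗ (GradedTensorProduct.of k 𝓓 𝓓).toLinearMap

theorem bosonLin_of_mem {i : ZMod 2} {x : D} (hx : x ∈ 𝓓 i) (y : D) :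
    bosonLin 𝓓 (x ⊗ₜ y) = inD 𝓓 x ⊗ₜ (inH 𝓓 (gp k i) * inD 𝓓 y) := by
  have h : bosonLin 𝓓 (x ⊗ₜ y) = coactHom 𝓓 x * (1 ⊗ₜ inD 𝓓 y) :=
    GradedTensorProduct.lift_tmul 𝓓 𝓓 _ _ coactHom_comm x y
  rw [h, coactHom_of_mem hx, Algebra.TensorProduct.tmul_mul_tmul, mul_one]

variable (𝓓) in
theorem tensor_linear_ext {N : Type*} [AddCommGroup N] [Module k N] {f g : D ⊗[k] D →ₗ[k] N}
    (h : ∀ i, ∀ x ∈ 𝓓 i, ∀ j, ∀ y ∈ 𝓓 j, f (x ⊗ₜ y) = g (x ⊗ₜ y)) : f = g := by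
  apply TensorProduct.ext
  exact homogeneous_ext 𝓓 fun i x hx => homogeneous_ext 𝓓 fun j y hy => h i x hx j y hy

variable [Coalgebra k D] {S : D →ₗ[k] D}

theorem bosonLin_comul {x : D} (r : SuperRepr 𝓓 x) : bosonLin 𝓓 (Coalgebra.comul (R := k) x) =
    ∑ s, inD 𝓓 (r.fst s) ⊗ₜ (inH 𝓓 (gp k (r.deg₁ s)) * inD 𝓓 (r.snd s)) := by
  rw [r.map_comul]
  exact Finset.sum_congr rfl fun s _ => bosonLin_of_mem (r.fst_mem s) _

/-- The coproduct on the superalgebra, as an algebra map. -/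
def comulD (hD : IsSuperHopf 𝓓 S) : D →ₐ[k] Bos 𝓓 ⊗[k] Bos 𝓓 :=
  AlgHom.ofLinearMap (bosonLin 𝓓 ∘ₗ Coalgebra.comul)
    (by
      rw [LinearMap.comp_apply, hD.comul_one, bosonLin_of_mem SetLike.GradedOne.one_mem, gp_zero,
        inH_one, inD_one, mul_one]
      rfl)
    (fun a b => by
      exact (congrArg (boson 𝓓) (hD.comul_mul a b)).trans (map_mul (boson 𝓓) _ _))

theorem comulD_apply (hD : IsSuperHopf 𝓓 S) (x : D) :
    comulD hD x = bosonLin 𝓓 (Coalgebra.comul (R := k) x) := rfl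

/-- The coproduct, as an algebra map. -/
def comulHom (hD : IsSuperHopf 𝓓 S) : Bos 𝓓 →ₐ[k] Bos 𝓓 ⊗[k] Bos 𝓓 :=
  lift ((Algebra.TensorProduct.map (inHHom 𝓓) (inHHom 𝓓)).comp (Bialgebra.comulAlgHom k (Zh k)))
    (comulD hD) fun i x hx => by
      obtain ⟨r, hr⟩ := hD.comul_graded i x hx
      rw [comulD_apply, bosonLin_comul r, Finset.sum_mul, Finset.mul_sum, Finset.smul_sum]
      refine Finset.sum_congr rfl fun s _ => ?_
      simp only [AlgHom.comp_apply, Bialgebra.comulAlgHom_apply, comul_gp,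
        Algebra.TensorProduct.map_tmul, inHHom_apply, Algebra.TensorProduct.tmul_mul_tmul]
      rw [mul_assoc, inD_mul_inH (r.snd_mem s), inD_mul_inH (r.fst_mem s), mul_smul_comm,
        ← mul_assoc, ← mul_assoc, ← inH_mul, ← inH_mul, mul_comm (gp k 1), TensorProduct.smul_tmul_smul,
        ← sgn_add, mul_one, mul_one, hr s]

theorem comulHom_gp (hD : IsSuperHopf 𝓓 S) (i : ZMod 2) :
    comulHom hD (inH 𝓓 (gp k i)) = inH 𝓓 (gp k i) ⊗ₜ inH 𝓓 (gp k i) := by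
  rw [comulHom, lift_inH]
  simp

theorem comulHom_inD (hD : IsSuperHopf 𝓓 S) (x : D) :
    comulHom hD (inD 𝓓 x) = bosonLin 𝓓 (Coalgebra.comul (R := k) x) := by
  rw [comulHom, lift_inD, comulD_apply]

/-- The counit of the superalgebra, as an algebra map. -/
def counitD (hD : IsSuperHopf 𝓓 S) : D →ₐ[k] k :=
  AlgHom.ofLinearMap Coalgebra.counit hD.counit_one hD.counit_mul

@[simp] theorem counitD_apply (hD : IsSuperHopf 𝓓 S) (x : D) :
    counitD hD x = Coalgebra.counit (R := k) x := rfl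

theorem sgn_mul_counit (hD : IsSuperHopf 𝓓 S) {i : ZMod 2} {x : D} (hx : x ∈ 𝓓 i) :
    sgn k i * Coalgebra.counit (R := k) x = Coalgebra.counit (R := k) x := by
  rcases zmod_two_cases i with rfl | rfl
  · simp
  · simp [hD.counit_graded x hx]

theorem counit_smul_gp (hD : IsSuperHopf 𝓓 S) {i : ZMod 2} {x : D} (hx : x ∈ 𝓓 i) :
    Coalgebra.counit (R := k) x • gp k i = Coalgebra.counit (R := k) x • 1 := by
  rcases zmod_two_cases i with rfl | rfl
  · rw [gp_zero]
  · simp [hD.counit_graded x hx]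

/-- The counit, as an algebra map. -/
def counitHom (hD : IsSuperHopf 𝓓 S) : Bos 𝓓 →ₐ[k] k :=
  lift (Bialgebra.counitAlgHom k (Zh k)) (counitD hD) fun i x hx => by
    simp [sgn_mul_counit hD hx]

theorem counitHom_gp (hD : IsSuperHopf 𝓓 S) (i : ZMod 2) :
    counitHom hD (inH 𝓓 (gp k i)) = 1 := by
  rw [counitHom, lift_inH]
  simp

theorem counitHom_inD (hD : IsSuperHopf 𝓓 S) (x : D) :
    counitHom hD (inD 𝓓 x) = Coalgebra.counit (R := k) x := by
  rw [counitHom, lift_inD, counitD_apply]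

/-- The map `x ⊗ y ⊗ z ↦ x ⊗ g^{|x|} y ⊗ g^{|x| + |y|} z`. -/
def boson₃ (hD : IsSuperHopf 𝓓 S) : D ⊗[k] (D ⊗[k] D) →ₗ[k] Bos 𝓓 ⊗[k] (Bos 𝓓 ⊗[k] Bos 𝓓) :=
  LinearMap.lTensor (Bos 𝓓) (LinearMap.mul' k (Bos 𝓓 ⊗[k] Bos 𝓓)) ∘ₗ
    (TensorProduct.assoc k (Bos 𝓓) (Bos 𝓓 ⊗[k] Bos 𝓓) (Bos 𝓓 ⊗[k] Bos 𝓓)).toLinearMap ∘ₗ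
    TensorProduct.map (LinearMap.lTensor (Bos 𝓓) (comulHom hD).toLinearMap ∘ₗ
      (coactHom 𝓓).toLinearMap) (bosonLin 𝓓)

theorem boson₃_of_mem (hD : IsSuperHopf 𝓓 S) {i : ZMod 2} {x : D} (hx : x ∈ 𝓓 i) (w : D ⊗[k] D) :
    boson₃ hD (x ⊗ₜ w) =
      inD 𝓓 x ⊗ₜ (inH 𝓓 (gp k i) ⊗ₜ inH 𝓓 (gp k i) * bosonLin 𝓓 w) := by
  simp [boson₃, coactHom_of_mem hx, comulHom_gp]

/-- Both iterated coproducts factor through `boson₃`, so coassociativity of the bosonisation reduces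
to that of `D`. -/
theorem lTensor_comulHom_bosonLin (hD : IsSuperHopf 𝓓 S) :
    LinearMap.lTensor (Bos 𝓓) (comulHom hD).toLinearMap ∘ₗ bosonLin 𝓓 =
      boson₃ hD ∘ₗ LinearMap.lTensor D Coalgebra.comul :=
  tensor_linear_ext 𝓓 fun i x hx j y _ => by
    simp [bosonLin_of_mem hx, boson₃_of_mem hD hx, comulHom_gp, comulHom_inD]

/-- Gradedness of the coproduct enters here, as `g^{|x|} = g^{|x₁|} g^{|x₂|}`. -/
theorem rTensor_comulHom_bosonLin (hD : IsSuperHopf 𝓓 S) :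
    (TensorProduct.assoc k (Bos 𝓓) (Bos 𝓓) (Bos 𝓓)).toLinearMap ∘ₗ
      LinearMap.rTensor (Bos 𝓓) (comulHom hD).toLinearMap ∘ₗ bosonLin 𝓓 =
      boson₃ hD ∘ₗ (TensorProduct.assoc k D D D).toLinearMap ∘ₗ
        LinearMap.rTensor D Coalgebra.comul :=
  tensor_linear_ext 𝓓 fun i x hx j y _ => by
    obtain ⟨r, hr⟩ := hD.comul_graded i x hx
    simp only [LinearMap.comp_apply, bosonLin_of_mem hx, LinearMap.rTensor_tmul,
      AlgHom.toLinearMap_apply, comulHom_inD, bosonLin_comul r]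
    rw [← r.eq]
    simp only [TensorProduct.sum_tmul, map_sum, LinearEquiv.coe_coe, TensorProduct.assoc_tmul]
    refine Finset.sum_congr rfl fun s _ => ?_
    rw [boson₃_of_mem hD (r.fst_mem s), bosonLin_of_mem (r.snd_mem s),
      Algebra.TensorProduct.tmul_mul_tmul, ← mul_assoc, ← inH_mul, gp_mul_gp, hr s]

theorem rTensor_counitHom_bosonLin (hD : IsSuperHopf 𝓓 S) :
    LinearMap.rTensor (Bos 𝓓) (counitHom hD).toLinearMap ∘ₗ bosonLin 𝓓 =
      LinearMap.lTensor k (inD 𝓓) ∘ₗ LinearMap.rTensor D Coalgebra.counit :=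
  tensor_linear_ext 𝓓 fun i x hx j y _ => by
    simp only [LinearMap.comp_apply, bosonLin_of_mem hx, LinearMap.rTensor_tmul,
      AlgHom.toLinearMap_apply, counitHom_inD, LinearMap.lTensor_tmul]
    rcases zmod_two_cases i with rfl | rfl
    · rw [gp_zero, inH_one, one_mul]
    · simp [hD.counit_graded x hx]

theorem lTensor_counitHom_bosonLin (hD : IsSuperHopf 𝓓 S) :
    LinearMap.lTensor (Bos 𝓓) (counitHom hD).toLinearMap ∘ₗ bosonLin 𝓓 =
      LinearMap.rTensor k (inD 𝓓) ∘ₗ LinearMap.lTensor D Coalgebra.counit :=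
  tensor_linear_ext 𝓓 fun i x hx j y _ => by
    simp [bosonLin_of_mem hx, counitHom_inD, counitHom_gp]

/-- The bialgebra structure of the bosonisation. -/
@[reducible]
def bialgebra (hD : IsSuperHopf 𝓓 S) : Bialgebra k (Bos 𝓓) :=
  Bialgebra.ofAlgHom (comulHom hD) (counitHom hD)
    (algHom_ext (by simp [comulHom_gp]) fun x => by
      have h1 := LinearMap.congr_fun (rTensor_comulHom_bosonLin hD) (Coalgebra.comul (R := k) x)
      have h2 := LinearMap.congr_fun (lTensor_comulHom_bosonLin hD) (Coalgebra.comul (R := k) x)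
      have h3 := congrArg (boson₃ hD) (Coalgebra.coassoc_apply (R := k) x)
      have h4 := h1.trans (h3.trans h2.symm)
      simp only [LinearMap.comp_apply, ← comulHom_inD hD] at h4
      exact h4)
    (algHom_ext (by simp [comulHom_gp, counitHom_gp]) fun x => by
      have h1 := LinearMap.congr_fun (rTensor_counitHom_bosonLin hD) (Coalgebra.comul (R := k) x)
      simp only [LinearMap.comp_apply, ← comulHom_inD hD, Coalgebra.rTensor_counit_comul,
        LinearMap.lTensor_tmul] at h1
      exact h1)
    (algHom_ext (by simp [comulHom_gp, counitHom_gp]) fun x => by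
      have h1 := LinearMap.congr_fun (lTensor_counitHom_bosonLin hD) (Coalgebra.comul (R := k) x)
      simp only [LinearMap.comp_apply, ← comulHom_inD hD, Coalgebra.lTensor_counit_comul,
        LinearMap.rTensor_tmul] at h1
      exact h1)

end Coproduct

end Bos

/-! ### The antipode of the bosonisation -/

namespace Bos

section Antipode

variable {k : Type*} [Field k] {D : Type*} [Ring D] [Algebra k D] {𝓓 : ZMod 2 → Submodule k D}
  [GradedAlgebra 𝓓] [Coalgebra k D] {S : D →ₗ[k] D}

/-- The projection to the group algebra. -/
def toZh (hD : IsSuperHopf 𝓓 S) : Bos 𝓓 →ₐ[k] Zh k :=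
  lift (AlgHom.id k (Zh k)) ((Algebra.ofId k (Zh k)).comp (counitD hD)) fun i x hx => by
    simp only [AlgHom.comp_apply, counitD_apply, AlgHom.id_apply, Algebra.ofId_apply]
    rw [← Algebra.commutes, ← Algebra.smul_def, smul_smul, sgn_mul_counit hD hx]

theorem toZh_gp (hD : IsSuperHopf 𝓓 S) (i : ZMod 2) : toZh hD (inH 𝓓 (gp k i)) = gp k i := by
  rw [toZh, lift_inH]
  rfl

theorem toZh_inD (hD : IsSuperHopf 𝓓 S) (x : D) :
    toZh hD (inD 𝓓 x) = Coalgebra.counit (R := k) x • 1 := by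
  rw [toZh, lift_inD, Algebra.smul_def, mul_one]
  rfl

variable (𝓓) in
/-- The linear map `h x ↦ ε(h) x`. -/
def toD : Bos 𝓓 →ₗ[k] D :=
  (TensorProduct.lid k D).toLinearMap ∘ₗ LinearMap.rTensor D Coalgebra.counit ∘ₗ
    (LinearEquiv.ofBijective (pair 𝓓) ⟨pair_injective 𝓓, pair_surjective 𝓓⟩).symm.toLinearMap

theorem toD_mul (i : ZMod 2) (x : D) : toD 𝓓 (inH 𝓓 (gp k i) * inD 𝓓 x) = x := by
  have h : (LinearEquiv.ofBijective (pair 𝓓) ⟨pair_injective 𝓓, pair_surjective 𝓓⟩).symm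
      (pair 𝓓 (gp k i ⊗ₜ x)) = gp k i ⊗ₜ x := LinearEquiv.symm_apply_apply _ _
  rw [← pair_tmul, toD, LinearMap.comp_apply, LinearMap.comp_apply, LinearEquiv.coe_coe,
    LinearEquiv.coe_coe, h]
  simp

variable [Coalgebra k (Bos 𝓓)]

/-- The projection to the group algebra is a coalgebra map. -/
def toZhCoalgHom (hD : IsSuperHopf 𝓓 S)
    (hΔ : ∀ x : Bos 𝓓, Coalgebra.comul (R := k) x = comulHom hD x)
    (hε : ∀ x : Bos 𝓓, Coalgebra.counit (R := k) x = counitHom hD x) : Bos 𝓓 →ₗc[k] Zh k where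
  toLinearMap := (toZh hD).toLinearMap
  counit_comp := by
    have h : (Bialgebra.counitAlgHom k (Zh k)).comp (toZh hD) = counitHom hD :=
      algHom_ext (by simp [toZh_gp, counitHom_gp]) fun x => by simp [toZh_inD, counitHom_inD]
    ext x
    exact (AlgHom.congr_fun h x).trans (hε x).symm
  map_comp_comul := by
    have h : (Algebra.TensorProduct.map (toZh hD) (toZh hD)).comp (comulHom hD) =
        (Bialgebra.comulAlgHom k (Zh k)).comp (toZh hD) :=
      algHom_ext (by simp [toZh_gp, comulHom_gp]) fun x => by
        -- The first leg `x₁` projects to `ε(x₁)`, zero in odd degree, so the factor `g^{|x₁|}` of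
        -- the second leg may be replaced by `1`.
        have h1 : TensorProduct.map (toZh hD).toLinearMap (toZh hD).toLinearMap ∘ₗ bosonLin 𝓓 =
            (Algebra.linearMap k (Zh k ⊗[k] Zh k)) ∘ₗ Coalgebra.counit ∘ₗ
              (TensorProduct.lid k D).toLinearMap ∘ₗ LinearMap.rTensor D Coalgebra.counit :=
          tensor_linear_ext 𝓓 fun i x hx j y hy => by
            simp only [LinearMap.comp_apply, bosonLin_of_mem hx, TensorProduct.map_tmul,
              AlgHom.toLinearMap_apply, map_mul, toZh_gp, toZh_inD, mul_smul_comm, mul_one,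
              TensorProduct.smul_tmul, TensorProduct.tmul_smul, LinearMap.rTensor_tmul,
              LinearEquiv.coe_coe, TensorProduct.lid_tmul, map_smul, smul_eq_mul]
            rw [← TensorProduct.tmul_smul, counit_smul_gp hD hx, TensorProduct.tmul_smul, smul_smul,
              mul_comm, Algebra.linearMap_apply, Algebra.algebraMap_eq_smul_one]
            rfl
        have h2 := LinearMap.congr_fun h1 (Coalgebra.comul (R := k) x)
        simp only [LinearMap.comp_apply, ← comulHom_inD hD, Coalgebra.rTensor_counit_comul] at h2
        refine h2.trans ?_
        simp [toZh_inD, Algebra.algebraMap_eq_smul_one]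
    ext x
    have h1 := AlgHom.congr_fun h x
    rw [LinearMap.comp_apply, hΔ]
    exact h1

theorem comul_mul_inD (hD : IsSuperHopf 𝓓 S)
    (hΔ : ∀ x : Bos 𝓓, Coalgebra.comul (R := k) x = comulHom hD x) (i : ZMod 2) (x : D) :
    Coalgebra.comul (R := k) (inH 𝓓 (gp k i) * inD 𝓓 x) =
      inH 𝓓 (gp k i) ⊗ₜ inH 𝓓 (gp k i) * bosonLin 𝓓 (Coalgebra.comul (R := k) x) := by
  rw [hΔ, map_mul, comulHom_gp, comulHom_inD]

/-- The map `h x ↦ ε(h) x` is a coalgebra map. -/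
def toDCoalgHom (hD : IsSuperHopf 𝓓 S)
    (hΔ : ∀ x : Bos 𝓓, Coalgebra.comul (R := k) x = comulHom hD x)
    (hε : ∀ x : Bos 𝓓, Coalgebra.counit (R := k) x = counitHom hD x) : Bos 𝓓 →ₗc[k] D where
  toLinearMap := toD 𝓓
  counit_comp := linear_ext fun j i x _ => by
    rw [hε, map_mul (counitHom hD), counitHom_gp, counitHom_inD, LinearMap.comp_apply, toD_mul, one_mul]
  map_comp_comul := linear_ext fun j i x _ => by
    have h : TensorProduct.map (toD 𝓓) (toD 𝓓) ∘ₗ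
        LinearMap.mulLeft k (inH 𝓓 (gp k j) ⊗ₜ inH 𝓓 (gp k j)) ∘ₗ bosonLin 𝓓 = LinearMap.id :=
      tensor_linear_ext 𝓓 fun i x hx l y _ => by
        simp only [LinearMap.comp_apply, bosonLin_of_mem hx, LinearMap.mulLeft_apply,
          Algebra.TensorProduct.tmul_mul_tmul, ← mul_assoc, ← inH_mul, gp_mul_gp,
          TensorProduct.map_tmul, toD_mul, LinearMap.id_apply]
    rw [LinearMap.comp_apply, LinearMap.comp_apply, comul_mul_inD hD hΔ, toD_mul]
    exact LinearMap.congr_fun h _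

/-- The two factors are pulled back along coalgebra maps to the group algebra and to `D`, both of
which have antipodes. Each factor is therefore invertible, and the antipode of the bosonisation is
the product of the inverses in the opposite order. -/
theorem id_eq_mul (hD : IsSuperHopf 𝓓 S)
    (hΔ : ∀ x : Bos 𝓓, Coalgebra.comul (R := k) x = comulHom hD x)
    (hε : ∀ x : Bos 𝓓, Coalgebra.counit (R := k) x = counitHom hD x) :
    toConv LinearMap.id = convPull (toZhCoalgHom hD hΔ hε) (toConv (inHHom 𝓓).toLinearMap) *
      convPull (toDCoalgHom hD hΔ hε) (toConv (inDHom 𝓓).toLinearMap) := by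
  apply ofConv_injective
  refine linear_ext fun j i x _ => ?_
  have h : LinearMap.mul' k (Bos 𝓓) ∘ₗ TensorProduct.map
      ((inHHom 𝓓).toLinearMap ∘ₗ (toZh hD).toLinearMap) ((inDHom 𝓓).toLinearMap ∘ₗ toD 𝓓) ∘ₗ
        LinearMap.mulLeft k (inH 𝓓 (gp k j) ⊗ₜ inH 𝓓 (gp k j)) ∘ₗ bosonLin 𝓓 =
      LinearMap.mulLeft k (inH 𝓓 (gp k j)) ∘ₗ inD 𝓓 ∘ₗ (TensorProduct.lid k D).toLinearMap ∘ₗ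
        LinearMap.rTensor D Coalgebra.counit :=
    tensor_linear_ext 𝓓 fun i x hx l y _ => by
      simp only [LinearMap.comp_apply, bosonLin_of_mem hx, LinearMap.mulLeft_apply,
        Algebra.TensorProduct.tmul_mul_tmul]
      rw [← mul_assoc, ← inH_mul, gp_mul_gp]
      simp [toD_mul, toZh_gp, toZh_inD]
  have h1 := LinearMap.congr_fun h (Coalgebra.comul (R := k) x)
  simp only [LinearMap.comp_apply, Coalgebra.rTensor_counit_comul, LinearMap.mulLeft_apply,
    LinearEquiv.coe_coe, TensorProduct.lid_tmul, one_smul, ← comul_mul_inD hD hΔ] at h1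
  exact h1.symm

theorem isHopf (hD : IsSuperHopf 𝓓 S)
    (hΔ : ∀ x : Bos 𝓓, Coalgebra.comul (R := k) x = comulHom hD x)
    (hε : ∀ x : Bos 𝓓, Coalgebra.counit (R := k) x = counitHom hD x) : IsHopf k (Bos 𝓓) where
  comul_one := by rw [hΔ, map_one]
  comul_mul a b := by rw [hΔ, hΔ, hΔ, map_mul]
  counit_one := by rw [hε, map_one]
  counit_mul a b := by rw [hε, hε, hε, map_mul]
  exists_antipode := by
    set q := toZhCoalgHom hD hΔ hε
    set p := toDCoalgHom hD hΔ hε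
    have hid := id_eq_mul hD hΔ hε
    have z1 : toConv (HopfAlgebra.antipode k (A := Zh k)) * toConv LinearMap.id = 1 :=
      congrArg toConv (HopfAlgebra.mul_antipode_rTensor_comul (R := k) (A := Zh k))
    have z2 : toConv LinearMap.id * toConv (HopfAlgebra.antipode k (A := Zh k)) = 1 :=
      congrArg toConv (HopfAlgebra.mul_antipode_lTensor_comul (R := k) (A := Zh k))
    have h1 := congrArg (convPull q) (congrArg (convPush _ (inHHom 𝓓)) z1)
    have h2 := congrArg (convPull q) (congrArg (convPush _ (inHHom 𝓓)) z2)
    have h3 := congrArg (convPull p) (antipode_conv_algHom hD (inDHom 𝓓))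
    have h4 := congrArg (convPull p) (algHom_conv_antipode hD (inDHom 𝓓))
    simp only [map_mul, map_one] at h1 h2 h3 h4
    set a' := convPull q (convPush _ (inHHom 𝓓) (toConv (HopfAlgebra.antipode k (A := Zh k))))
    set b' := convPull p (toConv ((inDHom 𝓓).toLinearMap ∘ₗ S))
    change a' * convPull q (toConv (inHHom 𝓓).toLinearMap) = 1 at h1
    change convPull q (toConv (inHHom 𝓓).toLinearMap) * a' = 1 at h2
    refine ⟨(b' * a').ofConv, ?_, ?_⟩
    · have h : b' * a' * toConv LinearMap.id = 1 := by
        rw [hid, mul_assoc, ← mul_assoc a', h1, one_mul, h3]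
      exact congrArg ofConv h
    · have h : toConv LinearMap.id * (b' * a') = 1 := by
        rw [hid, mul_assoc, ← mul_assoc _ b', h4, one_mul, h2]
      exact congrArg ofConv h

theorem isCoproduct (hD : IsSuperHopf 𝓓 S)
    (hΔ : ∀ x : Bos 𝓓, Coalgebra.comul (R := k) x = comulHom hD x)
    (hε : ∀ x : Bos 𝓓, Coalgebra.counit (R := k) x = counitHom hD x) : IsCoproduct 𝓓 where
  isHopf := isHopf hD hΔ hε
  pair_bijective := ⟨pair_injective 𝓓, pair_surjective 𝓓⟩
  comul_g := by rw [hΔ, comulHom_gp]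
  comul_D x r := by rw [hΔ, comulHom_inD, bosonLin_comul r]
  counit_g := by rw [hε, counitHom_gp]
  counit_D x := by rw [hε, counitHom_inD]

end Antipode

end Bos

/-! ### The algebra of the double-bosonisation -/

namespace DBos

section Algebra

variable {k : Type*} [Field k]
  {C : Type*} [Ring C] [Algebra k C] [Coalgebra k C] (𝓒 : ZMod 2 → Submodule k C)
  {B : Type*} [Ring B] [Algebra k B] [Coalgebra k B] (𝓑 : ZMod 2 → Submodule k B)
  (ev : C →ₗ[k] B →ₗ[k] k)

variable {𝓒 𝓑 ev} in
theorem mk_rel {x y : TensorAlgebra k (C × Zh k × B)} (h : DBosRel 𝓒 𝓑 ev x y) :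
    RingQuot.mkAlgHom k (DBosRel 𝓒 𝓑 ev) x = RingQuot.mkAlgHom k (DBosRel 𝓒 𝓑 ev) y :=
  RingQuot.mkAlgHom_rel k h

/-- The inclusion of the group algebra, as an algebra map. -/
def inHHom : Zh k →ₐ[k] DBos 𝓒 𝓑 ev :=
  AlgHom.ofLinearMap (inH 𝓒 𝓑 ev) ((mk_rel DBosRel.oneH).trans (map_one _))
    fun a b => (mk_rel (DBosRel.mulH a b)).symm.trans (map_mul _ _ _)

/-- The inclusion of `B`, as an algebra map. -/
def inBHom : B →ₐ[k] DBos 𝓒 𝓑 ev :=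
  AlgHom.ofLinearMap (inB 𝓒 𝓑 ev) ((mk_rel DBosRel.oneB).trans (map_one _))
    fun a b => (mk_rel (DBosRel.mulB a b)).symm.trans (map_mul _ _ _)

@[simp] theorem inHHom_apply (h : Zh k) : inHHom 𝓒 𝓑 ev h = inH 𝓒 𝓑 ev h := rfl

@[simp] theorem inBHom_apply (b : B) : inBHom 𝓒 𝓑 ev b = inB 𝓒 𝓑 ev b := rfl

theorem inC_one : inC 𝓒 𝓑 ev 1 = 1 := (mk_rel DBosRel.oneC).trans (map_one _)

theorem inC_mul (c d : C) : inC 𝓒 𝓑 ev c * inC 𝓒 𝓑 ev d = inC 𝓒 𝓑 ev (d * c) :=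
  (map_mul (RingQuot.mkAlgHom k (DBosRel 𝓒 𝓑 ev)) _ _).symm.trans (mk_rel (DBosRel.mulC c d))

theorem inH_one : inH 𝓒 𝓑 ev 1 = 1 := map_one (inHHom 𝓒 𝓑 ev)

theorem inH_mul (x y : Zh k) : inH 𝓒 𝓑 ev (x * y) = inH 𝓒 𝓑 ev x * inH 𝓒 𝓑 ev y :=
  map_mul (inHHom 𝓒 𝓑 ev) x y

variable {𝓒 𝓑 ev}

theorem inB_mul_inH {i : ZMod 2} {b : B} (hb : b ∈ 𝓑 i) (j : ZMod 2) :
    inB 𝓒 𝓑 ev b * inH 𝓒 𝓑 ev (gp k j) =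
      sgn k (i * j) • (inH 𝓒 𝓑 ev (gp k j) * inB 𝓒 𝓑 ev b) := by
  rcases zmod_two_cases j with rfl | rfl
  · rw [gp_zero, inH_one, mul_one, one_mul, mul_zero, sgn_zero, one_smul]
  · have h := mk_rel (DBosRel.actB (𝓒 := 𝓒) (ev := ev) i b hb)
    rw [unit_smul k, map_mul, map_smul, map_mul] at h
    rw [mul_one]
    exact h

theorem inC_mul_inH {i : ZMod 2} {c : C} (hc : c ∈ 𝓒 i) (j : ZMod 2) :
    inC 𝓒 𝓑 ev c * inH 𝓒 𝓑 ev (gp k j) =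
      sgn k (i * j) • (inH 𝓒 𝓑 ev (gp k j) * inC 𝓒 𝓑 ev c) := by
  rcases zmod_two_cases j with rfl | rfl
  · rw [gp_zero, inH_one, mul_one, one_mul, mul_zero, sgn_zero, one_smul]
  · have h := mk_rel (DBosRel.actC (𝓑 := 𝓑) (ev := ev) i c hc)
    rw [unit_smul k, map_mul, map_smul, map_mul] at h
    rw [mul_one]
    exact h

theorem cross_in (b : B) (c : C) (r : SuperRepr 𝓑 b) (t : SuperRepr 𝓒 c) :
    ∑ s, ∑ u, ev (t.snd u) (r.snd s) •
        (inB 𝓒 𝓑 ev (r.fst s) * inH 𝓒 𝓑 ev (gp k (t.deg₂ u)) * inC 𝓒 𝓑 ev (t.fst u)) =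
      ∑ s, ∑ u, ev (t.fst u) (r.fst s) •
        (inC 𝓒 𝓑 ev (t.snd u) * inH 𝓒 𝓑 ev (gp k (r.deg₁ s)) * inB 𝓒 𝓑 ev (r.snd s)) := by
  have h := mk_rel (DBosRel.cross (ev := ev) b c r t)
  simp only [map_sum, map_smul, map_mul] at h
  exact h

variable {A : Type*} [Ring A] [Algebra k A]

/-- The universal property of the double-bosonisation. -/
def lift (u : C →ₗ[k] A) (w : Zh k →ₐ[k] A) (v : B →ₐ[k] A) (hu1 : u 1 = 1)
    (hu : ∀ c d, u c * u d = u (d * c))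
    (hv : ∀ i, ∀ b ∈ 𝓑 i, v b * w (gp k 1) = sgn k i • (w (gp k 1) * v b))
    (huw : ∀ i, ∀ c ∈ 𝓒 i, u c * w (gp k 1) = sgn k i • (w (gp k 1) * u c))
    (hx : ∀ (b : B) (c : C) (r : SuperRepr 𝓑 b) (t : SuperRepr 𝓒 c),
      ∑ s, ∑ x, ev (t.snd x) (r.snd s) • (v (r.fst s) * w (gp k (t.deg₂ x)) * u (t.fst x)) =
      ∑ s, ∑ x, ev (t.fst x) (r.fst s) • (u (t.snd x) * w (gp k (r.deg₁ s)) * v (r.snd s))) :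
    DBos 𝓒 𝓑 ev →ₐ[k] A :=
  RingQuot.liftAlgHom k ⟨TensorAlgebra.lift k (u.coprod (w.toLinearMap.coprod v.toLinearMap)), by
    have ec : ∀ c, TensorAlgebra.lift k (u.coprod (w.toLinearMap.coprod v.toLinearMap))
      (genC k C B c) = u c := fun c => by simp [genC]
    have eh : ∀ h, TensorAlgebra.lift k (u.coprod (w.toLinearMap.coprod v.toLinearMap))
      (genH k C B h) = w h := fun h => by simp [genH]
    have eb : ∀ b, TensorAlgebra.lift k (u.coprod (w.toLinearMap.coprod v.toLinearMap))
      (genB k C B b) = v b := fun b => by simp [genB]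
    intro x y hxy
    induction hxy with
    | oneC => rw [ec, hu1, map_one]
    | mulC c d => rw [map_mul, ec, ec, ec, hu]
    | oneH => rw [eh, map_one, map_one]
    | mulH a b => rw [map_mul, eh, eh, eh, map_mul]
    | oneB => rw [eb, map_one, map_one]
    | mulB a b => rw [map_mul, eb, eb, eb, map_mul]
    | actB i b hb => rw [unit_smul k, map_mul, map_smul, map_mul, eb, eh, hv i b hb]
    | actC i c hc => rw [unit_smul k, map_mul, map_smul, map_mul, ec, eh, huw i c hc]
    | cross b c r t =>
      simp only [map_sum, map_smul, map_mul, ec, eh, eb]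
      exact hx b c r t⟩

theorem lift_inC (u : C →ₗ[k] A) (w : Zh k →ₐ[k] A) (v : B →ₐ[k] A) (hu1 : u 1 = 1)
    (hu : ∀ c d, u c * u d = u (d * c))
    (hv : ∀ i, ∀ b ∈ 𝓑 i, v b * w (gp k 1) = sgn k i • (w (gp k 1) * v b))
    (huw : ∀ i, ∀ c ∈ 𝓒 i, u c * w (gp k 1) = sgn k i • (w (gp k 1) * u c))
    (hx : ∀ (b : B) (c : C) (r : SuperRepr 𝓑 b) (t : SuperRepr 𝓒 c),
      ∑ s, ∑ x, ev (t.snd x) (r.snd s) • (v (r.fst s) * w (gp k (t.deg₂ x)) * u (t.fst x)) =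
      ∑ s, ∑ x, ev (t.fst x) (r.fst s) • (u (t.snd x) * w (gp k (r.deg₁ s)) * v (r.snd s)))
    (y : C) : lift u w v hu1 hu hv huw hx (inC 𝓒 𝓑 ev y) = u y := by
  change RingQuot.liftAlgHom k _ (RingQuot.mkAlgHom k _ (genC k C B y)) = u y
  rw [RingQuot.liftAlgHom_mkAlgHom_apply]
  simp [genC]

theorem lift_inH (u : C →ₗ[k] A) (w : Zh k →ₐ[k] A) (v : B →ₐ[k] A) (hu1 : u 1 = 1)
    (hu : ∀ c d, u c * u d = u (d * c))
    (hv : ∀ i, ∀ b ∈ 𝓑 i, v b * w (gp k 1) = sgn k i • (w (gp k 1) * v b))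
    (huw : ∀ i, ∀ c ∈ 𝓒 i, u c * w (gp k 1) = sgn k i • (w (gp k 1) * u c))
    (hx : ∀ (b : B) (c : C) (r : SuperRepr 𝓑 b) (t : SuperRepr 𝓒 c),
      ∑ s, ∑ x, ev (t.snd x) (r.snd s) • (v (r.fst s) * w (gp k (t.deg₂ x)) * u (t.fst x)) =
      ∑ s, ∑ x, ev (t.fst x) (r.fst s) • (u (t.snd x) * w (gp k (r.deg₁ s)) * v (r.snd s)))
    (y : Zh k) : lift u w v hu1 hu hv huw hx (inH 𝓒 𝓑 ev y) = w y := by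
  change RingQuot.liftAlgHom k _ (RingQuot.mkAlgHom k _ (genH k C B y)) = w y
  rw [RingQuot.liftAlgHom_mkAlgHom_apply]
  simp [genH]

theorem lift_inB (u : C →ₗ[k] A) (w : Zh k →ₐ[k] A) (v : B →ₐ[k] A) (hu1 : u 1 = 1)
    (hu : ∀ c d, u c * u d = u (d * c))
    (hv : ∀ i, ∀ b ∈ 𝓑 i, v b * w (gp k 1) = sgn k i • (w (gp k 1) * v b))
    (huw : ∀ i, ∀ c ∈ 𝓒 i, u c * w (gp k 1) = sgn k i • (w (gp k 1) * u c))
    (hx : ∀ (b : B) (c : C) (r : SuperRepr 𝓑 b) (t : SuperRepr 𝓒 c),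
      ∑ s, ∑ x, ev (t.snd x) (r.snd s) • (v (r.fst s) * w (gp k (t.deg₂ x)) * u (t.fst x)) =
      ∑ s, ∑ x, ev (t.fst x) (r.fst s) • (u (t.snd x) * w (gp k (r.deg₁ s)) * v (r.snd s)))
    (y : B) : lift u w v hu1 hu hv huw hx (inB 𝓒 𝓑 ev y) = v y := by
  change RingQuot.liftAlgHom k _ (RingQuot.mkAlgHom k _ (genB k C B y)) = v y
  rw [RingQuot.liftAlgHom_mkAlgHom_apply]
  simp [genB]

theorem algHom_ext {f g : DBos 𝓒 𝓑 ev →ₐ[k] A} (hc : ∀ c, f (inC 𝓒 𝓑 ev c) = g (inC 𝓒 𝓑 ev c))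
    (hg : f (inH 𝓒 𝓑 ev (gp k 1)) = g (inH 𝓒 𝓑 ev (gp k 1)))
    (hb : ∀ b, f (inB 𝓒 𝓑 ev b) = g (inB 𝓒 𝓑 ev b)) : f = g := by
  have hH : f.comp (inHHom 𝓒 𝓑 ev) = g.comp (inHHom 𝓒 𝓑 ev) := Zh.algHom_ext hg
  apply RingQuot.ringQuot_ext'
  apply TensorAlgebra.hom_ext
  apply LinearMap.prod_ext
  · exact LinearMap.ext hc
  · apply LinearMap.prod_ext
    · exact LinearMap.ext fun c => AlgHom.congr_fun hH c
    · exact LinearMap.ext hb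

end Algebra

end DBos

/-! ### The isomorphism with the bosonisation of the super-double -/

section Iso

variable {k : Type*} [Field k] {C : Type*} [Ring C] [Algebra k C]
  (𝓒 : ZMod 2 → Submodule k C) [GradedAlgebra 𝓒] {A : Type*} [Ring A] [Algebra k A]

/-- The map `c ↦ g^{|c|} f(c)`. -/
def gradeTwist (w : Zh k →ₐ[k] A) (f : C →ₗ[k] A) : C →ₗ[k] A :=
  f ∘ₗ pr 𝓒 0 + LinearMap.mulLeft k (w (gp k 1)) ∘ₗ f ∘ₗ pr 𝓒 1

variable {𝓒} in
theorem gradeTwist_of_mem (w : Zh k →ₐ[k] A) (f : C →ₗ[k] A) {i : ZMod 2} {c : C} (hc : c ∈ 𝓒 i) :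
    gradeTwist 𝓒 w f c = w (gp k i) * f c := by
  rcases zmod_two_cases i with rfl | rfl
  · simp [gradeTwist, pr_of_mem hc, pr_of_mem_ne hc (by decide : (0 : ZMod 2) ≠ 1), gp_zero]
  · simp [gradeTwist, pr_of_mem hc, pr_of_mem_ne hc (by decide : (1 : ZMod 2) ≠ 0)]

end Iso

namespace DBos

section Iso

variable {k : Type*} [Field k]
  {C : Type*} [Ring C] [Algebra k C] [Coalgebra k C] {𝓒 : ZMod 2 → Submodule k C}
  [GradedAlgebra 𝓒] [IsSuperCoalgebra 𝓒] {SC : C →ₗ[k] C}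
  {B : Type*} [Ring B] [Algebra k B] [Coalgebra k B] {𝓑 : ZMod 2 → Submodule k B}
  [GradedAlgebra 𝓑] [IsSuperCoalgebra 𝓑]
  {ev : C →ₗ[k] B →ₗ[k] k}

variable (𝓒 𝓑 ev) in
/-- The map `c ↦ g^{|c|} c` to the double-bosonisation. -/
def twC : C →ₗ[k] DBos 𝓒 𝓑 ev := gradeTwist 𝓒 (inHHom 𝓒 𝓑 ev) (inC 𝓒 𝓑 ev)

theorem twC_of_mem {i : ZMod 2} {c : C} (hc : c ∈ 𝓒 i) :
    twC 𝓒 𝓑 ev c = inH 𝓒 𝓑 ev (gp k i) * inC 𝓒 𝓑 ev c := gradeTwist_of_mem _ _ hc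

/-- Moving `g^{|b|}` to the left past `a` costs `(-1)^{|a||b|}`, the difference between the opposite
and the super-opposite product. -/
theorem isAntiHom_twC : IsAntiHom 𝓒 (twC 𝓒 𝓑 ev) where
  map_one := by
    rw [twC_of_mem SetLike.GradedOne.one_mem, gp_zero, inH_one, inC_one, mul_one]
  map_mul i j a ha b hb := by
    rw [twC_of_mem ha, twC_of_mem hb, twC_of_mem (SetLike.GradedMul.mul_mem hb ha), mul_assoc,
      ← mul_assoc (inC 𝓒 𝓑 ev a), inC_mul_inH ha, smul_mul_assoc, mul_smul_comm, mul_assoc,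
      inC_mul, ← mul_assoc, ← inH_mul, gp_mul_gp, add_comm]

/-- Multiplying the cross relation of the double-bosonisation by `g^{|c|}` and collecting powers of
`g` on the left produces the signs of the super-double. On the right-hand side this uses `|b₁| =
|c₁|`, valid where the pairing does not vanish. -/
theorem cross_twC (hC : IsSuperHopf 𝓒 SC) (hev : IsSuperDual 𝓒 𝓑 ev) :
    Double.Cross (𝓒 := 𝓒) (𝓑 := 𝓑) ev (twC 𝓒 𝓑 ev) (inBHom 𝓒 𝓑 ev) := by
  refine STensor.conv_ext fun i j c hc b hb => ?_
  obtain ⟨t, ht⟩ := hC.comul_graded i c hc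
  obtain ⟨r⟩ := SuperRepr.nonempty 𝓑 b
  rw [cross_left hC.comul_graded ev _ _ hc t r, cross_right hev _ _ t r]
  have h := congrArg (inH 𝓒 𝓑 ev (gp k i) * ·) (cross_in (ev := ev) b c r t)
  simp only [Finset.mul_sum, mul_smul_comm] at h
  convert h using 1
  · refine Finset.sum_congr rfl fun s _ => Finset.sum_congr rfl fun x _ => ?_
    rw [unit_smul k, smul_comm, AlgHom.toLinearMap_apply, inBHom_apply, twC_of_mem (t.fst_mem x),
      ← mul_assoc, inB_mul_inH (r.fst_mem s), inB_mul_inH (r.fst_mem s), ← ht x]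
    simp only [smul_mul_assoc, mul_smul_comm, smul_smul, ← mul_assoc, ← inH_mul, gp_mul_gp,
      ← sgn_add]
    congr 2
    · congr 1
      exact (by decide : ∀ a b c : ZMod 2, a * (b + c) + a * b = a * c) _ _ _
    · rw [add_assoc, CharTwo.add_self_eq_zero, add_zero]
  · refine Finset.sum_congr rfl fun s _ => Finset.sum_congr rfl fun x _ => ?_
    by_cases h1 : t.deg₁ x = r.deg₁ s
    · rw [unit_smul k, smul_comm, AlgHom.toLinearMap_apply, inBHom_apply, twC_of_mem (t.snd_mem x),
        inC_mul_inH (t.snd_mem x), ← h1, ← ht x]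
      simp only [smul_mul_assoc, mul_smul_comm, ← mul_assoc, ← inH_mul, gp_mul_gp]
      rw [mul_comm (t.deg₂ x), add_right_comm, CharTwo.add_self_eq_zero, zero_add]
    · rw [hev.apply_eq_zero (t.fst_mem x) (r.fst_mem s) h1, zero_smul, zero_smul, smul_zero]

section

variable [GradedAlgebra (Double.grading 𝓒 𝓑 ev)]

/-- The map from the super-double to the double-bosonisation. -/
def ofDouble (hC : IsSuperHopf 𝓒 SC) (hev : IsSuperDual 𝓒 𝓑 ev) :
    Double 𝓒 𝓑 ev →ₐ[k] DBos 𝓒 𝓑 ev :=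
  Double.lift hC hev (twC 𝓒 𝓑 ev) (inBHom 𝓒 𝓑 ev) isAntiHom_twC (cross_twC hC hev)

theorem ofDouble_inC (hC : IsSuperHopf 𝓒 SC) (hev : IsSuperDual 𝓒 𝓑 ev) {i : ZMod 2} {c : C}
    (hc : c ∈ 𝓒 i) : ofDouble hC hev (Double.inC 𝓒 𝓑 ev c) =
      inH 𝓒 𝓑 ev (gp k i) * inC 𝓒 𝓑 ev c :=
  (Double.lift_inC _ _ _ _ _ _ _).trans (twC_of_mem hc)

theorem ofDouble_inB (hC : IsSuperHopf 𝓒 SC) (hev : IsSuperDual 𝓒 𝓑 ev) (b : B) :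
    ofDouble hC hev (Double.inB 𝓒 𝓑 ev b) = inB 𝓒 𝓑 ev b :=
  Double.lift_inB _ _ _ _ _ _ _

/-- The map from the bosonisation of the super-double to the double-bosonisation. -/
def ofBos (hC : IsSuperHopf 𝓒 SC) (hev : IsSuperDual 𝓒 𝓑 ev) :
    Bos (Double.grading 𝓒 𝓑 ev) →ₐ[k] DBos 𝓒 𝓑 ev :=
  Bos.lift (inHHom 𝓒 𝓑 ev) (ofDouble hC hev) fun i x hx => by
    induction hx using Submodule.span_induction with
    | mem x h =>
      obtain ⟨j, l, c, b, hc, hb, rfl, rfl⟩ := h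
      rw [map_mul, ofDouble_inC hC hev hc, ofDouble_inB, inHHom_apply, mul_assoc,
        inB_mul_inH hb, mul_smul_comm, mul_assoc, ← mul_assoc (inC 𝓒 𝓑 ev c), inC_mul_inH hc,
        smul_mul_assoc, mul_smul_comm, smul_smul, mul_assoc, ← mul_assoc, ← inH_mul,
        mul_assoc (inH 𝓒 𝓑 ev (gp k j)), ← mul_assoc (inH 𝓒 𝓑 ev (gp k 1)), ← inH_mul,
        mul_comm (gp k 1), ← sgn_add, mul_one, mul_one, add_comm]
    | zero => simp
    | add x y _ _ hx hy => rw [map_add, add_mul, hx, hy, mul_add, smul_add]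
    | smul a x _ hx => rw [map_smul, smul_mul_assoc, hx, mul_smul_comm, smul_comm]

theorem ofBos_inH (hC : IsSuperHopf 𝓒 SC) (hev : IsSuperDual 𝓒 𝓑 ev) (h : Zh k) :
    ofBos hC hev (Bos.inH _ h) = inH 𝓒 𝓑 ev h :=
  Bos.lift_inH _ _ _ _

theorem ofBos_inC (hC : IsSuperHopf 𝓒 SC) (hev : IsSuperDual 𝓒 𝓑 ev) {i : ZMod 2} {c : C}
    (hc : c ∈ 𝓒 i) : ofBos hC hev (Bos.inD _ (Double.inC 𝓒 𝓑 ev c)) =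
      inH 𝓒 𝓑 ev (gp k i) * inC 𝓒 𝓑 ev c :=
  (Bos.lift_inD _ _ _ _).trans (ofDouble_inC hC hev hc)

theorem ofBos_inB (hC : IsSuperHopf 𝓒 SC) (hev : IsSuperDual 𝓒 𝓑 ev) (b : B) :
    ofBos hC hev (Bos.inD _ (Double.inB 𝓒 𝓑 ev b)) = inB 𝓒 𝓑 ev b :=
  (Bos.lift_inD _ _ _ _).trans (ofDouble_inB hC hev b)

variable (𝓒 𝓑 ev) in
/-- The map `c ↦ g^{|c|} c` to the bosonisation. -/
def bosC : C →ₗ[k] Bos (Double.grading 𝓒 𝓑 ev) :=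
  gradeTwist 𝓒 (Bos.inHHom _) (Bos.inD _ ∘ₗ Double.inC 𝓒 𝓑 ev)

theorem bosC_of_mem {i : ZMod 2} {c : C} (hc : c ∈ 𝓒 i) :
    bosC 𝓒 𝓑 ev c = Bos.inH _ (gp k i) * Bos.inD _ (Double.inC 𝓒 𝓑 ev c) :=
  gradeTwist_of_mem _ _ hc

theorem bosC_one : bosC 𝓒 𝓑 ev 1 = 1 := by
  rw [bosC_of_mem SetLike.GradedOne.one_mem, gp_zero, Bos.inH_one,
    (Double.isAntiHom_inC 𝓒 𝓑 ev).map_one, Bos.inD_one, mul_one]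

/-- The sign from moving `g^{|d|}` past `c` cancels the sign of the super-opposite product. -/
theorem bosC_mul (c d : C) : bosC 𝓒 𝓑 ev c * bosC 𝓒 𝓑 ev d = bosC 𝓒 𝓑 ev (d * c) := by
  have h : (LinearMap.mul k _).compl₁₂ (bosC 𝓒 𝓑 ev) (bosC 𝓒 𝓑 ev) =
      ((LinearMap.mul k C).compr₂ (bosC 𝓒 𝓑 ev)).flip :=
    homogeneous_ext 𝓒 fun i c hc => homogeneous_ext 𝓒 fun j d hd => by
      simp only [LinearMap.compl₁₂_apply, LinearMap.flip_apply, LinearMap.compr₂_apply,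
        LinearMap.mul_apply']
      rw [bosC_of_mem hc, bosC_of_mem hd, bosC_of_mem (SetLike.GradedMul.mul_mem hd hc), mul_assoc,
        ← mul_assoc (Bos.inD _ _), Bos.inD_mul_inH (Double.inC_mem hc), smul_mul_assoc,
        mul_smul_comm, mul_assoc, ← Bos.inD_mul, (Double.isAntiHom_inC 𝓒 𝓑 ev).map_mul _ _ _ hc _ hd,
        map_smul, mul_smul_comm, mul_smul_comm, smul_smul, sgn_mul_self, one_smul, ← mul_assoc,
        ← Bos.inH_mul, gp_mul_gp, add_comm]
  exact LinearMap.congr_fun (LinearMap.congr_fun h c) d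

theorem bosC_mul_inH {i : ZMod 2} {c : C} (hc : c ∈ 𝓒 i) (j : ZMod 2) :
    bosC 𝓒 𝓑 ev c * Bos.inH _ (gp k j) = sgn k (i * j) • (Bos.inH _ (gp k j) * bosC 𝓒 𝓑 ev c) := by
  rw [bosC_of_mem hc, mul_assoc, Bos.inD_mul_inH (Double.inC_mem hc), mul_smul_comm, ← mul_assoc,
    ← mul_assoc, ← Bos.inH_mul, ← Bos.inH_mul, mul_comm (gp k i)]

/-- The converse of `cross_twC`: the relation of the super-double is multiplied by `g^{|c|}`.
Rewriting `g^{|c|}` as `g^{|c₁|} g^{|c₂|}` needs every term of `t` to have total degree `|c|`. -/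
theorem cross_bosC_of_mem (hev : IsSuperDual 𝓒 𝓑 ev) {b : B}
    (r : SuperRepr 𝓑 b) {i : ZMod 2} {c : C} (hc : c ∈ 𝓒 i) (t : SuperRepr 𝓒 c)
    (ht : ∀ s, t.deg₁ s + t.deg₂ s = i) :
    ∑ s, ∑ x, ev (t.snd x) (r.snd s) • (Bos.inD _ (Double.inB 𝓒 𝓑 ev (r.fst s)) *
        Bos.inH _ (gp k (t.deg₂ x)) * bosC 𝓒 𝓑 ev (t.fst x)) =
      ∑ s, ∑ x, ev (t.fst x) (r.fst s) • (bosC 𝓒 𝓑 ev (t.snd x) * Bos.inH _ (gp k (r.deg₁ s)) *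
        Bos.inD _ (Double.inB 𝓒 𝓑 ev (r.snd s))) := by
  have h := congrArg (fun y => Bos.inH _ (gp k i) * Bos.inD (Double.grading 𝓒 𝓑 ev) y)
    (Double.mk_rel (DoubleRel.cross (ev := ev) b i c hc r t))
  simp only [unit_smul k, map_sum, map_smul, map_mul, Finset.mul_sum, mul_smul_comm] at h
  convert h using 1
  · refine Finset.sum_congr rfl fun s _ => Finset.sum_congr rfl fun x _ => ?_
    have e : Bos.inD (Double.grading 𝓒 𝓑 ev) (Double.mk 𝓒 𝓑 ev (dgenB k C B (r.fst s)) *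
        Double.mk 𝓒 𝓑 ev (dgenC k C B (t.fst x))) = Bos.inD _ (Double.inB 𝓒 𝓑 ev (r.fst s)) *
          Bos.inD _ (Double.inC 𝓒 𝓑 ev (t.fst x)) := Bos.inD_mul _ _ _
    rw [e, bosC_of_mem (t.fst_mem x), smul_comm, ← mul_assoc, mul_assoc (Bos.inD _ _),
      ← Bos.inH_mul, gp_mul_gp, add_comm (t.deg₂ x), ht x,
      Bos.inD_mul_inH (Double.inB_mem (r.fst_mem s)), smul_mul_assoc, mul_assoc]
  · refine Finset.sum_congr rfl fun s _ => Finset.sum_congr rfl fun x _ => ?_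
    by_cases h1 : t.deg₁ x = r.deg₁ s
    · have e : Bos.inD (Double.grading 𝓒 𝓑 ev) (Double.mk 𝓒 𝓑 ev (dgenC k C B (t.snd x)) *
          Double.mk 𝓒 𝓑 ev (dgenB k C B (r.snd s))) = Bos.inD _ (Double.inC 𝓒 𝓑 ev (t.snd x)) *
            Bos.inD _ (Double.inB 𝓒 𝓑 ev (r.snd s)) := Bos.inD_mul _ _ _
      rw [e, bosC_of_mem (t.snd_mem x), smul_comm, mul_assoc (Bos.inH _ _),
        Bos.inD_mul_inH (Double.inC_mem (t.snd_mem x)), mul_smul_comm, ← mul_assoc, ← Bos.inH_mul,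
        gp_mul_gp, ← h1, add_comm (t.deg₂ x), ht x, smul_mul_assoc, mul_assoc,
        mul_comm (t.deg₂ x)]
    · rw [hev.apply_eq_zero (t.fst_mem x) (r.fst_mem s) h1, zero_smul, zero_smul, smul_zero]

end

end Iso

end DBos

/-! ### The inverse isomorphism -/

namespace DBos

section Inverse

variable {k : Type*} [Field k]
  {C : Type*} [Ring C] [Algebra k C] [Coalgebra k C] {𝓒 : ZMod 2 → Submodule k C}
  [GradedAlgebra 𝓒] [IsSuperCoalgebra 𝓒] {SC : C →ₗ[k] C}
  {B : Type*} [Ring B] [Algebra k B] [Coalgebra k B] {𝓑 : ZMod 2 → Submodule k B}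
  [GradedAlgebra 𝓑] [IsSuperCoalgebra 𝓑]
  {ev : C →ₗ[k] B →ₗ[k] k} [GradedAlgebra (Double.grading 𝓒 𝓑 ev)]

/-- The double-bosonisation imposes its relation for all `c` and all presentations. Both sides are
linear in `Δ c`, through `F` and `G`, so one presentation of total degree `|c|` for each homogeneous
`c` is enough. -/
theorem cross_bosC (hC : IsSuperHopf 𝓒 SC) (hev : IsSuperDual 𝓒 𝓑 ev) (b : B) (c : C)
    (r : SuperRepr 𝓑 b) (t : SuperRepr 𝓒 c) :
    ∑ s, ∑ x, ev (t.snd x) (r.snd s) • (Bos.inD _ (Double.inB 𝓒 𝓑 ev (r.fst s)) *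
        Bos.inH _ (gp k (t.deg₂ x)) * bosC 𝓒 𝓑 ev (t.fst x)) =
      ∑ s, ∑ x, ev (t.fst x) (r.fst s) • (bosC 𝓒 𝓑 ev (t.snd x) * Bos.inH _ (gp k (r.deg₁ s)) *
        Bos.inD _ (Double.inB 𝓒 𝓑 ev (r.snd s))) := by
  let H := Bos (Double.grading 𝓒 𝓑 ev)
  -- Summing over the projections `pr 𝓒 i` makes the dependence of `g^{|c₂|}` on `c₂` linear.
  let F : C ⊗[k] C →ₗ[k] H := ∑ s, ∑ i, (TensorProduct.rid k H).toLinearMap ∘ₗ TensorProduct.map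
    (LinearMap.mulLeft k (Bos.inD _ (Double.inB 𝓒 𝓑 ev (r.fst s)) * Bos.inH _ (gp k i)) ∘ₗ
      bosC 𝓒 𝓑 ev) (ev.flip (r.snd s) ∘ₗ pr 𝓒 i)
  let G : C ⊗[k] C →ₗ[k] H := ∑ s, (TensorProduct.lid k H).toLinearMap ∘ₗ TensorProduct.map
    (ev.flip (r.fst s)) (LinearMap.mulRight k (Bos.inH _ (gp k (r.deg₁ s)) *
      Bos.inD _ (Double.inB 𝓒 𝓑 ev (r.snd s))) ∘ₗ bosC 𝓒 𝓑 ev)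
  have hF : ∀ x j, ∀ y ∈ 𝓒 j, F (x ⊗ₜ y) = ∑ s, ev y (r.snd s) •
      (Bos.inD _ (Double.inB 𝓒 𝓑 ev (r.fst s)) * Bos.inH _ (gp k j) * bosC 𝓒 𝓑 ev x) := by
    intro x j y hy
    simp only [F, LinearMap.sum_apply, sum_zmod_two]
    refine Finset.sum_congr rfl fun s _ => ?_
    rcases zmod_two_cases j with rfl | rfl
    · simp [mul_assoc, pr_of_mem hy, pr_of_mem_ne hy (by decide : (0 : ZMod 2) ≠ 1)]
    · simp [mul_assoc, pr_of_mem hy, pr_of_mem_ne hy (by decide : (1 : ZMod 2) ≠ 0)]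
  have hG : ∀ x y, G (x ⊗ₜ y) = ∑ s, ev x (r.fst s) • (bosC 𝓒 𝓑 ev y *
      Bos.inH _ (gp k (r.deg₁ s)) * Bos.inD _ (Double.inB 𝓒 𝓑 ev (r.snd s))) := by
    intro x y
    simp [G, mul_assoc]
  have hF' : ∀ {c : C} (t : SuperRepr 𝓒 c), F (Coalgebra.comul c) = ∑ s, ∑ x,
      ev (t.snd x) (r.snd s) • (Bos.inD _ (Double.inB 𝓒 𝓑 ev (r.fst s)) *
        Bos.inH _ (gp k (t.deg₂ x)) * bosC 𝓒 𝓑 ev (t.fst x)) := fun t => by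
    rw [t.map_comul, Finset.sum_comm]
    exact Finset.sum_congr rfl fun x _ => hF _ _ _ (t.snd_mem x)
  have hG' : ∀ {c : C} (t : SuperRepr 𝓒 c), G (Coalgebra.comul c) = ∑ s, ∑ x,
      ev (t.fst x) (r.fst s) • (bosC 𝓒 𝓑 ev (t.snd x) * Bos.inH _ (gp k (r.deg₁ s)) *
        Bos.inD _ (Double.inB 𝓒 𝓑 ev (r.snd s))) := fun t => by
    rw [t.map_comul, Finset.sum_comm]
    exact Finset.sum_congr rfl fun x _ => hG _ _
  rw [← hF' t, ← hG' t]
  have h : F ∘ₗ Coalgebra.comul = G ∘ₗ Coalgebra.comul := homogeneous_ext 𝓒 fun i c hc => by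
    obtain ⟨t, ht⟩ := hC.comul_graded i c hc
    rw [LinearMap.comp_apply, LinearMap.comp_apply, hF' t, hG' t, cross_bosC_of_mem hev r hc t ht]
  exact LinearMap.congr_fun h c

/-- The map from the double-bosonisation to the bosonisation of the super-double. -/
def toBos (hC : IsSuperHopf 𝓒 SC) (hev : IsSuperDual 𝓒 𝓑 ev) :
    DBos 𝓒 𝓑 ev →ₐ[k] Bos (Double.grading 𝓒 𝓑 ev) :=
  lift (bosC 𝓒 𝓑 ev) (Bos.inHHom _) ((Bos.inDHom _).comp (Double.inBHom 𝓒 𝓑 ev)) bosC_one bosC_mul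
    (fun i b hb => by
      have h := Bos.inD_mul_inH (Double.inB_mem (𝓒 := 𝓒) (ev := ev) hb) 1
      rwa [mul_one] at h)
    (fun i c hc => by
      have h := bosC_mul_inH (𝓑 := 𝓑) (ev := ev) hc 1
      rwa [mul_one] at h)
    (cross_bosC hC hev)

theorem toBos_inC (hC : IsSuperHopf 𝓒 SC) (hev : IsSuperDual 𝓒 𝓑 ev) (c : C) :
    toBos hC hev (inC 𝓒 𝓑 ev c) = bosC 𝓒 𝓑 ev c :=
  lift_inC _ _ _ _ _ _ _ _ _

theorem toBos_inH (hC : IsSuperHopf 𝓒 SC) (hev : IsSuperDual 𝓒 𝓑 ev) (h : Zh k) :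
    toBos hC hev (inH 𝓒 𝓑 ev h) = Bos.inH _ h :=
  lift_inH _ _ _ _ _ _ _ _ _

theorem toBos_inB (hC : IsSuperHopf 𝓒 SC) (hev : IsSuperDual 𝓒 𝓑 ev) (b : B) :
    toBos hC hev (inB 𝓒 𝓑 ev b) = Bos.inD _ (Double.inB 𝓒 𝓑 ev b) :=
  lift_inB _ _ _ _ _ _ _ _ _

theorem gp_mul_self_mul (i : ZMod 2) (x : DBos 𝓒 𝓑 ev) :
    inH 𝓒 𝓑 ev (gp k i) * (inH 𝓒 𝓑 ev (gp k i) * x) = x := by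
  rw [← mul_assoc, ← inH_mul, gp_mul_gp, CharTwo.add_self_eq_zero, gp_zero, inH_one, one_mul]

theorem _root_.SuperDouble.Bos.gp_mul_self_mul {D : Type*} [Ring D] [Algebra k D]
    (𝓓 : ZMod 2 → Submodule k D) (i : ZMod 2) (x : Bos 𝓓) :
    Bos.inH 𝓓 (gp k i) * (Bos.inH 𝓓 (gp k i) * x) = x := by
  rw [← mul_assoc, ← Bos.inH_mul, gp_mul_gp, CharTwo.add_self_eq_zero, gp_zero, Bos.inH_one,
    one_mul]

theorem ofBos_comp_toBos (hC : IsSuperHopf 𝓒 SC) (hev : IsSuperDual 𝓒 𝓑 ev) :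
    (ofBos hC hev).comp (toBos hC hev) = AlgHom.id k _ :=
  algHom_ext (fun c => by
      have h : ((ofBos hC hev).comp (toBos hC hev)).toLinearMap ∘ₗ inC 𝓒 𝓑 ev = inC 𝓒 𝓑 ev :=
        homogeneous_ext 𝓒 fun i c hc => by
          rw [LinearMap.comp_apply, AlgHom.toLinearMap_apply, AlgHom.comp_apply, toBos_inC,
            bosC_of_mem hc, map_mul, ofBos_inH, ofBos_inC hC hev hc, gp_mul_self_mul]
      exact LinearMap.congr_fun h c)
    (by rw [AlgHom.comp_apply, toBos_inH, ofBos_inH, AlgHom.id_apply])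
    (fun b => by rw [AlgHom.comp_apply, toBos_inB, ofBos_inB, AlgHom.id_apply])

theorem toBos_comp_ofBos (hC : IsSuperHopf 𝓒 SC) (hev : IsSuperDual 𝓒 𝓑 ev) :
    (toBos hC hev).comp (ofBos hC hev) = AlgHom.id k _ := by
  refine Bos.algHom_ext (by rw [AlgHom.comp_apply, ofBos_inH, toBos_inH, AlgHom.id_apply]) ?_
  refine AlgHom.congr_fun (φ₁ := ((toBos hC hev).comp (ofBos hC hev)).comp (Bos.inDHom _))
    (φ₂ := Bos.inDHom _) (Double.algHom_ext (fun c => ?_) fun b => ?_)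
  · have h : ((toBos hC hev).comp (ofBos hC hev)).toLinearMap ∘ₗ Bos.inD _ ∘ₗ Double.inC 𝓒 𝓑 ev =
        Bos.inD _ ∘ₗ Double.inC 𝓒 𝓑 ev :=
      homogeneous_ext 𝓒 fun i c hc => by
        rw [LinearMap.comp_apply, LinearMap.comp_apply, AlgHom.toLinearMap_apply, AlgHom.comp_apply,
          ofBos_inC hC hev hc, map_mul, toBos_inH, toBos_inC, bosC_of_mem hc, Bos.gp_mul_self_mul]
    exact LinearMap.congr_fun h c
  · rw [AlgHom.comp_apply, AlgHom.comp_apply, Bos.inDHom_apply, ofBos_inB, toBos_inB]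

/-- The bosonisation of the super-double is the double-bosonisation. -/
def bosEquiv (hC : IsSuperHopf 𝓒 SC) (hev : IsSuperDual 𝓒 𝓑 ev) :
    Bos (Double.grading 𝓒 𝓑 ev) ≃ₐ[k] DBos 𝓒 𝓑 ev :=
  AlgEquiv.ofAlgHom (ofBos hC hev) (toBos hC hev) (ofBos_comp_toBos hC hev)
    (toBos_comp_ofBos hC hev)

end Inverse

end DBos

/-! ### The Hopf algebra structure of the double-bosonisation -/

/-- The image of a homogeneous Sweedler presentation under a graded coalgebra map. -/
def SuperRepr.map {k : Type*} [Field k] {B : Type*} [Ring B] [Algebra k B] [Coalgebra k B]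
    {A : Type*} [Ring A] [Algebra k A] [Coalgebra k A] {𝓑 : ZMod 2 → Submodule k B}
    {𝓐 : ZMod 2 → Submodule k A} {b : B} (r : SuperRepr 𝓑 b) (f : B →ₗ[k] A)
    (hf : ∀ i, ∀ x ∈ 𝓑 i, f x ∈ 𝓐 i)
    (h : Coalgebra.comul (R := k) (f b) = TensorProduct.map f f (Coalgebra.comul (R := k) b)) :
    SuperRepr 𝓐 (f b) where
  n := r.n
  fst s := f (r.fst s)
  snd s := f (r.snd s)
  deg₁ := r.deg₁
  deg₂ := r.deg₂
  fst_mem s := hf _ _ (r.fst_mem s)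
  snd_mem s := hf _ _ (r.snd_mem s)
  eq := by rw [h, ← r.eq, map_sum]; rfl

theorem IsHopf.of_algEquiv {k : Type*} [Field k] {A : Type*} [Ring A] [Algebra k A] [Coalgebra k A]
    {A' : Type*} [Ring A'] [Algebra k A'] [Coalgebra k A'] (h : IsHopf k A) (e : A ≃ₐ[k] A')
    (hΔ : ∀ x, Coalgebra.comul (R := k) (e x) =
      Algebra.TensorProduct.map e.toAlgHom e.toAlgHom (Coalgebra.comul (R := k) x))
    (hε : ∀ x, Coalgebra.counit (R := k) (e x) = Coalgebra.counit (R := k) x) : IsHopf k A' where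
  comul_one := by rw [← map_one e, hΔ, h.comul_one, map_one]
  comul_mul a b := by
    obtain ⟨a, rfl⟩ := e.surjective a
    obtain ⟨b, rfl⟩ := e.surjective b
    rw [← map_mul, hΔ, hΔ, hΔ, h.comul_mul, map_mul]
  counit_one := by rw [← map_one e, hε, h.counit_one]
  counit_mul a b := by
    obtain ⟨a, rfl⟩ := e.surjective a
    obtain ⟨b, rfl⟩ := e.surjective b
    rw [← map_mul, hε, hε, hε, h.counit_mul]
  exists_antipode := by
    obtain ⟨S, hl, hr⟩ := h.exists_antipode
    refine ⟨e.toLinearMap ∘ₗ S ∘ₗ e.symm.toLinearMap, ?_, ?_⟩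
    · ext y
      obtain ⟨x, rfl⟩ := e.surjective y
      have h1 : LinearMap.mul' k A' ∘ₗ TensorProduct.map (e.toLinearMap ∘ₗ S ∘ₗ e.symm.toLinearMap)
          LinearMap.id ∘ₗ (Algebra.TensorProduct.map e.toAlgHom e.toAlgHom).toLinearMap =
          e.toLinearMap ∘ₗ LinearMap.mul' k A ∘ₗ TensorProduct.map S LinearMap.id := by
        ext a b
        simp
      have h2 := (LinearMap.congr_fun h1 (Coalgebra.comul (R := k) x)).trans
        (congrArg e (LinearMap.congr_fun hl x))
      simp only [LinearMap.comp_apply, AlgHom.toLinearMap_apply, ← hΔ] at h2 ⊢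
      rw [h2, hε]
      exact e.commutes _
    · ext y
      obtain ⟨x, rfl⟩ := e.surjective y
      have h1 : LinearMap.mul' k A' ∘ₗ TensorProduct.map LinearMap.id
          (e.toLinearMap ∘ₗ S ∘ₗ e.symm.toLinearMap) ∘ₗ
            (Algebra.TensorProduct.map e.toAlgHom e.toAlgHom).toLinearMap =
          e.toLinearMap ∘ₗ LinearMap.mul' k A ∘ₗ TensorProduct.map LinearMap.id S := by
        ext a b
        simp
      have h2 := (LinearMap.congr_fun h1 (Coalgebra.comul (R := k) x)).trans
        (congrArg e (LinearMap.congr_fun hr x))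
      simp only [LinearMap.comp_apply, AlgHom.toLinearMap_apply, ← hΔ] at h2 ⊢
      rw [h2, hε]
      exact e.commutes _

/-! ### The twist that compares the bases `c h b` and `h c b` -/

section Twist

variable {k : Type*} [Field k] {C : Type*} [AddCommGroup C] [Module k C]
  (𝓒 : ZMod 2 → Submodule k C) [DirectSum.Decomposition 𝓒]

/-- The map `c ⊗ g^j ↦ (-1)^{|c| j} c ⊗ g^{|c| + j}`. -/
def twistZh : C ⊗[k] Zh k →ₗ[k] C ⊗[k] Zh k :=
  ∑ i, TensorProduct.map (pr 𝓒 i) (LinearMap.mulLeft k (gp k i) ∘ₗ (Zh.signHom k i).toLinearMap)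

variable {𝓒} in
theorem twistZh_tmul_gp {i : ZMod 2} {c : C} (hc : c ∈ 𝓒 i) (j : ZMod 2) :
    twistZh 𝓒 (c ⊗ₜ gp k j) = sgn k (i * j) • (c ⊗ₜ gp k (i + j)) := by
  rw [twistZh, LinearMap.sum_apply, sum_zmod_two]
  rcases zmod_two_cases i with rfl | rfl
  · simp [pr_of_mem hc, pr_of_mem_ne hc (by decide : (0 : ZMod 2) ≠ 1), gp_mul_gp]
  · simp [pr_of_mem hc, pr_of_mem_ne hc (by decide : (1 : ZMod 2) ≠ 0), gp_mul_gp]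

theorem tensorZh_ext {N : Type*} [AddCommGroup N] [Module k N] {f g : C ⊗[k] Zh k →ₗ[k] N}
    (h : ∀ i, ∀ c ∈ 𝓒 i, ∀ j, f (c ⊗ₜ gp k j) = g (c ⊗ₜ gp k j)) : f = g :=
  TensorProduct.ext (homogeneous_ext 𝓒 fun i c hc => Zh.linear_ext fun j => h i c hc j)

/-- Applied twice, the twist fixes the power of `g` and leaves the sign `(-1)^{|c|}`, so following
or preceding its square by the parity gives the identity. -/
theorem twistZh_bijective : Function.Bijective (twistZh 𝓒) := by
  have h1 : LinearMap.rTensor (Zh k) (par 𝓒) ∘ₗ twistZh 𝓒 ∘ₗ twistZh 𝓒 = LinearMap.id :=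
    tensorZh_ext 𝓒 fun i c hc j => by
      simp only [LinearMap.comp_apply, twistZh_tmul_gp hc, map_smul, LinearMap.rTensor_tmul,
        par_of_mem hc, ← TensorProduct.smul_tmul', smul_smul, LinearMap.id_apply, ← sgn_add]
      rw [← add_assoc, CharTwo.add_self_eq_zero, zero_add,
        (by decide : ∀ i j : ZMod 2, i * j + i * (i + j) + i = 0), sgn_zero, one_smul]
  have h2 : twistZh 𝓒 ∘ₗ twistZh 𝓒 ∘ₗ LinearMap.rTensor (Zh k) (par 𝓒) = LinearMap.id :=
    tensorZh_ext 𝓒 fun i c hc j => by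
      simp only [LinearMap.comp_apply, twistZh_tmul_gp hc, map_smul, LinearMap.rTensor_tmul,
        par_of_mem hc, ← TensorProduct.smul_tmul', smul_smul, LinearMap.id_apply, ← sgn_add]
      rw [← add_assoc, CharTwo.add_self_eq_zero, zero_add,
        (by decide : ∀ i j : ZMod 2, i + i * j + i * (i + j) = 0), sgn_zero, one_smul]
  exact ⟨Function.LeftInverse.injective (g := LinearMap.rTensor (Zh k) (par 𝓒) ∘ₗ twistZh 𝓒)
      (LinearMap.congr_fun h1),
    Function.RightInverse.surjective (g := twistZh 𝓒 ∘ₗ LinearMap.rTensor (Zh k) (par 𝓒))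
      (LinearMap.congr_fun h2)⟩

end Twist

namespace DBos

section Coproduct

variable {k : Type*} [Field k]
  {C : Type*} [Ring C] [Algebra k C] [Coalgebra k C] {𝓒 : ZMod 2 → Submodule k C}
  [GradedAlgebra 𝓒] [IsSuperCoalgebra 𝓒] {SC : C →ₗ[k] C}
  {B : Type*} [Ring B] [Algebra k B] [Coalgebra k B] {𝓑 : ZMod 2 → Submodule k B}
  [GradedAlgebra 𝓑] [IsSuperCoalgebra 𝓑]
  {ev : C →ₗ[k] B →ₗ[k] k} [GradedAlgebra (Double.grading 𝓒 𝓑 ev)]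

theorem bosEquiv_inH (hC : IsSuperHopf 𝓒 SC) (hev : IsSuperDual 𝓒 𝓑 ev) (h : Zh k) :
    bosEquiv hC hev (Bos.inH _ h) = inH 𝓒 𝓑 ev h :=
  ofBos_inH hC hev h

theorem bosEquiv_inC (hC : IsSuperHopf 𝓒 SC) (hev : IsSuperDual 𝓒 𝓑 ev) {i : ZMod 2} {c : C}
    (hc : c ∈ 𝓒 i) : bosEquiv hC hev (Bos.inD _ (Double.inC 𝓒 𝓑 ev c)) =
      inH 𝓒 𝓑 ev (gp k i) * inC 𝓒 𝓑 ev c :=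
  ofBos_inC hC hev hc

theorem bosEquiv_inB (hC : IsSuperHopf 𝓒 SC) (hev : IsSuperDual 𝓒 𝓑 ev) (b : B) :
    bosEquiv hC hev (Bos.inD _ (Double.inB 𝓒 𝓑 ev b)) = inB 𝓒 𝓑 ev b :=
  ofBos_inB hC hev b

theorem bosEquiv_gp_mul_inC (hC : IsSuperHopf 𝓒 SC) (hev : IsSuperDual 𝓒 𝓑 ev) {i : ZMod 2} {c : C}
    (hc : c ∈ 𝓒 i) : bosEquiv hC hev (Bos.inH _ (gp k i) * Bos.inD _ (Double.inC 𝓒 𝓑 ev c)) =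
      inC 𝓒 𝓑 ev c := by
  rw [map_mul, bosEquiv_inH, bosEquiv_inC hC hev hc, gp_mul_self_mul]

/-- For `|c| = i` one has `c g^j b = (-1)^{ij} g^{i+j} (g^i c) b`, the image under `bosEquiv` of
`(-1)^{ij} g^{i+j} c b`. Hence `triple` is composed of the twist, the bijections `pair` of the
super-double and of the bosonisation, and the isomorphism. -/
theorem triple_bijective (hC : IsSuperHopf 𝓒 SC) (hev : IsSuperDual 𝓒 𝓑 ev)
    (hp : Function.Bijective (Double.pair 𝓒 𝓑 ev)) : Function.Bijective (triple 𝓒 𝓑 ev) := by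
  let E : C ⊗[k] (Zh k ⊗[k] B) ≃ₗ[k] DBos 𝓒 𝓑 ev :=
    (TensorProduct.assoc k C (Zh k) B).symm ≪≫ₗ
    TensorProduct.congr (LinearEquiv.ofBijective (twistZh 𝓒) (twistZh_bijective 𝓒) ≪≫ₗ
      TensorProduct.comm k C (Zh k)) (LinearEquiv.refl k B) ≪≫ₗ
    TensorProduct.assoc k (Zh k) C B ≪≫ₗ
    TensorProduct.congr (LinearEquiv.refl k (Zh k)) (LinearEquiv.ofBijective _ hp) ≪≫ₗ
    LinearEquiv.ofBijective (Bos.pair (Double.grading 𝓒 𝓑 ev))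
      ⟨Bos.pair_injective _, Bos.pair_surjective _⟩ ≪≫ₗ
    (bosEquiv hC hev).toLinearEquiv
  have h : triple 𝓒 𝓑 ev = E.toLinearMap := by
    apply TensorProduct.ext
    refine homogeneous_ext 𝓒 fun i c hc => TensorProduct.ext (Zh.linear_ext fun j => ?_)
    ext b
    have hE : E (c ⊗ₜ (gp k j ⊗ₜ b)) = sgn k (i * j) • bosEquiv hC hev
        (Bos.pair _ (gp k (i + j) ⊗ₜ Double.pair 𝓒 𝓑 ev (c ⊗ₜ b))) := by
      simp [E, twistZh_tmul_gp hc, ← TensorProduct.smul_tmul']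
      rfl
    refine Eq.trans ?_ hE.symm
    rw [Bos.pair_tmul, Double.pair_tmul, map_mul, Bos.inD_mul, map_mul, bosEquiv_inH,
      bosEquiv_inC hC hev hc, bosEquiv_inB, add_comm, ← gp_mul_gp, inH_mul, mul_assoc,
      ← mul_assoc (inH 𝓒 𝓑 ev (gp k i)), gp_mul_self_mul, ← mul_assoc, ← smul_mul_assoc,
      ← inC_mul_inH hc, mul_assoc]
    rfl
  rw [h]
  exact E.bijective

variable [Coalgebra k (Double 𝓒 𝓑 ev)] [Coalgebra k (Bos (Double.grading 𝓒 𝓑 ev))]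
  [Coalgebra k (DBos 𝓒 𝓑 ev)]

theorem isCoproduct (hC : IsSuperHopf 𝓒 SC) (hev : IsSuperDual 𝓒 𝓑 ev)
    (hD : Double.IsCoproduct 𝓒 𝓑 ev) (hH : Bos.IsCoproduct (Double.grading 𝓒 𝓑 ev))
    (hΔ : ∀ x, Coalgebra.comul (R := k) (bosEquiv hC hev x) =
      Algebra.TensorProduct.map (bosEquiv hC hev).toAlgHom (bosEquiv hC hev).toAlgHom
        (Coalgebra.comul (R := k) x))
    (hε : ∀ x, Coalgebra.counit (R := k) (bosEquiv hC hev x) = Coalgebra.counit (R := k) x) :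
    IsCoproduct 𝓒 𝓑 ev where
  isHopf := hH.isHopf.of_algEquiv _ hΔ hε
  triple_bijective := triple_bijective hC hev hD.pair_bijective
  comul_g := by
    rw [← bosEquiv_inH hC hev, hΔ, hH.comul_g]
    rfl
  comul_B b r := by
    rw [← bosEquiv_inB hC hev, hΔ, hH.comul_D _ (r.map (𝓐 := Double.grading 𝓒 𝓑 ev)
      (Double.inB 𝓒 𝓑 ev) (fun i x hx => Double.inB_mem hx) (hD.comul_B b)), map_sum]
    refine Finset.sum_congr rfl fun s _ => ?_
    rw [← bosEquiv_inB hC hev, ← bosEquiv_inB hC hev, ← bosEquiv_inH hC hev, ← map_mul]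
    rfl
  comul_C c t := by
    -- The expected coproduct as a linear function of `Δ c`, which reduces the claim to homogeneous
    -- `c` with a presentation of total degree `|c|`.
    let K : C ⊗[k] C →ₗ[k] DBos 𝓒 𝓑 ev ⊗[k] DBos 𝓒 𝓑 ev := ∑ i, TensorProduct.map
      (LinearMap.mulLeft k (inH 𝓒 𝓑 ev (gp k i)) ∘ₗ inC 𝓒 𝓑 ev) (inC 𝓒 𝓑 ev ∘ₗ pr 𝓒 i)
    have hK : ∀ x j, ∀ y ∈ 𝓒 j, K (x ⊗ₜ y) =
        (inH 𝓒 𝓑 ev (gp k j) * inC 𝓒 𝓑 ev x) ⊗ₜ inC 𝓒 𝓑 ev y := fun x j y hy => by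
      simp only [K, sum_zmod_two]
      rcases zmod_two_cases j with rfl | rfl
      · simp [pr_of_mem hy, pr_of_mem_ne hy (by decide : (0 : ZMod 2) ≠ 1)]
      · simp [pr_of_mem hy, pr_of_mem_ne hy (by decide : (1 : ZMod 2) ≠ 0)]
    have hK' : ∀ {c : C} (t : SuperRepr 𝓒 c), K (Coalgebra.comul c) =
        ∑ u, (inH 𝓒 𝓑 ev (gp k (t.deg₂ u)) * inC 𝓒 𝓑 ev (t.fst u)) ⊗ₜ[k] inC 𝓒 𝓑 ev (t.snd u) :=
      fun t => by
        rw [t.map_comul]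
        exact Finset.sum_congr rfl fun x _ => hK _ _ _ (t.snd_mem x)
    have hg : ∀ i, Coalgebra.comul (R := k) (Bos.inH (Double.grading 𝓒 𝓑 ev) (gp k i)) =
        Bos.inH _ (gp k i) ⊗ₜ Bos.inH _ (gp k i) := fun i => by
      rcases zmod_two_cases i with rfl | rfl
      · rw [gp_zero, Bos.inH_one, hH.isHopf.comul_one]; rfl
      · exact hH.comul_g
    -- In the bosonisation `c` corresponds to `g^{|c|} c`, with coproduct `g^{|c|} c₁ ⊗ g^{|c| +
    -- |c₁|} c₂`. The isomorphism adds `g^{|c₁|}` and `g^{|c₂|}`, which leaves `g^{|c₂|} c₁ ⊗ c₂`.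
    have h : Coalgebra.comul ∘ₗ inC 𝓒 𝓑 ev = K ∘ₗ Coalgebra.comul :=
      homogeneous_ext 𝓒 fun i c hc => by
        obtain ⟨t, ht⟩ := hC.comul_graded i c hc
        rw [LinearMap.comp_apply, LinearMap.comp_apply, hK' t, ← bosEquiv_gp_mul_inC hC hev hc, hΔ,
          hH.isHopf.comul_mul, hg, hH.comul_D _ (t.map (𝓐 := Double.grading 𝓒 𝓑 ev)
            (Double.inC 𝓒 𝓑 ev) (fun i x hx => Double.inC_mem hx) (hD.comul_C c)),
          Finset.mul_sum, map_sum]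
        refine Finset.sum_congr rfl fun s _ => ?_
        rw [Algebra.TensorProduct.tmul_mul_tmul, Algebra.TensorProduct.map_tmul]
        congr 1
        · refine (map_mul (bosEquiv hC hev) _ _).trans ?_
          refine (congrArg₂ (· * ·) (bosEquiv_inH hC hev _)
            (bosEquiv_inC hC hev (t.fst_mem s))).trans ?_
          change inH 𝓒 𝓑 ev _ * (inH 𝓒 𝓑 ev _ * inC 𝓒 𝓑 ev _) = _
          rw [← ht s, ← mul_assoc, ← inH_mul, gp_mul_gp, add_right_comm, CharTwo.add_self_eq_zero,
            zero_add]
        · rw [← bosEquiv_gp_mul_inC hC hev (t.snd_mem s), ← mul_assoc, ← Bos.inH_mul, gp_mul_gp]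
          have : i + (t.map (𝓐 := Double.grading 𝓒 𝓑 ev)
            (Double.inC 𝓒 𝓑 ev) (fun i x hx => Double.inC_mem hx) (hD.comul_C c)).deg₁ s =
              t.deg₂ s := by
            rw [← ht s]
            exact (by decide : ∀ a b : ZMod 2, a + b + a = b) _ _
          rw [this]
          rfl
    rw [← hK' t]
    exact LinearMap.congr_fun h c
  counit_g := by rw [← bosEquiv_inH hC hev, hε, hH.counit_g]
  counit_B b := by rw [← bosEquiv_inB hC hev, hε, hH.counit_D, hD.counit_B]
  counit_C c := by
    have hg : ∀ i, Coalgebra.counit (R := k) (Bos.inH (Double.grading 𝓒 𝓑 ev) (gp k i)) = 1 :=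
      fun i => by
        rcases zmod_two_cases i with rfl | rfl
        · rw [gp_zero, Bos.inH_one, hH.isHopf.counit_one]
        · exact hH.counit_g
    have h : Coalgebra.counit (R := k) ∘ₗ inC 𝓒 𝓑 ev = Coalgebra.counit :=
      homogeneous_ext 𝓒 fun i c hc => by
        rw [LinearMap.comp_apply, ← bosEquiv_gp_mul_inC hC hev hc, hε, hH.isHopf.counit_mul, hg,
          one_mul, hH.counit_D, hD.counit_C]
    exact LinearMap.congr_fun h c

end Coproduct

end DBos

end SuperDouble

end

/-! ### Assembly of the three structures and the isomorphism -/

theorem proposition4p2 {k : Type*} [Field k] (h2 : (2 : k) ≠ 0)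
    {B : Type*} [Ring B] [Algebra k B] [Coalgebra k B]
    (𝓑 : ZMod 2 → Submodule k B) [GradedAlgebra 𝓑]
    (SB : B →ₗ[k] B) (hB : SuperDouble.IsSuperHopf 𝓑 SB)
    {C : Type*} [Ring C] [Algebra k C] [Coalgebra k C]
    (𝓒 : ZMod 2 → Submodule k C) [GradedAlgebra 𝓒]
    (SC : C →ₗ[k] C) (hC : SuperDouble.IsSuperHopf 𝓒 SC) (hSC : Function.Bijective SC)
    (ev : C →ₗ[k] B →ₗ[k] k) (hev : SuperDouble.IsSuperDual 𝓒 𝓑 ev) :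
    ∃ (_ : GradedAlgebra (SuperDouble.Double.grading 𝓒 𝓑 ev))
      (_ : Coalgebra k (SuperDouble.Double 𝓒 𝓑 ev))
      (_ : Coalgebra k (SuperDouble.Bos (SuperDouble.Double.grading 𝓒 𝓑 ev)))
      (_ : Coalgebra k (SuperDouble.DBos 𝓒 𝓑 ev)),
      SuperDouble.Double.IsCoproduct 𝓒 𝓑 ev ∧
      SuperDouble.Bos.IsCoproduct (SuperDouble.Double.grading 𝓒 𝓑 ev) ∧
      SuperDouble.DBos.IsCoproduct 𝓒 𝓑 ev ∧
      ∃ θ : SuperDouble.Bos (SuperDouble.Double.grading 𝓒 𝓑 ev) ≃ₐc[k] SuperDouble.DBos 𝓒 𝓑 ev,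
        θ (SuperDouble.Bos.inH _ (SuperDouble.gp k 1)) =
            SuperDouble.DBos.inH 𝓒 𝓑 ev (SuperDouble.gp k 1) ∧
        (∀ b : B, θ (SuperDouble.Bos.inD _ (SuperDouble.Double.inB 𝓒 𝓑 ev b)) =
            SuperDouble.DBos.inB 𝓒 𝓑 ev b) ∧
        (∀ (i : ZMod 2) (c : C), c ∈ 𝓒 i →
          θ (SuperDouble.Bos.inD _ (SuperDouble.Double.inC 𝓒 𝓑 ev c)) =
            SuperDouble.DBos.inH 𝓒 𝓑 ev (SuperDouble.gp k i) * SuperDouble.DBos.inC 𝓒 𝓑 ev c) := by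
  have := hB.isSuperCoalgebra
  have := hC.isSuperCoalgebra
  let _ := SuperDouble.Double.gradedAlgebra h2 hC hSC hev
  have hp := SuperDouble.Double.pair_bijective hC hSC hB hev
  let _ := SuperDouble.coalgebraOfEquiv (SuperDouble.Double.pairEquiv hp)
  have hD : SuperDouble.Double.IsCoproduct 𝓒 𝓑 ev :=
    SuperDouble.Double.isCoproduct hC hSC hB hev hp
  obtain ⟨S, hS⟩ := hD.isSuperHopf
  let _ : Coalgebra k (SuperDouble.Bos (SuperDouble.Double.grading 𝓒 𝓑 ev)) :=
    (SuperDouble.Bos.bialgebra hS).toCoalgebra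
  have hH : SuperDouble.Bos.IsCoproduct (SuperDouble.Double.grading 𝓒 𝓑 ev) :=
    SuperDouble.Bos.isCoproduct hS (fun _ => rfl) fun _ => rfl
  let e := SuperDouble.DBos.bosEquiv hC hev
  -- Transporting the coalgebra structure along `e` makes the isomorphism a coalgebra map by
  -- construction.
  let _ := SuperDouble.coalgebraOfEquiv e.toLinearEquiv
  let f := SuperDouble.coalgHomOfEquiv e.toLinearEquiv
  refine ⟨‹_›, ‹_›, ‹_›, ‹_›, hD, hH, SuperDouble.DBos.isCoproduct hC hev hD hH
    (fun x => (CoalgHomClass.map_comp_comul_apply f x).symm)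
    (fun x => CoalgHomClass.counit_comp_apply f x),
    { f, e with }, SuperDouble.DBos.bosEquiv_inH hC hev _, SuperDouble.DBos.bosEquiv_inB hC hev,
    fun i c hc => SuperDouble.DBos.bosEquiv_inC hC hev hc⟩
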